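/- Let $n\ge 1$ and $k\ge 3$ be integers, $\epsilon>0$, and let $Q$ be a nonempty compact convex set of real symmetric $n\times n$ matrices. For symmetric $X$ and $z=(z_1,\dots,z_k)\in(\mathbb R^n)^k$ put $$F_k(X;z)=\max_{1\le i\le k}\lambda_{\max}\Big(X+\frac{\epsilon}{n}z_iz_i^T\Big),\qquad \mathsf F_k(X)=\mathbf E\,[F_k(X;z)]\ \text{ with } z_1,\dots,z_k \text{ i.i.d. } \mathcal N(0,I_n),\qquad \mathsf F_k^*=\min_{X\in Q}\mathsf F_k(X),\qquad C_k=\frac{k}{k-2}.$$ Let $\langle A,B\rangle=\operatorname{Tr}(A^TB)$, $\omega(X)=\frac12\|X\|_F^2$, $D=D_{\omega,Q}=(\max_Q\omega-\min_Q\omega)^{1/2}$ and $V(X,Y)=\omega(Y)-\omega(X)-\langle X,Y-X\rangle$. Stochastic oracle: for $q\ge 1$ and $q$ independent samples $z^{(1)},\dots,z^{(q)}$, each made of $k$ i.i.d. $\mathcal N(0,I_n)$ vectors, $$G\big(X,(z^{(l)})_{l\le q}\big)=\frac1q\sum_{l=1}^q\phi_l\phi_l^T,$$ where $\phi_l=\Phi(X,z^{(l)})$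 and $\Phi$ is a fixed measurable rule which returns, for every symmetric $X$ and every $z$, a unit leading eigenvector of $X+\frac{\epsilon}{n}z_{i_0}z_{i_0}^T$ for some $i_0\in\operatorname{argmax}_{i}\lambda_{\max}(X+\frac{\epsilon}{n}z_iz_i^T)$. AC-SA with $N$ iterations: let $L=C_kn/\epsilon$, $\sigma^2=1/q$, $\beta_t=\frac{t+1}{2}$ and $$\gamma_t=\frac{t+1}{2}\,\min\Big\{\frac{1}{2L},\ \frac{\sqrt6\,D}{(N+2)^{3/2}\sigma}\Big\}.$$ Start from $X_1=X_1^{ag}=\operatorname{argmin}_{Q}\omega$ and, for $t=1,\dots,N$, with a fresh independent batch $\xi_t$ of $q$ samples, $$X_t^{md}=\beta_t^{-1}X_t+(1-\beta_t^{-1})X_t^{ag},\quad X_{t+1}=\operatorname*{argmin}_{W\in Q}\big\{\gamma_t\langle G(X_t^{md},\xi_t),W-X_t\rangle+V(X_t,W)\big\},\quad X_{t+1}^{ag}=\beta_t^{-1}X_{t+1}+(1-\beta_t^{-1})X_t^{ag}.$$ Then $F_k(Y;\cdot)$ is integrable for every $Y\in Q$, the minimum $\mathsf F_k^*$ is attained,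 $\mathsf F_k(X_{N+1}^{ag})$ is integrable, and: (i) for all integers $N\ge1$ and $q\ge1$, $$\mathbf E\big[\mathsf F_k(X_{N+1}^{ag})-\mathsf F_k^*\big]\le\frac{8nC_kD^2}{\epsilon N(N+2)}+\frac{4\sqrt2\,D}{\sqrt{Nq}};$$ (ii) for the choice $N=\lceil 2D\sqrt n/\epsilon\rceil$ and $q=\lceil\max\{1,D/(\epsilon\sqrt n)\}\rceil$, $$\mathbf E\big[\mathsf F_k(X_{N+1}^{ag})-\mathsf F_k^*\big]\le(2C_k+4)\,\epsilon\le 10\,\epsilon,$$ so accuracy $O(\epsilon)$ is reached within $\lceil 2D\sqrt n/\epsilon\rceil$ iterations. -/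

import Mathlib

open MeasureTheory ProbabilityTheory

noncomputable section

namespace StochSmooth

/-- Largest eigenvalue of a (symmetric) real matrix: the largest element of its real spectrum. -/
def lambdaMax {n : ℕ} (A : Matrix (Fin n) (Fin n) ℝ) : ℝ :=
  sSup (spectrum ℝ A)

/-- The rank one perturbation `X + (ε / n) v vᵀ`. -/
def perturb {n : ℕ} (ε : ℝ) (X : Matrix (Fin n) (Fin n) ℝ) (v : Fin n → ℝ) :
    Matrix (Fin n) (Fin n) ℝ :=
  X + (ε / n) • Matrix.vecMulVec v v

/-- The random function `F_k(X) = max_{i ≤ k} λ_max (X + (ε / n) z_i z_iᵀ)`, as a function of the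
sample `z = (z_1, …, z_k)`. -/
def sampleF {n k : ℕ} (ε : ℝ) (X : Matrix (Fin n) (Fin n) ℝ) (z : Fin k → Fin n → ℝ) : ℝ :=
  ⨆ i : Fin k, lambdaMax (perturb ε X (z i))

/-- The law `𝒩(0, I_n)` on `ℝⁿ`. -/
def gaussianVec (n : ℕ) : Measure (Fin n → ℝ) :=
  Measure.pi fun _ : Fin n => gaussianReal 0 1

/-- The joint law of `k` independent `𝒩(0, I_n)` vectors. -/
def gaussianSample (n k : ℕ) : Measure (Fin k → Fin n → ℝ) :=
  Measure.pi fun _ : Fin k => gaussianVec n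

/-- The smoothed objective `E [max_{i ≤ k} λ_max (X + (ε / n) z_i z_iᵀ)]`. -/
def smoothF {n : ℕ} (k : ℕ) (ε : ℝ) (X : Matrix (Fin n) (Fin n) ℝ) : ℝ :=
  ∫ z, sampleF ε X z ∂(gaussianSample n k)

/-- Optimal value of the smoothed objective on `Q`. -/
def smoothOpt {n : ℕ} (k : ℕ) (ε : ℝ) (Q : Set (Matrix (Fin n) (Fin n) ℝ)) : ℝ :=
  sInf (smoothF k ε '' Q)

/-- `C_k = k / (k - 2)`. -/
def constC (k : ℕ) : ℝ := (k : ℝ) / ((k : ℝ) - 2)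

/-- The Frobenius (trace) inner product `⟨A, B⟩ = Tr (Aᵀ B)`. -/
def frobInner {n : ℕ} (A B : Matrix (Fin n) (Fin n) ℝ) : ℝ :=
  (A.transpose * B).trace

/-- The distance generating function `ω(X) = ‖X‖_F² / 2`; its strong convexity modulus with respect
to the Frobenius norm is `α = 1`, and `∇ω(X) = X`. -/
def dgf {n : ℕ} (X : Matrix (Fin n) (Fin n) ℝ) : ℝ :=
  frobInner X X / 2

/-- The prox-function `V(X, Y) = ω(Y) - [ω(X) + ⟨∇ω(X), Y - X⟩]`. -/
def proxV {n : ℕ} (X Y : Matrix (Fin n) (Fin n) ℝ) : ℝ :=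
  dgf Y - (dgf X + frobInner X (Y - X))

/-- The `ω`-diameter `D_{ω,Q} = (max_Q ω - min_Q ω)^{1/2}`. -/
def diam {n : ℕ} (Q : Set (Matrix (Fin n) (Fin n) ℝ)) : ℝ :=
  Real.sqrt (sSup (dgf '' Q) - sInf (dgf '' Q))

/-- `IsProxStep Q X Y Z`: the point `Z` is the value at `Y` of the prox-mapping with centre `X`,
i.e. it minimizes `⟨Y, W - X⟩ + V(X, W)` over `W ∈ Q`. -/
def IsProxStep {n : ℕ} (Q : Set (Matrix (Fin n) (Fin n) ℝ))
    (X Y Z : Matrix (Fin n) (Fin n) ℝ) : Prop :=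
  Z ∈ Q ∧ IsMinOn (fun W => frobInner Y (W - X) + proxV X W) Q Z

/-- `Φ` is a (measurable) rule which returns, for every symmetric matrix `X` and every sample
`z = (z_1, …, z_k)`, a unit leading eigenvector of `X + (ε / n) z_{i₀} z_{i₀}ᵀ`, where `i₀`
maximizes `λ_max (X + (ε / n) z_i z_iᵀ)` over `i`. -/
structure IsLeadingEigenvectorRule {n k : ℕ} (ε : ℝ)
    (Φ : Matrix (Fin n) (Fin n) ℝ → (Fin k → Fin n → ℝ) → (Fin n → ℝ)) : Prop where
  measurable : Measurable fun p : (Fin n → Fin n → ℝ) × (Fin k → Fin n → ℝ) =>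
    Φ (Matrix.of p.1) p.2
  unit : ∀ X : Matrix (Fin n) (Fin n) ℝ, X.IsSymm → ∀ z, Φ X z ⬝ᵥ Φ X z = 1
  leading : ∀ X : Matrix (Fin n) (Fin n) ℝ, X.IsSymm → ∀ z, ∃ i₀ : Fin k,
    (∀ i, lambdaMax (perturb ε X (z i)) ≤ lambdaMax (perturb ε X (z i₀))) ∧
    (perturb ε X (z i₀)).mulVec (Φ X z) = lambdaMax (perturb ε X (z i₀)) • Φ X z

/-- The stochastic gradient oracle `G(X, z) = (1 / q) ∑_{l ≤ q} φ_l φ_lᵀ`, where `φ_l` is computed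
from the `l`-th sample `z l` of `k` vectors. -/
def oracle {n k q : ℕ}
    (Φ : Matrix (Fin n) (Fin n) ℝ → (Fin k → Fin n → ℝ) → (Fin n → ℝ))
    (X : Matrix (Fin n) (Fin n) ℝ) (z : Fin q → Fin k → Fin n → ℝ) :
    Matrix (Fin n) (Fin n) ℝ :=
  (1 / (q : ℝ)) • ∑ l : Fin q, Matrix.vecMulVec (Φ X (z l)) (Φ X (z l))

/-- `β_t = (t + 1) / 2`. -/
def stepBeta (t : ℕ) : ℝ := ((t : ℝ) + 1) / 2

/-- The step size `γ_t = (t + 1) / 2 · min {1 / (2 L), √6 D / ((N + 2)^{3/2} σ)}` of the AC-SA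
method for a differentiable objective with `L`-Lipschitz gradient, an oracle with variance at most
`σ²`, `N` iterations, and a distance generating function of modulus `1` and diameter `D`. -/
def stepGamma (L σ D : ℝ) (N t : ℕ) : ℝ :=
  ((t : ℝ) + 1) / 2 * min (1 / (2 * L)) (Real.sqrt 6 * D / (((N : ℝ) + 2) ^ (3 / 2 : ℝ) * σ))

/-- One trajectory of `N` iterations of the AC-SA method for minimizing the smoothed objective on
`Q`, with `L = C_k n / ε` and `σ² = 1 / q`, when the samples used are `z`. The sequences
`X t`, `Xmd t`, `Xag t` are indexed from `t = 1`; iteration `t = s + 1` uses the samples `z s`. -/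
structure IsACSARun {n k N q : ℕ} (ε : ℝ) (Q : Set (Matrix (Fin n) (Fin n) ℝ))
    (Φ : Matrix (Fin n) (Fin n) ℝ → (Fin k → Fin n → ℝ) → (Fin n → ℝ))
    (z : Fin N → Fin q → Fin k → Fin n → ℝ)
    (X Xmd Xag : ℕ → Matrix (Fin n) (Fin n) ℝ) : Prop where
  init_mem : X 1 ∈ Q
  init_min : IsMinOn dgf Q (X 1)
  init_ag : Xag 1 = X 1
  md_step : ∀ s : Fin N, Xmd ((s : ℕ) + 1) =
    (stepBeta ((s : ℕ) + 1))⁻¹ • X ((s : ℕ) + 1) + (1 - (stepBeta ((s : ℕ) + 1))⁻¹) • Xag ((s : ℕ) + 1)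
  prox_step : ∀ s : Fin N, IsProxStep Q (X ((s : ℕ) + 1))
    (stepGamma (constC k * n / ε) (Real.sqrt (1 / (q : ℝ))) (diam Q) N ((s : ℕ) + 1) •
      oracle Φ (Xmd ((s : ℕ) + 1)) (z s)) (X ((s : ℕ) + 2))
  ag_step : ∀ s : Fin N, Xag ((s : ℕ) + 2) =
    (stepBeta ((s : ℕ) + 1))⁻¹ • X ((s : ℕ) + 2) + (1 - (stepBeta ((s : ℕ) + 1))⁻¹) • Xag ((s : ℕ) + 1)

end StochSmooth

end

/-! Only two properties of the smoothed objective enter the convergence argument: convexity, with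
`meanOracle` (the expectation of φφᵀ) as a subgradient, and the descent inequality `smoothF_descent`
with constant M = (n/ε)(C_k + 3/4). Differentiability is never needed. This M exceeds the L = C_k
n/ε of the step sizes, but the factor 1/(2L) leaves room: since C_k ≥ 1, M/(2L) ≤ 7/8, and the slack
absorbs the noise in `accelerated_step`.

The descent inequality comes from semiconcavity. Put r = n/ε. At a diagonal matrix with entries μ,
and for s above all μ_j, the sampled objective is at most s exactly when every z_i lies in the
ellipsoid ∑ v_j²/(s - μ_j) ≤ r. Its distribution function is therefore G(s - μ)^k, with G the
Gaussian mass of an ellipsoid, and its mean is a tail integral of 1 - G^k. Semiconcavity thus asks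
for a lower bound on the second derivative of G^k, integrated over s. After rescaling, G is a
Gaussian integral over a fixed ball, and the second derivative of log G in a direction e is a
quarter of the difference between the truncated and the untruncated variance of ∑ e_i w_i².
Integrating by parts over the ball, with a boundary term of known sign, shows that the deficit is at
most (1/min m + 3r/4)|e|² times the s-derivative of log G (`sum_sq_sub_ballVar_le`). With u = s -
max μ it remains to bound ∫ (1/u + 3r/4) d(G^k). An integration by parts in u turns the first term
into ∫ G^k/u² du ≤ r k E[1/χ²_k] = r C_k, and the second contributes at most 3r/4
(`lintegral_levelRate_mul_le`).

The objective is invariant under orthogonal conjugation. By Davis' argument (Birkhoff's theorem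
applied to the squared entries of an orthogonal matrix), semiconcavity passes from diagonal to all
symmetric matrices (`smoothF_semiconcave`).

The stochastic part is the accelerated scheme: a pathwise telescoped inequality
(`IsACSARun.gap_le`), an unbiased oracle with variance at most 1/q, and the fact that an iterate
depends only on earlier batches, so that the linear error terms have mean zero. The constants are
collected in `rate_bound` and `complexity_bound`. -/

namespace StochSmooth

open Matrix

variable {n k : ℕ}

/-! ### The largest eigenvalue -/

/-- Spectral theorem for real symmetric matrices. -/
theorem exists_orthogonal_diagonalization {A : Matrix (Fin n) (Fin n) ℝ} (hA : A.IsSymm) :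
    ∃ (U : Matrix (Fin n) (Fin n) ℝ) (μ : Fin n → ℝ), U * Uᵀ = 1 ∧ Uᵀ * U = 1 ∧
      A = U * diagonal μ * Uᵀ ∧ spectrum ℝ A = Set.range μ := by
  have hA' : A.IsHermitian := by
    rw [Matrix.IsHermitian, conjTranspose_eq_transpose_of_trivial]; exact hA
  refine ⟨hA'.eigenvectorUnitary, hA'.eigenvalues, ?_, ?_, ?_, hA'.spectrum_real_eq_range_eigenvalues⟩
  · have h := (Unitary.mem_iff.1 hA'.eigenvectorUnitary.2).2
    rwa [star_eq_conjTranspose, conjTranspose_eq_transpose_of_trivial] at h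
  · have h := (Unitary.mem_iff.1 hA'.eigenvectorUnitary.2).1
    rwa [star_eq_conjTranspose, conjTranspose_eq_transpose_of_trivial] at h
  · have h := hA'.spectral_theorem
    rw [Unitary.conjStarAlgAut_apply] at h
    simpa [star_eq_conjTranspose, conjTranspose_eq_transpose_of_trivial, Function.comp_def] using h

theorem dotProduct_conj_mulVec (U B : Matrix (Fin n) (Fin n) ℝ) (x : Fin n → ℝ) :
    x ⬝ᵥ (U * B * Uᵀ) *ᵥ x = (Uᵀ *ᵥ x) ⬝ᵥ B *ᵥ (Uᵀ *ᵥ x) := by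
  rw [← mulVec_mulVec, ← mulVec_mulVec, dotProduct_mulVec, ← mulVec_transpose]

theorem dotProduct_orthogonal_mulVec {U : Matrix (Fin n) (Fin n) ℝ} (hU : Uᵀ * U = 1)
    (x y : Fin n → ℝ) : (U *ᵥ x) ⬝ᵥ (U *ᵥ y) = x ⬝ᵥ y := by
  rw [dotProduct_mulVec, ← mulVec_transpose, mulVec_mulVec, hU, one_mulVec]

theorem dotProduct_diagonal_mulVec (μ x : Fin n → ℝ) :
    x ⬝ᵥ (diagonal μ) *ᵥ x = ∑ i, μ i * x i ^ 2 := by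
  simp only [dotProduct, mulVec_diagonal]
  exact Finset.sum_congr rfl fun i _ => by ring

/-- This removes eigenvalues from the sequel: every statement about `sampleF` becomes a family of
inequalities affine in `X` and quadratic in the sample. -/
theorem lambdaMax_le_iff (hn : 0 < n) {A : Matrix (Fin n) (Fin n) ℝ} (hA : A.IsSymm) (s : ℝ) :
    lambdaMax A ≤ s ↔ ∀ x : Fin n → ℝ, x ⬝ᵥ A *ᵥ x ≤ s * (x ⬝ᵥ x) := by
  have : Nonempty (Fin n) := ⟨⟨0, hn⟩⟩
  obtain ⟨U, μ, h1, h2, h3, h4⟩ := exists_orthogonal_diagonalization hA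
  rw [lambdaMax, h4, csSup_le_iff (Set.finite_range μ).bddAbove (Set.range_nonempty μ)]
  rw [Set.forall_mem_range]
  have h1' : (Uᵀ)ᵀ * Uᵀ = 1 := by rw [transpose_transpose, h1]
  constructor
  · intro h x
    rw [h3, dotProduct_conj_mulVec, dotProduct_diagonal_mulVec,
      ← dotProduct_orthogonal_mulVec h1' x x, dotProduct, Finset.mul_sum]
    refine Finset.sum_le_sum fun i _ => ?_
    rw [← pow_two]
    exact mul_le_mul_of_nonneg_right (h i) (sq_nonneg _)
  · intro h i
    have := h (U *ᵥ Pi.single i 1)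
    rw [h3, dotProduct_conj_mulVec, dotProduct_diagonal_mulVec, dotProduct_orthogonal_mulVec h2,
      mulVec_mulVec, h2, one_mulVec] at this
    simpa [Pi.single_apply] using this

theorem perturb_isSymm {ε : ℝ} {X : Matrix (Fin n) (Fin n) ℝ} (hX : X.IsSymm) (v : Fin n → ℝ) :
    (perturb ε X v).IsSymm := by
  have : (vecMulVec v v).IsSymm := by
    ext i j; simp [vecMulVec_apply, mul_comm]
  exact hX.add (this.smul _)

theorem dotProduct_perturb (ε : ℝ) (X : Matrix (Fin n) (Fin n) ℝ) (v x : Fin n → ℝ) :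
    x ⬝ᵥ (perturb ε X v) *ᵥ x = x ⬝ᵥ X *ᵥ x + ε / n * (v ⬝ᵥ x) ^ 2 := by
  rw [perturb, add_mulVec, dotProduct_add, smul_mulVec, dotProduct_smul, vecMulVec_mulVec]
  simp only [op_smul_eq_smul, dotProduct_smul, smul_eq_mul, dotProduct_comm x v]
  ring

theorem sampleF_le_iff (hn : 0 < n) (hk : 0 < k) {ε : ℝ} {X : Matrix (Fin n) (Fin n) ℝ}
    (hX : X.IsSymm) (z : Fin k → Fin n → ℝ) (s : ℝ) :
    sampleF ε X z ≤ s ↔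
      ∀ i, ∀ x : Fin n → ℝ, x ⬝ᵥ X *ᵥ x + ε / n * (z i ⬝ᵥ x) ^ 2 ≤ s * (x ⬝ᵥ x) := by
  have : Nonempty (Fin k) := ⟨⟨0, hk⟩⟩
  rw [sampleF, ciSup_le_iff (Set.finite_range _).bddAbove]
  refine forall_congr' fun i => ?_
  rw [lambdaMax_le_iff hn (perturb_isSymm hX _)]
  simp only [dotProduct_perturb]

theorem le_sampleF (hn : 0 < n) (hk : 0 < k) {ε : ℝ} {X : Matrix (Fin n) (Fin n) ℝ}
    (hX : X.IsSymm) (z : Fin k → Fin n → ℝ) (i : Fin k) (x : Fin n → ℝ) :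
    x ⬝ᵥ X *ᵥ x + ε / n * (z i ⬝ᵥ x) ^ 2 ≤ sampleF ε X z * (x ⬝ᵥ x) :=
  (sampleF_le_iff hn hk hX z _).1 le_rfl i x

theorem conj_isSymm {X : Matrix (Fin n) (Fin n) ℝ} (hX : X.IsSymm)
    (U : Matrix (Fin n) (Fin n) ℝ) : (U * X * Uᵀ).IsSymm := by
  rw [Matrix.IsSymm, transpose_mul, transpose_mul, transpose_transpose, hX.eq, Matrix.mul_assoc]

theorem sampleF_conj (hn : 0 < n) (hk : 0 < k) {ε : ℝ} {X U : Matrix (Fin n) (Fin n) ℝ}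
    (hX : X.IsSymm) (h1 : U * Uᵀ = 1) (h2 : Uᵀ * U = 1) (z : Fin k → Fin n → ℝ) :
    sampleF ε (U * X * Uᵀ) (fun i => U *ᵥ z i) = sampleF ε X z := by
  refine eq_of_forall_ge_iff fun s => ?_
  rw [sampleF_le_iff hn hk (conj_isSymm hX U), sampleF_le_iff hn hk hX]
  have h1' : (Uᵀ)ᵀ * Uᵀ = 1 := by rw [transpose_transpose, h1]
  have key : ∀ (v x : Fin n → ℝ), (U *ᵥ v) ⬝ᵥ x = v ⬝ᵥ (Uᵀ *ᵥ x) := fun v x => by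
    rw [← dotProduct_orthogonal_mulVec h2 v, mulVec_mulVec, h1, one_mulVec]
  constructor
  · intro h i x
    have := h i (U *ᵥ x)
    rwa [dotProduct_conj_mulVec, dotProduct_orthogonal_mulVec h2, dotProduct_orthogonal_mulVec h2,
      mulVec_mulVec, h2, one_mulVec] at this
  · intro h i x
    have := h i (Uᵀ *ᵥ x)
    rwa [dotProduct_orthogonal_mulVec h1', ← key, ← dotProduct_conj_mulVec] at this

/-! ### The Frobenius inner product -/

theorem frobInner_eq_sum (A B : Matrix (Fin n) (Fin n) ℝ) :
    frobInner A B = ∑ i, ∑ j, A i j * B i j := by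
  rw [frobInner, trace, Finset.sum_comm]
  simp [mul_apply]

theorem frobInner_comm (A B : Matrix (Fin n) (Fin n) ℝ) : frobInner A B = frobInner B A := by
  simp only [frobInner_eq_sum, mul_comm]

theorem frobInner_add_left (A B C : Matrix (Fin n) (Fin n) ℝ) :
    frobInner (A + B) C = frobInner A C + frobInner B C := by
  simp [frobInner, add_mul]

theorem frobInner_add_right (A B C : Matrix (Fin n) (Fin n) ℝ) :
    frobInner A (B + C) = frobInner A B + frobInner A C := by
  simp [frobInner, mul_add]

theorem frobInner_sub_left (A B C : Matrix (Fin n) (Fin n) ℝ) :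
    frobInner (A - B) C = frobInner A C - frobInner B C := by
  simp [frobInner, sub_mul]

theorem frobInner_sub_right (A B C : Matrix (Fin n) (Fin n) ℝ) :
    frobInner A (B - C) = frobInner A B - frobInner A C := by
  simp [frobInner, mul_sub]

theorem frobInner_smul_left (c : ℝ) (A B : Matrix (Fin n) (Fin n) ℝ) :
    frobInner (c • A) B = c * frobInner A B := by
  simp [frobInner]

theorem frobInner_smul_right (c : ℝ) (A B : Matrix (Fin n) (Fin n) ℝ) :
    frobInner A (c • B) = c * frobInner A B := by
  simp [frobInner]

theorem frobInner_self_nonneg (A : Matrix (Fin n) (Fin n) ℝ) : 0 ≤ frobInner A A := by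
  rw [frobInner_eq_sum]
  exact Finset.sum_nonneg fun i _ => Finset.sum_nonneg fun j _ => mul_self_nonneg _

theorem frobInner_eq_sum_prod (A B : Matrix (Fin n) (Fin n) ℝ) :
    frobInner A B = ∑ p : Fin n × Fin n, A p.1 p.2 * B p.1 p.2 := by
  rw [frobInner_eq_sum, Fintype.sum_prod_type]

theorem frobInner_self_eq_zero {A : Matrix (Fin n) (Fin n) ℝ} (h : frobInner A A = 0) : A = 0 := by
  rw [frobInner_eq_sum_prod, Fintype.sum_eq_zero_iff_of_nonneg fun p => mul_self_nonneg _] at h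
  ext i j
  simpa using congrFun h (i, j)

theorem frobInner_vecMulVec (φ : Fin n → ℝ) (H : Matrix (Fin n) (Fin n) ℝ) :
    frobInner (vecMulVec φ φ) H = φ ⬝ᵥ H *ᵥ φ := by
  simp only [frobInner_eq_sum, vecMulVec_apply, dotProduct, mulVec, Finset.mul_sum]
  exact Finset.sum_congr rfl fun i _ => Finset.sum_congr rfl fun j _ => by ring

theorem frobInner_mul_le (A B : Matrix (Fin n) (Fin n) ℝ) :
    frobInner A B ^ 2 ≤ frobInner A A * frobInner B B := by
  simp only [frobInner_eq_sum_prod, ← pow_two]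
  exact Finset.sum_mul_sq_le_sq_mul_sq Finset.univ (fun p : Fin n × Fin n => A p.1 p.2)
    fun p => B p.1 p.2

/-- The Frobenius norm. -/
noncomputable def frobNorm (A : Matrix (Fin n) (Fin n) ℝ) : ℝ := Real.sqrt (frobInner A A)

theorem frobNorm_nonneg (A : Matrix (Fin n) (Fin n) ℝ) : 0 ≤ frobNorm A := Real.sqrt_nonneg _

theorem frobNorm_sq (A : Matrix (Fin n) (Fin n) ℝ) : frobNorm A ^ 2 = frobInner A A :=
  Real.sq_sqrt (frobInner_self_nonneg A)

theorem abs_frobInner_le (A B : Matrix (Fin n) (Fin n) ℝ) :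
    |frobInner A B| ≤ frobNorm A * frobNorm B := by
  rw [frobNorm, frobNorm, ← Real.sqrt_mul (frobInner_self_nonneg A)]
  exact Real.abs_le_sqrt (frobInner_mul_le A B)

theorem frobNorm_vecMulVec (x : Fin n → ℝ) : frobNorm (vecMulVec x x) = x ⬝ᵥ x := by
  have h : 0 ≤ x ⬝ᵥ x := Finset.sum_nonneg fun i _ => mul_self_nonneg _
  rw [frobNorm, frobInner_vecMulVec, vecMulVec_mulVec]
  simp only [op_smul_eq_smul, dotProduct_smul, smul_eq_mul]
  exact Real.sqrt_mul_self h

theorem abs_dotProduct_mulVec_le (H : Matrix (Fin n) (Fin n) ℝ) (x : Fin n → ℝ) :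
    |x ⬝ᵥ H *ᵥ x| ≤ frobNorm H * (x ⬝ᵥ x) := by
  rw [← frobInner_vecMulVec, ← frobNorm_vecMulVec, mul_comm]
  exact abs_frobInner_le _ _

theorem frobNorm_sub_comm (A B : Matrix (Fin n) (Fin n) ℝ) : frobNorm (A - B) = frobNorm (B - A) := by
  simp only [frobNorm, frobInner_sub_left, frobInner_sub_right]
  congr 1; ring

theorem continuous_frobInner {α : Type*} [TopologicalSpace α] {f g : α → Matrix (Fin n) (Fin n) ℝ}
    (hf : Continuous f) (hg : Continuous g) : Continuous fun a => frobInner (f a) (g a) := by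
  unfold frobInner
  fun_prop

/-! ### The sampled objective -/

theorem sampleF_le_add (hn : 0 < n) (hk : 0 < k) {ε : ℝ} {X Y : Matrix (Fin n) (Fin n) ℝ}
    (hX : X.IsSymm) (hY : Y.IsSymm) (z : Fin k → Fin n → ℝ) :
    sampleF ε Y z ≤ sampleF ε X z + frobNorm (Y - X) := by
  rw [sampleF_le_iff hn hk hY]
  intro i x
  have h1 := le_sampleF hn hk hX z i x (ε := ε)
  have h2 := (abs_le.1 (abs_dotProduct_mulVec_le (Y - X) x)).2
  rw [sub_mulVec, dotProduct_sub] at h2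
  linarith

theorem neg_frobNorm_le_sampleF (hn : 0 < n) (hk : 0 < k) {ε : ℝ} (hε : 0 < ε)
    {X : Matrix (Fin n) (Fin n) ℝ} (hX : X.IsSymm) (z : Fin k → Fin n → ℝ) :
    -frobNorm X ≤ sampleF ε X z := by
  have h1 := le_sampleF hn hk hX z ⟨0, hk⟩ (Pi.single ⟨0, hn⟩ 1) (ε := ε)
  have h2 := (abs_le.1 (abs_dotProduct_mulVec_le X (Pi.single ⟨0, hn⟩ 1))).1
  have h3 : (Pi.single (⟨0, hn⟩ : Fin n) (1 : ℝ)) ⬝ᵥ Pi.single ⟨0, hn⟩ 1 = 1 := by simp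
  rw [h3] at h1 h2
  have : 0 ≤ ε / n * (z ⟨0, hk⟩ ⬝ᵥ Pi.single ⟨0, hn⟩ 1) ^ 2 := by positivity
  linarith

theorem sampleF_le_frobNorm_add (hn : 0 < n) (hk : 0 < k) {ε : ℝ} (hε : 0 < ε)
    {X : Matrix (Fin n) (Fin n) ℝ} (hX : X.IsSymm) (z : Fin k → Fin n → ℝ) :
    sampleF ε X z ≤ frobNorm X + ε / n * ∑ i, z i ⬝ᵥ z i := by
  rw [sampleF_le_iff hn hk hX]
  intro i x
  have h2 := (abs_le.1 (abs_dotProduct_mulVec_le X x)).2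
  have h3 : (z i ⬝ᵥ x) ^ 2 ≤ (z i ⬝ᵥ z i) * (x ⬝ᵥ x) := by
    simpa only [dotProduct, ← pow_two] using Finset.sum_mul_sq_le_sq_mul_sq Finset.univ (z i) x
  have h4 : z i ⬝ᵥ z i ≤ ∑ i, z i ⬝ᵥ z i :=
    Finset.single_le_sum (f := fun i => z i ⬝ᵥ z i)
      (fun j _ => Finset.sum_nonneg fun l _ => mul_self_nonneg _) (Finset.mem_univ i)
  have h5 : 0 ≤ x ⬝ᵥ x := Finset.sum_nonneg fun i _ => mul_self_nonneg _
  have h6 : 0 ≤ ε / n := by positivity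
  have h7 := mul_le_mul_of_nonneg_left (h3.trans (mul_le_mul_of_nonneg_right h4 h5)) h6
  nlinarith

/-- The returned eigenvector attains the maximum at `X` and is an admissible test vector at `Y` for
the same index, so the Rayleigh quotients differ exactly by the linear term. -/
theorem sampleF_subgradient (hn : 0 < n) (hk : 0 < k) {ε : ℝ}
    {Φ : Matrix (Fin n) (Fin n) ℝ → (Fin k → Fin n → ℝ) → (Fin n → ℝ)}
    (hΦ : IsLeadingEigenvectorRule ε Φ) {X Y : Matrix (Fin n) (Fin n) ℝ}
    (hX : X.IsSymm) (hY : Y.IsSymm) (z : Fin k → Fin n → ℝ) :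
    sampleF ε X z + frobInner (vecMulVec (Φ X z) (Φ X z)) (Y - X) ≤ sampleF ε Y z := by
  have : Nonempty (Fin k) := ⟨⟨0, hk⟩⟩
  obtain ⟨i, h1, h2⟩ := hΦ.leading X hX z
  have h3 := hΦ.unit X hX z
  have h4 : sampleF ε X z ≤ Φ X z ⬝ᵥ X *ᵥ Φ X z + ε / n * (z i ⬝ᵥ Φ X z) ^ 2 := by
    rw [← dotProduct_perturb, h2, dotProduct_smul, h3, smul_eq_mul, mul_one]
    exact ciSup_le h1
  have h5 := le_sampleF hn hk hY z i (Φ X z) (ε := ε)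
  rw [h3] at h5
  rw [frobInner_vecMulVec, sub_mulVec, dotProduct_sub]
  linarith

/-- Sublevel sets are intersections of closed conditions, one for each index and test vector, so the
function is lower semicontinuous. -/
theorem measurable_sampleF (hn : 0 < n) (hk : 0 < k) {ε : ℝ} {X : Matrix (Fin n) (Fin n) ℝ}
    (hX : X.IsSymm) : Measurable fun z : Fin k → Fin n → ℝ => sampleF ε X z := by
  refine measurable_of_Iic fun s => IsClosed.measurableSet ?_
  have : (fun z : Fin k → Fin n → ℝ => sampleF ε X z) ⁻¹' Set.Iic s =
      ⋂ i, ⋂ x : Fin n → ℝ,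
        {z | x ⬝ᵥ X *ᵥ x + ε / n * (z i ⬝ᵥ x) ^ 2 ≤ s * (x ⬝ᵥ x)} := by
    ext z
    simp [sampleF_le_iff hn hk hX]
  rw [this]
  refine isClosed_iInter fun i => isClosed_iInter fun x => isClosed_le ?_ continuous_const
  fun_prop

end StochSmooth

/-! ### Second-order analysis of Gaussian mass: integrals over a ball. -/

namespace StochSmooth

/-! ### Gaussian integrals over a centred ball -/

variable {n : ℕ}

/-- The closed ball of squared radius `r`. -/
def sqBall (n : ℕ) (r : ℝ) : Set (Fin n → ℝ) := {w | ∑ i, w i ^ 2 ≤ r}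

theorem isClosed_sqBall (r : ℝ) : IsClosed (sqBall n r) :=
  isClosed_le (by fun_prop) continuous_const

theorem isCompact_sqBall (r : ℝ) : IsCompact (sqBall n r) := by
  refine Metric.isCompact_of_isClosed_isBounded (isClosed_sqBall r) ?_
  refine (Metric.isBounded_closedBall (x := (0 : Fin n → ℝ)) (r := Real.sqrt r)).subset ?_
  intro w hw
  rw [mem_closedBall_zero_iff, pi_norm_le_iff_of_nonneg (Real.sqrt_nonneg _)]
  intro i
  refine Real.abs_le_sqrt (le_trans ?_ hw)
  exact Finset.single_le_sum (f := fun i => w i ^ 2) (fun j _ => sq_nonneg _) (Finset.mem_univ i)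

/-- Integral of `q` over the ball against the unnormalized Gaussian weight with precisions `m`. -/
noncomputable def ballInt (r : ℝ) (m : Fin n → ℝ) (q : (Fin n → ℝ) → ℝ) : ℝ :=
  ∫ w in sqBall n r, q w * Real.exp (-(∑ i, m i * w i ^ 2) / 2)

theorem integrableOn_sqBall {r : ℝ} {f : (Fin n → ℝ) → ℝ} (hf : Continuous f) :
    IntegrableOn f (sqBall n r) :=
  hf.continuousOn.integrableOn_compact (isCompact_sqBall r)

theorem ballInt_add {r : ℝ} {m : Fin n → ℝ} {f g : (Fin n → ℝ) → ℝ} (hf : Continuous f)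
    (hg : Continuous g) :
    ballInt r m (fun w => f w + g w) = ballInt r m f + ballInt r m g := by
  simp only [ballInt, add_mul]
  exact integral_add (integrableOn_sqBall (by fun_prop)) (integrableOn_sqBall (by fun_prop))

theorem ballInt_const_mul {r : ℝ} {m : Fin n → ℝ} (c : ℝ) (f : (Fin n → ℝ) → ℝ) :
    ballInt r m (fun w => c * f w) = c * ballInt r m f := by
  simp only [ballInt, mul_assoc]
  exact integral_const_mul _ _

theorem ballInt_sum {r : ℝ} {m : Fin n → ℝ} {f : Fin n → (Fin n → ℝ) → ℝ}
    (hf : ∀ i, Continuous (f i)) :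
    ballInt r m (fun w => ∑ i, f i w) = ∑ i, ballInt r m (f i) := by
  simp only [ballInt, Finset.sum_mul]
  refine integral_finsetSum _ fun i _ => integrableOn_sqBall ?_
  have := hf i
  fun_prop

theorem ballInt_mono {r : ℝ} {m : Fin n → ℝ} {f g : (Fin n → ℝ) → ℝ} (hf : Continuous f)
    (hg : Continuous g) (h : ∀ w ∈ sqBall n r, f w ≤ g w) : ballInt r m f ≤ ballInt r m g := by
  refine setIntegral_mono_on (integrableOn_sqBall (by fun_prop)) (integrableOn_sqBall (by fun_prop))
    (isClosed_sqBall r).measurableSet fun w hw => ?_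
  exact mul_le_mul_of_nonneg_right (h w hw) (Real.exp_pos _).le

theorem ballInt_one_pos {r : ℝ} (hr : 0 < r) (m : Fin n → ℝ) : 0 < ballInt r m fun _ => 1 := by
  rw [ballInt, setIntegral_pos_iff_support_of_nonneg_ae]
  · have h1 : (Function.support fun w : Fin n → ℝ =>
        (1 : ℝ) * Real.exp (-(∑ i, m i * w i ^ 2) / 2)) = Set.univ := by
      ext w; simp [Real.exp_ne_zero]
    rw [h1, Set.univ_inter]
    have h2 : IsOpen {w : Fin n → ℝ | ∑ i, w i ^ 2 < r} := isOpen_lt (by fun_prop) continuous_const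
    refine lt_of_lt_of_le (h2.measure_pos volume ⟨0, by simpa using hr⟩)
      (measure_mono fun w (hw : _ < r) => show _ ≤ r from hw.le)
  · exact Filter.Eventually.of_forall fun w => by simp [(Real.exp_pos _).le]
  · exact integrableOn_sqBall (by fun_prop)

/-- The domain is a fixed compact ball, so the derivative of the integrand is bounded uniformly near
`t` and dominated differentiation applies. -/
theorem hasDerivAt_ballInt {r : ℝ} (m e : Fin n → ℝ) {q : (Fin n → ℝ) → ℝ} (hq : Continuous q)
    (t : ℝ) :
    HasDerivAt (fun t : ℝ => ballInt r (m + t • e) q)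
      (ballInt r (m + t • e) fun w => q w * (-(∑ i, e i * w i ^ 2) / 2)) t := by
  have hcont : Continuous fun p : ℝ × (Fin n → ℝ) =>
      q p.2 * (-(∑ i, e i * p.2 i ^ 2) / 2) *
        Real.exp (-(∑ i, (m i + p.1 * e i) * p.2 i ^ 2) / 2) := by fun_prop
  have hK : IsCompact (Metric.closedBall t 1 ×ˢ sqBall n r) :=
    (isCompact_closedBall t 1).prod (isCompact_sqBall r)
  obtain ⟨C, hC⟩ := hK.exists_bound_of_continuousOn hcont.continuousOn
  have := hasDerivAt_integral_of_dominated_loc_of_deriv_le (μ := volume.restrict (sqBall n r))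
    (F := fun t w => q w * Real.exp (-(∑ i, (m i + t * e i) * w i ^ 2) / 2))
    (F' := fun t w => q w * (-(∑ i, e i * w i ^ 2) / 2) *
        Real.exp (-(∑ i, (m i + t * e i) * w i ^ 2) / 2))
    (x₀ := t) (bound := fun _ => C) (s := Metric.ball t 1) (Metric.ball_mem_nhds t one_pos)
    (Filter.Eventually.of_forall fun s => (by fun_prop : Continuous _).aestronglyMeasurable)
    (integrableOn_sqBall (by fun_prop))
    (by fun_prop : Continuous _).aestronglyMeasurable ?_ ?_ ?_
  · exact this.2
  · refine (ae_restrict_iff' (isClosed_sqBall r).measurableSet).2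
      (Filter.Eventually.of_forall fun w hw s hs => ?_)
    exact hC (s, w) ⟨Metric.ball_subset_closedBall hs, hw⟩
  · exact integrableOn_const (isCompact_sqBall r).measure_lt_top.ne
  · refine Filter.Eventually.of_forall fun w s _ => ?_
    have h1 : HasDerivAt (fun s : ℝ => -(∑ i, (m i + s * e i) * w i ^ 2) / 2)
        (-(∑ i, e i * w i ^ 2) / 2) s := by
      refine (HasDerivAt.fun_sum fun i _ => ?_).neg.div_const 2
      simpa using (((hasDerivAt_id s).mul_const (e i)).const_add (m i)).mul_const (w i ^ 2)
    have h2 := (h1.exp).const_mul (q w)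
    exact h2.congr_deriv (by ring)

/-- Integration by parts in one coordinate: the boundary term is nonnegative. -/
theorem ballInt_boundary_nonneg {r : ℝ} {m : Fin n → ℝ} (hm : ∀ i, 0 < m i) (i : Fin n)
    (A : ℝ) (h : Fin n → ℝ) (hq : ∀ w : Fin n → ℝ, ∑ j, w j ^ 2 = r → 0 ≤ A + ∑ j, h j * w j ^ 2) :
    0 ≤ ballInt r m fun w =>
      (A + ∑ j, h j * w j ^ 2) * ((m i)⁻¹ - w i ^ 2) + 2 * (m i)⁻¹ * h i * w i ^ 2 := by
  obtain _ | n := n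
  · exact i.elim0
  set g : (Fin (n + 1) → ℝ) → ℝ := fun w =>
    ((A + ∑ j, h j * w j ^ 2) * ((m i)⁻¹ - w i ^ 2) + 2 * (m i)⁻¹ * h i * w i ^ 2) *
      Real.exp (-(∑ i, m i * w i ^ 2) / 2) with hg
  have hgc : Continuous g := by fun_prop
  have hmp := volume_preserving_piFinSuccAbove (fun _ : Fin (n + 1) => ℝ) i
  have hint : Integrable ((sqBall (n + 1) r).indicator g) :=
    (integrable_indicator_iff (isClosed_sqBall r).measurableSet).2 (integrableOn_sqBall hgc)
  have h1 : ballInt r m (fun w =>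
      (A + ∑ j, h j * w j ^ 2) * ((m i)⁻¹ - w i ^ 2) + 2 * (m i)⁻¹ * h i * w i ^ 2) =
      ∫ w, (sqBall (n + 1) r).indicator g w :=
    (integral_indicator (isClosed_sqBall r).measurableSet).symm
  rw [h1, ← hmp.symm.integral_comp']
  have hint' : Integrable (fun x => (sqBall (n + 1) r).indicator g
      ((MeasurableEquiv.piFinSuccAbove (fun _ => ℝ) i).symm x))
      ((volume : Measure ℝ).prod volume) := hmp.symm.integrable_comp_of_integrable hint
  rw [Measure.volume_eq_prod, integral_prod_symm _ hint']
  refine integral_nonneg fun y => ?_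
  set S := ∑ j, y j ^ 2 with hS
  set M := ∑ j, m (i.succAbove j) * y j ^ 2 with hM
  set H := ∑ j, h (i.succAbove j) * y j ^ 2 with hH
  -- A line parallel to axis `i` meets the ball in `[-√(r - S), √(r - S)]`. The `if` covers lines
  -- that miss the ball: the square root of a negative number is 0, so the interval degenerates to
  -- `{0}` instead of becoming empty.
  have hform : ∀ a : ℝ, (sqBall (n + 1) r).indicator g (i.insertNth a y) =
      (Set.Icc (-Real.sqrt (r - S)) (Real.sqrt (r - S))).indicator (fun a =>
        if S ≤ r then ((A + (h i * a ^ 2 + H)) * ((m i)⁻¹ - a ^ 2) + 2 * (m i)⁻¹ * h i * a ^ 2) *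
        Real.exp (-(m i * a ^ 2 + M) / 2) else 0) a := by
    intro a
    have hmem : i.insertNth a y ∈ sqBall (n + 1) r ↔ a ^ 2 + S ≤ r := by
      rw [sqBall, Set.mem_ofPred_eq, Fin.sum_univ_succAbove _ i]
      simp [hS]
    by_cases hSr : S ≤ r
    · have hmem2 : a ∈ Set.Icc (-Real.sqrt (r - S)) (Real.sqrt (r - S)) ↔ a ^ 2 + S ≤ r := by
        rw [Set.mem_Icc, ← abs_le, ← Real.sqrt_sq_eq_abs, Real.sqrt_le_sqrt_iff (by linarith)]
        exact le_sub_iff_add_le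
      by_cases ha : a ^ 2 + S ≤ r
      · rw [Set.indicator_of_mem (hmem.2 ha), Set.indicator_of_mem (hmem2.2 ha), if_pos hSr, hg]
        simp only [Fin.sum_univ_succAbove _ i, Fin.insertNth_apply_same,
          Fin.insertNth_apply_succAbove, hH, hM]
      · rw [Set.indicator_of_notMem (mt hmem.1 ha), Set.indicator_of_notMem (mt hmem2.1 ha)]
    · rw [Set.indicator_of_notMem (mt hmem.1 (by nlinarith [sq_nonneg a]))]
      simp [hSr]
  change 0 ≤ ∫ a, (sqBall (n + 1) r).indicator g (i.insertNth a y)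
  simp only [hform]
  rw [integral_indicator measurableSet_Icc]
  by_cases hSr : S ≤ r
  swap
  · simp [hSr]
  simp only [if_pos hSr]
  set ρ := Real.sqrt (r - S) with hρ
  have hρ0 : 0 ≤ ρ := Real.sqrt_nonneg _
  have hρ2 : ρ ^ 2 = r - S := Real.sq_sqrt (by linarith)
  rw [integral_Icc_eq_integral_Ioc, ← intervalIntegral.integral_of_le (by linarith)]
  -- The antiderivative is odd in `a`, so the two endpoint contributions add. The endpoints lie on
  -- the sphere, where the quadratic factor is nonnegative by `hq`.
  rw [intervalIntegral.integral_eq_sub_of_hasDerivAt (f := fun a => (m i)⁻¹ * a *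
    (A + (h i * a ^ 2 + H)) * Real.exp (-(m i * a ^ 2 + M) / 2))]
  · have hq' : 0 ≤ A + (h i * ρ ^ 2 + H) := by
      have := hq (i.insertNth ρ y) (by
        rw [Fin.sum_univ_succAbove _ i]; simp [hρ2, hS])
      rw [Fin.sum_univ_succAbove _ i] at this
      simpa [hH] using this
    have : 0 ≤ (m i)⁻¹ * ρ * (A + (h i * ρ ^ 2 + H)) * Real.exp (-(m i * ρ ^ 2 + M) / 2) := by
      have := hm i
      positivity
    simp only [neg_sq]
    linarith
  · intro a _
    have e1 : HasDerivAt (fun a : ℝ => (m i)⁻¹ * a) (m i)⁻¹ a := by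
      simpa using (hasDerivAt_id a).const_mul (m i)⁻¹
    have e2 : HasDerivAt (fun a : ℝ => A + (h i * a ^ 2 + H)) (h i * (2 * a)) a := by
      simpa using ((((hasDerivAt_pow 2 a).const_mul (h i)).add_const H).const_add A)
    have e3 : HasDerivAt (fun a : ℝ => -(m i * a ^ 2 + M) / 2) (-(m i * (2 * a)) / 2) a := by
      simpa using (((hasDerivAt_pow 2 a).const_mul (m i)).add_const M).neg.div_const 2
    refine ((e1.fun_mul e2).fun_mul e3.exp).congr_deriv ?_
    have := mul_inv_cancel₀ (hm i).ne'
    linear_combination (-a ^ 2 * (A + (h i * a ^ 2 + H)) * Real.exp (-(m i * a ^ 2 + M) / 2)) * this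
  · exact (by fun_prop : Continuous _).intervalIntegrable _ _

end StochSmooth

/-! ### Second-order analysis of Gaussian mass: moments and log-derivatives. -/

namespace StochSmooth

/-! ### Reverse variance inequality for truncated Gaussians -/

variable {n : ℕ}

/-- Expectation under the centred Gaussian with precisions `m` conditioned to the ball. -/
noncomputable def ballMean (r : ℝ) (m : Fin n → ℝ) (q : (Fin n → ℝ) → ℝ) : ℝ :=
  ballInt r m q / ballInt r m fun _ => 1

/-- The loss of variance in coordinate `i` caused by conditioning to the ball. -/
noncomputable def varDefect (r : ℝ) (m : Fin n → ℝ) (i : Fin n) : ℝ :=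
  (m i)⁻¹ - ballMean r m fun w => w i ^ 2

/-- Variance of `∑ e_i w_i²` under the conditioned Gaussian. -/
noncomputable def ballVar (r : ℝ) (m e : Fin n → ℝ) : ℝ :=
  (∑ i, ∑ j, e i * e j * ballMean r m fun w => w j ^ 2 * w i ^ 2) -
    (∑ i, e i * ballMean r m fun w => w i ^ 2) ^ 2

theorem ballMean_sq_nonneg {r : ℝ} (hr : 0 < r) (m : Fin n → ℝ) (i : Fin n) :
    0 ≤ ballMean r m fun w => w i ^ 2 := by
  refine div_nonneg ?_ (ballInt_one_pos hr m).le
  have := ballInt_mono (r := r) (m := m) (f := fun _ => 0) (g := fun w => w i ^ 2)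
    (by fun_prop) (by fun_prop) fun w _ => sq_nonneg _
  simpa [ballInt] using this

theorem sum_ballMean_sq_le {r : ℝ} (hr : 0 < r) (m : Fin n → ℝ) :
    ∑ i, (ballMean r m fun w => w i ^ 2) ≤ r := by
  simp only [ballMean, ← Finset.sum_div]
  rw [div_le_iff₀ (ballInt_one_pos hr m), ← ballInt_sum fun i => by fun_prop,
    ← ballInt_const_mul]
  exact ballInt_mono (by fun_prop) (by fun_prop) fun w hw => by rw [mul_one]; exact hw

/-- `ballInt_boundary_nonneg` divided by the total mass and expanded in moments, which makes it
linear in `A` and `h`. -/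
theorem ballMean_boundary_nonneg {r : ℝ} (hr : 0 < r) {m : Fin n → ℝ} (hm : ∀ i, 0 < m i)
    (i : Fin n) (A : ℝ) (h : Fin n → ℝ)
    (hq : ∀ w : Fin n → ℝ, ∑ j, w j ^ 2 = r → 0 ≤ A + ∑ j, h j * w j ^ 2) :
    0 ≤ A * varDefect r m i + ((m i)⁻¹ * ∑ j, h j * ballMean r m fun w => w j ^ 2) -
      (∑ j, h j * ballMean r m fun w => w j ^ 2 * w i ^ 2) +
      2 * (m i)⁻¹ * h i * ballMean r m fun w => w i ^ 2 := by
  have h0 := ballInt_boundary_nonneg hm i A h hq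
  have hZ := ballInt_one_pos hr m
  have h1 : (ballInt r m fun w =>
      (A + ∑ j, h j * w j ^ 2) * ((m i)⁻¹ - w i ^ 2) + 2 * (m i)⁻¹ * h i * w i ^ 2) =
      A * (m i)⁻¹ * (ballInt r m fun _ => 1) + (-A + 2 * (m i)⁻¹ * h i) *
        (ballInt r m fun w => w i ^ 2) +
      (∑ j, (m i)⁻¹ * h j * ballInt r m fun w => w j ^ 2) +
      ∑ j, -h j * ballInt r m fun w => w j ^ 2 * w i ^ 2 := by
    simp only [← ballInt_const_mul]
    rw [← ballInt_sum fun j => by fun_prop, ← ballInt_sum fun j => by fun_prop,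
      ← ballInt_add (by fun_prop) (by fun_prop), ← ballInt_add (by fun_prop) (by fun_prop),
      ← ballInt_add (by fun_prop) (by fun_prop)]
    congr 1
    ext w
    have e1 : ∑ j, (m i)⁻¹ * h j * w j ^ 2 = (m i)⁻¹ * ∑ j, h j * w j ^ 2 := by
      rw [Finset.mul_sum]; exact Finset.sum_congr rfl fun j _ => by ring
    have e2 : ∑ j, -h j * (w j ^ 2 * w i ^ 2) = -(∑ j, h j * w j ^ 2) * w i ^ 2 := by
      rw [← Finset.sum_neg_distrib, Finset.sum_mul]; exact Finset.sum_congr rfl fun j _ => by ring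
    rw [e1, e2]
    ring
  rw [h1] at h0
  have h2 := div_nonneg h0 hZ.le
  refine h2.trans_eq ?_
  simp only [varDefect, ballMean, mul_div_assoc', ← Finset.sum_div]
  simp only [neg_mul, Finset.sum_neg_distrib]
  have e1 : ∑ j, (m i)⁻¹ * h j * (ballInt r m fun w => w j ^ 2) =
      (m i)⁻¹ * ∑ j, h j * ballInt r m fun w => w j ^ 2 := by
    rw [Finset.mul_sum]; exact Finset.sum_congr rfl fun j _ => by ring
  rw [e1]
  field_simp
  ring

/-- The boundary inequality for the constant function 1: conditioning to the ball cannot increase a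
coordinate's second moment. -/
theorem varDefect_nonneg {r : ℝ} (hr : 0 < r) {m : Fin n → ℝ} (hm : ∀ i, 0 < m i) (i : Fin n) :
    0 ≤ varDefect r m i := by
  simpa using ballMean_boundary_nonneg hr hm i 1 0 (by simp)

/-- The boundary inequality is applied to a constant plus or minus the centred form `∑ h_j (w_j² -
b_j)`, with `b_j` the mean of `w_j²`. The constant need only dominate the form on the sphere, and it
multiplies `varDefect`. -/
theorem abs_boundary_le {r : ℝ} (hr : 0 < r) {m : Fin n → ℝ} (hm : ∀ i, 0 < m i)
    (h : Fin n → ℝ) (i : Fin n) :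
    |(∑ j, h j * ballMean r m fun w => w j ^ 2) * (ballMean r m fun w => w i ^ 2) -
      (∑ j, h j * ballMean r m fun w => w j ^ 2 * w i ^ 2) +
      2 * (m i)⁻¹ * h i * ballMean r m fun w => w i ^ 2| ≤
    3 / 2 * r * Real.sqrt (∑ j, h j ^ 2) * varDefect r m i := by
  set η := Real.sqrt (∑ j, h j ^ 2) with hη
  have hη0 : 0 ≤ η := Real.sqrt_nonneg _
  have hη2 : η ^ 2 = ∑ j, h j ^ 2 := Real.sq_sqrt (Finset.sum_nonneg fun j _ => sq_nonneg _)
  set b : Fin n → ℝ := fun j => ballMean r m fun w => w j ^ 2 with hb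
  have hb0 : ∀ j, 0 ≤ b j := ballMean_sq_nonneg hr m
  have hbr : ∑ j, b j ≤ r := sum_ballMean_sq_le hr m
  have hb2 : ∑ j, b j ^ 2 ≤ r ^ 2 :=
    (Finset.sum_sq_le_sq_sum_of_nonneg fun j _ => hb0 j).trans
      (pow_le_pow_left₀ (Finset.sum_nonneg fun j _ => hb0 j) hbr 2)
  -- By Cauchy–Schwarz the form is at most `η` times the root of `∑ (w_j² - b_j)²`. Dropping the
  -- nonpositive cross terms bounds that sum by `2r²`, and `√2 ≤ 3/2`.
  have key : ∀ w : Fin n → ℝ, ∑ j, w j ^ 2 = r →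
      |(∑ j, h j * w j ^ 2) - ∑ j, h j * b j| ≤ 3 / 2 * r * η := by
    intro w hw
    refine abs_le_of_sq_le_sq ?_ (by positivity)
    have h1 : (∑ j, h j * w j ^ 2) - ∑ j, h j * b j = ∑ j, h j * (w j ^ 2 - b j) := by
      rw [← Finset.sum_sub_distrib]; exact Finset.sum_congr rfl fun j _ => by ring
    have h2 := Finset.sum_mul_sq_le_sq_mul_sq Finset.univ h (fun j => w j ^ 2 - b j)
    have h3 : ∑ j, (w j ^ 2 - b j) ^ 2 ≤ ∑ j, ((w j ^ 2) ^ 2 + b j ^ 2) :=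
      Finset.sum_le_sum fun j _ => by nlinarith [mul_nonneg (sq_nonneg (w j)) (hb0 j)]
    have h4 : ∑ j, (w j ^ 2) ^ 2 ≤ r ^ 2 := by
      rw [← hw]; exact Finset.sum_sq_le_sq_sum_of_nonneg fun j _ => sq_nonneg _
    rw [Finset.sum_add_distrib] at h3
    rw [h1]
    refine h2.trans ?_
    rw [← hη2]
    nlinarith [sq_nonneg η, sq_nonneg r, mul_nonneg (sq_nonneg η) (sq_nonneg r),
      mul_le_mul_of_nonneg_left (h3.trans (add_le_add h4 hb2)) (sq_nonneg η)]
  have p1 := ballMean_boundary_nonneg hr hm i (3 / 2 * r * η - ∑ j, h j * b j) h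
    fun w hw => by linarith [(abs_le.1 (key w hw)).1]
  have p2 := ballMean_boundary_nonneg hr hm i (3 / 2 * r * η + ∑ j, h j * b j) (fun j => -h j)
    fun w hw => by
      simp only [neg_mul, Finset.sum_neg_distrib]
      linarith [(abs_le.1 (key w hw)).2]
  simp only [neg_mul, Finset.sum_neg_distrib] at p2
  have hd : varDefect r m i = (m i)⁻¹ - b i := rfl
  change 0 ≤ (3 / 2 * r * η - ∑ j, h j * b j) * varDefect r m i + (m i)⁻¹ * (∑ j, h j * b j) - _ +
    2 * (m i)⁻¹ * h i * b i at p1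
  change 0 ≤ (3 / 2 * r * η + ∑ j, h j * b j) * varDefect r m i +
    (m i)⁻¹ * (-∑ j, h j * b j) - _ + _ * b i at p2
  change |(∑ j, h j * b j) * b i - _ + 2 * (m i)⁻¹ * h i * b i| ≤ _
  rw [hd] at p1 p2 ⊢
  rw [abs_le]
  constructor <;> nlinarith

/-- A lower bound for a truncated variance: without truncation it would be `2 ∑ h_i²/m_i²` and the
left side would vanish. Multiplying `abs_boundary_le` by `h_i` and summing produces the variance;
replacing the second moment by `1/m_i` minus its defect costs the term with `V`. The right side
contains only the total defect, which is what can be integrated over the level `s`. -/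
theorem sum_sq_sub_ballVar_le {r : ℝ} (hr : 0 < r) {m : Fin n → ℝ} (hm : ∀ i, 0 < m i)
    {V : ℝ} (hV : ∀ i, (m i)⁻¹ ≤ V) (h : Fin n → ℝ) :
    (∑ i, h i ^ 2 * (m i)⁻¹ ^ 2) / 2 - ballVar r m h / 4 ≤
      (V + 3 / 4 * r) * (∑ i, h i ^ 2) * ((∑ i, varDefect r m i) / 2) := by
  set η := Real.sqrt (∑ j, h j ^ 2) with hη
  have hη0 : 0 ≤ η := Real.sqrt_nonneg _
  have hη2 : η ^ 2 = ∑ j, h j ^ 2 := Real.sq_sqrt (Finset.sum_nonneg fun j _ => sq_nonneg _)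
  set b : Fin n → ℝ := fun j => ballMean r m fun w => w j ^ 2 with hb
  set B := ∑ j, h j * b j with hB
  set P : Fin n → ℝ := fun i => ∑ j, h j * ballMean r m fun w => w j ^ 2 * w i ^ 2 with hP
  have hle : ∀ i, h i ^ 2 ≤ ∑ j, h j ^ 2 := fun i =>
    Finset.single_le_sum (f := fun j => h j ^ 2) (fun j _ => sq_nonneg _) (Finset.mem_univ i)
  have h1 : ∀ i, 2 * h i ^ 2 * (m i)⁻¹ ^ 2 - (h i * P i - B * (h i * b i)) ≤
      (2 * V + 3 / 2 * r) * (∑ i, h i ^ 2) * varDefect r m i := by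
    intro i
    have e1 := abs_boundary_le hr hm h i
    change |B * b i - P i + 2 * (m i)⁻¹ * h i * b i| ≤ 3 / 2 * r * η * varDefect r m i at e1
    have hd := varDefect_nonneg hr hm i
    have e2 : |h i| ≤ η := Real.abs_le_sqrt (hle i)
    have e3 : h i * (B * b i - P i + 2 * (m i)⁻¹ * h i * b i) ≤
        η * (3 / 2 * r * η * varDefect r m i) := by
      refine (le_abs_self _).trans ?_
      rw [abs_mul]
      exact mul_le_mul e2 e1 (abs_nonneg _) hη0
    have e4 : h i ^ 2 * (m i)⁻¹ * varDefect r m i ≤ (∑ i, h i ^ 2) * V * varDefect r m i := by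
      refine mul_le_mul_of_nonneg_right ?_ hd
      exact mul_le_mul (hle i) (hV i) (inv_nonneg.2 (hm i).le) ((sq_nonneg (h i)).trans (hle i))
    have e5 : varDefect r m i = (m i)⁻¹ - b i := rfl
    rw [← hη2] at e4 ⊢
    rw [e5] at e3 e4 ⊢
    linarith
  have h2 := Finset.sum_le_sum fun i (_ : i ∈ Finset.univ) => h1 i
  simp only [Finset.sum_sub_distrib, ← Finset.mul_sum] at h2
  have h3 : ballVar r m h = (∑ i, h i * P i) - B ^ 2 := by
    rw [ballVar]
    congr 1
    refine Finset.sum_congr rfl fun i _ => ?_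
    rw [hP, Finset.mul_sum]
    exact Finset.sum_congr rfl fun j _ => by ring
  have h4 : ∑ i, 2 * h i ^ 2 * (m i)⁻¹ ^ 2 = 2 * ∑ i, h i ^ 2 * (m i)⁻¹ ^ 2 := by
    rw [Finset.mul_sum]; exact Finset.sum_congr rfl fun j _ => by ring
  rw [h4] at h2
  rw [h3]
  linarith

/-! ### The logarithm of the Gaussian measure of an ellipsoid -/

/-- Logarithm of the Gaussian mass of the ellipsoid `∑ z_i² / m_i ≤ r`, up to an additive
constant. -/
noncomputable def logMass (r : ℝ) (m : Fin n → ℝ) : ℝ :=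
  (∑ i, Real.log (m i)) / 2 + Real.log (ballInt r m fun _ => 1)

/-- The log-determinant contributes `1/m_i` and the integral minus the mean of `w_i²`, each halved;
their difference is the defect. For `e = 1` this is the derivative in the level `s`. -/
theorem hasDerivAt_logMass {r : ℝ} (hr : 0 < r) (m e : Fin n → ℝ) (t : ℝ)
    (hm : ∀ i, 0 < (m + t • e) i) :
    HasDerivAt (fun t : ℝ => logMass r (m + t • e))
      ((∑ i, e i * varDefect r (m + t • e) i) / 2) t := by
  have hZ := ballInt_one_pos hr (m + t • e)
  have h1 := (hasDerivAt_ballInt (r := r) m e (q := fun _ => 1) (by fun_prop) t).log hZ.ne'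
  have h2 : HasDerivAt (fun t : ℝ => (∑ i, Real.log ((m + t • e) i)) / 2)
      ((∑ i, e i / (m + t • e) i) / 2) t := by
    refine (HasDerivAt.fun_sum fun i _ => ?_).div_const 2
    refine HasDerivAt.log ?_ (hm i).ne'
    simpa using ((hasDerivAt_id t).mul_const (e i)).const_add (m i)
  refine (h2.fun_add h1).congr_deriv ?_
  have e1 : (ballInt r (m + t • e) fun w => 1 * (-(∑ i, e i * w i ^ 2) / 2)) =
      -(∑ i, e i * ballInt r (m + t • e) fun w => w i ^ 2) / 2 := by
    simp only [← ballInt_const_mul]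
    rw [← ballInt_sum fun j => by fun_prop, neg_div, div_eq_inv_mul, ← neg_mul,
      ← ballInt_const_mul]
    congr 1; ext w; ring
  rw [e1]
  simp only [varDefect, ballMean, mul_sub, Finset.sum_sub_distrib, mul_div_assoc',
    ← Finset.sum_div, ← div_eq_mul_inv]
  ring

/-- Differentiating a mean in the Gaussian weight gives its covariance with `-½ ∑ e_j w_j²`; summed
against `e` these covariances form `ballVar`. -/
theorem hasDerivAt_varDefect {r : ℝ} (hr : 0 < r) (m e : Fin n → ℝ) (t : ℝ)
    (hm : ∀ i, 0 < (m + t • e) i) :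
    HasDerivAt (fun t : ℝ => (∑ i, e i * varDefect r (m + t • e) i) / 2)
      (ballVar r (m + t • e) e / 4 - (∑ i, e i ^ 2 * ((m + t • e) i)⁻¹ ^ 2) / 2) t := by
  have hZ := ballInt_one_pos hr (m + t • e)
  have hD : ∀ q : (Fin n → ℝ) → ℝ, Continuous q →
      (ballInt r (m + t • e) fun w => q w * (-(∑ i, e i * w i ^ 2) / 2)) =
      -(∑ i, e i * ballInt r (m + t • e) fun w => w i ^ 2 * q w) / 2 := by
    intro q hq
    simp only [← ballInt_const_mul]
    rw [← ballInt_sum fun j => by fun_prop, neg_div, div_eq_inv_mul, ← neg_mul,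
      ← ballInt_const_mul]
    congr 1; ext w
    rw [neg_div, div_eq_inv_mul, Finset.mul_sum, Finset.mul_sum, ← Finset.sum_neg_distrib,
      Finset.mul_sum]
    exact Finset.sum_congr rfl fun j _ => by ring
  have hM : ∀ i, HasDerivAt (fun t : ℝ => ballMean r (m + t • e) fun w => w i ^ 2)
      (-(∑ j, e j * ballMean r (m + t • e) fun w => w j ^ 2 * w i ^ 2) / 2 +
        (ballMean r (m + t • e) fun w => w i ^ 2) *
          (∑ j, e j * ballMean r (m + t • e) fun w => w j ^ 2) / 2) t := by
    intro i
    have h1 := hasDerivAt_ballInt (r := r) m e (q := fun _ => 1) (by fun_prop) t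
    have h2 := hasDerivAt_ballInt (r := r) m e (q := fun w => w i ^ 2) (by fun_prop) t
    rw [hD _ (by fun_prop)] at h1 h2
    refine (h2.fun_div h1 hZ.ne').congr_deriv ?_
    simp only [mul_one, ballMean, mul_div_assoc', ← Finset.sum_div]
    field_simp
    ring
  have hI : ∀ i, HasDerivAt (fun t : ℝ => ((m + t • e) i)⁻¹)
      (-e i * ((m + t • e) i)⁻¹ ^ 2) t := by
    intro i
    have h1 : HasDerivAt (fun t : ℝ => (m + t • e) i) (e i) t := by
      simpa using ((hasDerivAt_id t).mul_const (e i)).const_add (m i)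
    refine (h1.fun_inv (hm i).ne').congr_deriv ?_
    rw [div_eq_mul_inv, inv_pow]
  have := (HasDerivAt.fun_sum fun i (_ : i ∈ Finset.univ) =>
    ((hI i).fun_sub (hM i)).const_mul (e i)).div_const 2
  refine this.congr_deriv ?_
  set b : Fin n → ℝ := fun j => ballMean r (m + t • e) fun w => w j ^ 2 with hb
  set v : Fin n → ℝ := fun j => ((m + t • e) j)⁻¹ with hv
  have h3 : ballVar r (m + t • e) e =
      (∑ i, e i * ∑ j, e j * ballMean r (m + t • e) fun w => w j ^ 2 * w i ^ 2) -
        (∑ i, e i * b i) * (∑ i, e i * b i) := by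
    rw [ballVar, ← pow_two]
    congr 1
    refine Finset.sum_congr rfl fun i _ => ?_
    rw [Finset.mul_sum]
    exact Finset.sum_congr rfl fun j _ => by ring
  rw [h3]
  set P : Fin n → ℝ := fun i =>
    ∑ j, e j * ballMean r (m + t • e) fun w => w j ^ 2 * w i ^ 2 with hP
  set B := ∑ j, e j * b j with hB
  change (∑ i, e i * (-e i * v i ^ 2 - (-P i / 2 + b i * B / 2))) / 2 =
    ((∑ i, e i * P i) - B * B) / 4 - (∑ i, e i ^ 2 * v i ^ 2) / 2
  have h5 : ∑ i, e i * (-e i * v i ^ 2 - (-P i / 2 + b i * B / 2)) =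
      (∑ i, e i * P i) / 2 - (∑ i, e i * b i) * B / 2 - ∑ i, e i ^ 2 * v i ^ 2 := by
    rw [Finset.sum_div, Finset.sum_mul, Finset.sum_div, ← Finset.sum_sub_distrib,
      ← Finset.sum_sub_distrib]
    exact Finset.sum_congr rfl fun i _ => by ring
  rw [h5, ← hB]
  ring

end StochSmooth

/-! ### Ellipsoid probabilities, and the inverse moment that produces `C_k`. -/

namespace StochSmooth

open scoped NNReal ENNReal

/-! ### Gaussian mass of ellipsoids -/

variable {n : ℕ}

instance : IsProbabilityMeasure (gaussianVec n) := by
  unfold gaussianVec; infer_instance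

instance (k : ℕ) : IsProbabilityMeasure (gaussianSample n k) := by
  unfold gaussianSample; infer_instance

theorem pi_gaussianReal_eq_withDensity (v : Fin n → ℝ≥0) (hv : ∀ i, v i ≠ 0) :
    Measure.pi (fun i => gaussianReal 0 (v i)) =
      (volume : Measure (Fin n → ℝ)).withDensity
        (fun w => ENNReal.ofReal (∏ i, gaussianPDFReal 0 (v i) (w i))) := by
  refine Measure.pi_eq fun s hs => ?_
  have hbox : MeasurableSet (Set.univ.pi s) := MeasurableSet.univ_pi hs
  rw [withDensity_apply _ hbox, volume_pi, Measure.restrict_pi_pi,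
    ← ofReal_integral_eq_lintegral_ofReal, integral_fintype_prod_eq_prod,
    ENNReal.ofReal_prod_of_nonneg]
  · exact Finset.prod_congr rfl fun i _ => (gaussianReal_apply_eq_integral 0 (hv i) (s i)).symm
  · exact fun i _ => integral_nonneg fun x => gaussianPDFReal_nonneg _ _ _
  · exact Integrable.fintype_prod fun i => (integrable_gaussianPDFReal 0 (v i)).restrict
  · exact Filter.Eventually.of_forall fun w =>
      Finset.prod_nonneg fun i _ => gaussianPDFReal_nonneg _ _ _

/-- Gaussian mass of the ellipsoid `∑ z_i² / m_i ≤ r`. -/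
noncomputable def ellMass (r : ℝ) (m : Fin n → ℝ) : ℝ :=
  (gaussianVec n).real {z | ∑ i, z i ^ 2 / m i ≤ r}

theorem measurableSet_ellipsoid (r : ℝ) (m : Fin n → ℝ) :
    MeasurableSet {z : Fin n → ℝ | ∑ i, z i ^ 2 / m i ≤ r} :=
  measurableSet_le (by fun_prop) measurable_const

/-- The substitution `z_i = √m_i w_i` carries the ellipsoid to a fixed ball and moves all dependence
on `m` into the smooth Gaussian weight. -/
theorem ellMass_eq {r : ℝ} (hr : 0 < r) {m : Fin n → ℝ} (hm : ∀ i, 0 < m i) :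
    ellMass r m = (Real.sqrt (2 * Real.pi) ^ n)⁻¹ * Real.exp (logMass r m) := by
  set v : Fin n → ℝ≥0 := fun i => ⟨(m i)⁻¹, (inv_pos.2 (hm i)).le⟩ with hv
  have hv0 : ∀ i, v i ≠ 0 := fun i h => (inv_pos.2 (hm i)).ne' (congrArg NNReal.toReal h)
  have hmap : gaussianVec n = (Measure.pi fun i => gaussianReal 0 (v i)).map
      fun w i => Real.sqrt (m i) * w i := by
    rw [Measure.pi_map_pi (fun i => (measurable_const_mul (Real.sqrt (m i))).aemeasurable)]
    unfold gaussianVec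
    congr 1
    ext1 i
    rw [gaussianReal_map_const_mul, mul_zero]
    congr 1
    ext
    simp only [hv, Real.sq_sqrt (hm i).le]
    exact (mul_inv_cancel₀ (hm i).ne').symm
  have hpre : (fun (w : Fin n → ℝ) i => Real.sqrt (m i) * w i) ⁻¹'
      {z : Fin n → ℝ | ∑ i, z i ^ 2 / m i ≤ r} = sqBall n r := by
    ext w
    have : ∀ i, (Real.sqrt (m i) * w i) ^ 2 / m i = w i ^ 2 := fun i => by
      rw [mul_pow, Real.sq_sqrt (hm i).le, mul_div_cancel_left₀ _ (hm i).ne']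
    simp only [Set.mem_preimage, Set.mem_ofPred_eq, this]
    rfl
  have hpdf : ∀ w : Fin n → ℝ, ∏ i, gaussianPDFReal 0 (v i) (w i) =
      (Real.sqrt (2 * Real.pi) ^ n)⁻¹ * (∏ i, Real.sqrt (m i)) *
        Real.exp (-(∑ i, m i * w i ^ 2) / 2) := by
    intro w
    have : ∀ i, gaussianPDFReal 0 (v i) (w i) =
        (Real.sqrt (2 * Real.pi))⁻¹ * Real.sqrt (m i) * Real.exp (-(m i * w i ^ 2) / 2) := by
      intro i
      have hmi := hm i
      rw [gaussianPDFReal]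
      change (Real.sqrt (2 * Real.pi * (m i)⁻¹))⁻¹ *
        Real.exp (-(w i - 0) ^ 2 / (2 * (m i)⁻¹)) = _
      rw [Real.sqrt_mul (by positivity), Real.sqrt_inv, mul_inv, inv_inv]
      congr 2
      field_simp
      ring
    simp only [this, Finset.prod_mul_distrib, ← Real.exp_sum]
    congr 2
    · rw [Finset.prod_const, Finset.card_univ, Fintype.card_fin, inv_pow]
    · rw [← Finset.sum_div, Finset.sum_neg_distrib]
  have hlog : Real.exp (logMass r m) = (∏ i, Real.sqrt (m i)) * ballInt r m fun _ => 1 := by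
    rw [logMass, Real.exp_add, Real.exp_log (ballInt_one_pos hr m), Finset.sum_div, Real.exp_sum]
    congr 1
    refine Finset.prod_congr rfl fun i _ => ?_
    rw [← Real.log_sqrt (hm i).le, Real.exp_log (Real.sqrt_pos.2 (hm i))]
  rw [ellMass, hmap, map_measureReal_apply (by fun_prop) (measurableSet_ellipsoid r m), hpre,
    pi_gaussianReal_eq_withDensity v hv0, measureReal_def,
    withDensity_apply _ (isClosed_sqBall r).measurableSet, hlog,
    ← integral_eq_lintegral_of_nonneg_ae]
  · simp only [hpdf]
    rw [integral_const_mul, ballInt, mul_assoc]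
    simp
  · exact Filter.Eventually.of_forall fun w =>
      Finset.prod_nonneg fun i _ => gaussianPDFReal_nonneg _ _ _
  · refine Measurable.aestronglyMeasurable ?_
    exact Finset.measurable_fun_prod _ fun i _ =>
      (measurable_gaussianPDFReal 0 (v i)).comp (measurable_pi_apply i)

theorem ellMass_nonneg (r : ℝ) (m : Fin n → ℝ) : 0 ≤ ellMass r m := measureReal_nonneg

theorem ellMass_le_one (r : ℝ) (m : Fin n → ℝ) : ellMass r m ≤ 1 := measureReal_le_one

/-- Mass of a centred interval under the standard Gaussian on the line. -/
noncomputable def gaussSq (a : ℝ) : ℝ := (gaussianReal 0 1).real {x | x ^ 2 ≤ a}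

theorem gaussSq_nonneg (a : ℝ) : 0 ≤ gaussSq a := measureReal_nonneg

/-- The density is at most 1/2 because `2π ≥ 4`, and the interval has length `2√a`. The bound serves
to show that the mass tends to 0 when an axis collapses. -/
theorem gaussSq_le_sqrt (a : ℝ) : gaussSq a ≤ Real.sqrt a := by
  rcases lt_or_ge a 0 with ha | ha
  · have : {x : ℝ | x ^ 2 ≤ a} = ∅ := by
      ext x
      simpa using ha.trans_le (sq_nonneg x)
    rw [gaussSq, this]; simp
  have hset : {x : ℝ | x ^ 2 ≤ a} = Set.Icc (-Real.sqrt a) (Real.sqrt a) := by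
    ext x
    rw [Set.mem_ofPred_eq, Set.mem_Icc, ← abs_le, ← Real.sqrt_sq_eq_abs, Real.sqrt_le_sqrt_iff ha]
  have hpi : (2 : ℝ) ≤ Real.sqrt (2 * Real.pi) := by
    refine Real.le_sqrt_of_sq_le ?_
    linarith [Real.pi_gt_three]
  have hb : ∀ x, gaussianPDFReal 0 1 x ≤ 1 / 2 := by
    intro x
    rw [gaussianPDFReal]
    have h1 : Real.exp (-(x - 0) ^ 2 / (2 * ((1 : ℝ≥0) : ℝ))) ≤ 1 := by
      rw [Real.exp_le_one_iff]
      refine div_nonpos_of_nonpos_of_nonneg (neg_nonpos.2 (sq_nonneg _)) (by simp)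
    have h2 : (Real.sqrt (2 * Real.pi * ((1 : ℝ≥0) : ℝ)))⁻¹ ≤ 1 / 2 := by
      rw [NNReal.coe_one, mul_one, one_div]
      exact inv_anti₀ two_pos hpi
    calc _ ≤ 1 / 2 * (1 : ℝ) := mul_le_mul h2 h1 (Real.exp_pos _).le (by norm_num)
      _ = 1 / 2 := mul_one _
  rw [gaussSq, hset, measureReal_def, gaussianReal_apply_eq_integral 0 one_ne_zero,
    ENNReal.toReal_ofReal (integral_nonneg fun x => gaussianPDFReal_nonneg _ _ _)]
  have h0 := Real.sqrt_nonneg a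
  calc ∫ x in Set.Icc (-Real.sqrt a) (Real.sqrt a), gaussianPDFReal 0 1 x
      ≤ ∫ x in Set.Icc (-Real.sqrt a) (Real.sqrt a), (1 / 2 : ℝ) :=
        setIntegral_mono (integrable_gaussianPDFReal 0 1).integrableOn
          (integrableOn_const (by simp)) hb
    _ = Real.sqrt a := by
        rw [setIntegral_const, smul_eq_mul, Real.volume_real_Icc_of_le (by linarith)]
        ring

theorem gaussianVec_real_sq_le (i : Fin n) (a : ℝ) :
    (gaussianVec n).real {z | z i ^ 2 ≤ a} = gaussSq a := by
  have h : MeasurePreserving (Function.eval i) (gaussianVec n) (gaussianReal 0 1) :=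
    measurePreserving_eval (fun _ : Fin n => gaussianReal 0 1) i
  rw [gaussSq, measureReal_def, measureReal_def, ← h.measure_preimage
    (measurableSet_le (by fun_prop) measurable_const).nullMeasurableSet]
  rfl

theorem ellMass_le_gaussSq {r : ℝ} {m : Fin n → ℝ} (hm : ∀ i, 0 < m i) (i : Fin n) :
    ellMass r m ≤ gaussSq (r * m i) := by
  rw [← gaussianVec_real_sq_le i]
  refine measureReal_mono fun z hz => ?_
  have h1 : z i ^ 2 / m i ≤ ∑ j, z j ^ 2 / m j :=
    Finset.single_le_sum (f := fun j => z j ^ 2 / m j)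
      (fun j _ => div_nonneg (sq_nonneg _) (hm j).le) (Finset.mem_univ i)
  exact (div_le_iff₀ (hm i)).1 (h1.trans hz)

/-! ### The reciprocal of a chi-square variable -/

theorem lintegral_exp_neg_sq_gaussianReal {a : ℝ} (ha : 0 ≤ a) :
    ∫⁻ x, ENNReal.ofReal (Real.exp (-a * x ^ 2)) ∂(gaussianReal 0 1) =
      ENNReal.ofReal ((1 + 2 * a) ^ (-(1 / 2) : ℝ)) := by
  have hint : Integrable (fun x : ℝ => Real.exp (-a * x ^ 2)) (gaussianReal 0 1) := by
    refine Integrable.of_bound (C := 1) (by fun_prop) (Filter.Eventually.of_forall fun x => ?_)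
    rw [Real.norm_of_nonneg (Real.exp_pos _).le, Real.exp_le_one_iff, neg_mul, neg_nonpos]
    positivity
  rw [← ofReal_integral_eq_lintegral_ofReal hint
    (Filter.Eventually.of_forall fun x => (Real.exp_pos _).le),
    integral_gaussianReal_eq_integral_smul one_ne_zero]
  have h1 : ∀ x : ℝ, gaussianPDFReal 0 1 x • Real.exp (-a * x ^ 2) =
      (Real.sqrt (2 * Real.pi))⁻¹ * Real.exp (-(a + 1 / 2) * x ^ 2) := by
    intro x
    rw [gaussianPDFReal, smul_eq_mul, mul_assoc, ← Real.exp_add]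
    simp only [NNReal.coe_one, mul_one, sub_zero]
    congr 2
    ring
  simp only [h1]
  rw [integral_const_mul, integral_gaussian, Real.rpow_neg (by positivity), ← Real.sqrt_eq_rpow,
    ← Real.sqrt_inv, ← Real.sqrt_inv, ← Real.sqrt_mul (by positivity)]
  congr 2
  have := Real.pi_pos
  field_simp
  ring

theorem lintegral_prod_pi_gaussianReal (k : ℕ) {f : ℝ → ℝ≥0∞} (hf : Measurable f) :
    ∫⁻ x, ∏ i, f (x i) ∂(Measure.pi fun _ : Fin k => gaussianReal 0 1) =
      (∫⁻ x, f x ∂(gaussianReal 0 1)) ^ k := by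
  induction k with
  | zero => simp
  | succ k ih =>
    have hmp := measurePreserving_piFinSuccAbove (fun _ : Fin (k + 1) => gaussianReal 0 1) 0
    rw [← hmp.symm.lintegral_comp (by fun_prop)]
    simp only [Fin.prod_univ_succ]
    have h2 : ∀ p : ℝ × (Fin k → ℝ),
        f ((MeasurableEquiv.piFinSuccAbove (fun _ : Fin (k + 1) => ℝ) 0).symm p 0) *
        ∏ i : Fin k, f ((MeasurableEquiv.piFinSuccAbove (fun _ : Fin (k + 1) => ℝ) 0).symm p i.succ)
        = f p.1 * ∏ i : Fin k, f (p.2 i) := fun p => rfl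
    simp only [h2]
    rw [lintegral_prod_mul (f := f) (g := fun y : Fin k → ℝ => ∏ i, f (y i)) hf.aemeasurable
      (Finset.measurable_fun_prod _ fun i _ => hf.comp (measurable_pi_apply i)).aemeasurable, ih,
      pow_succ']

/-- Write `1/S` as the integral of `exp(-aS)` over `a > 0` and exchange the integrals. The Laplace
transform of the square sum is `(1 + 2a)^(-k/2)`, integrable at infinity because `k > 2`. At `S = 0`
the convention `0⁻¹ = 0` leaves a trivial inequality. -/
theorem lintegral_inv_chiSq {k : ℕ} (hk : 3 ≤ k) :
    ∫⁻ x, ENNReal.ofReal (∑ i, x i ^ 2)⁻¹ ∂(Measure.pi fun _ : Fin k => gaussianReal 0 1) ≤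
      ENNReal.ofReal (1 / ((k : ℝ) - 2)) := by
  have hk' : (3 : ℝ) ≤ k := by exact_mod_cast hk
  have h1 : ∀ S : ℝ, 0 ≤ S →
      ENNReal.ofReal S⁻¹ ≤ ∫⁻ a in Set.Ioi (0 : ℝ), ENNReal.ofReal (Real.exp (-a * S)) := by
    intro S hS
    rcases hS.eq_or_lt with rfl | hS
    · simp
    have h2 := integral_exp_mul_Ioi (neg_neg_of_pos hS) 0
    have h3 := integrableOn_exp_mul_Ioi (neg_neg_of_pos hS) 0
    have e : ∀ a : ℝ, -a * S = -S * a := fun a => by ring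
    simp only [e]
    rw [← ofReal_integral_eq_lintegral_ofReal h3
      (Filter.Eventually.of_forall fun x => (Real.exp_pos _).le), h2]
    simp
  calc ∫⁻ x, ENNReal.ofReal (∑ i, x i ^ 2)⁻¹ ∂(Measure.pi fun _ : Fin k => gaussianReal 0 1)
      ≤ ∫⁻ x, (∫⁻ a in Set.Ioi (0 : ℝ), ENNReal.ofReal (Real.exp (-a * ∑ i, x i ^ 2)))
          ∂(Measure.pi fun _ : Fin k => gaussianReal 0 1) :=
        lintegral_mono fun x => h1 _ (Finset.sum_nonneg fun i _ => sq_nonneg _)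
    _ = ∫⁻ a in Set.Ioi (0 : ℝ), ∫⁻ x, ENNReal.ofReal (Real.exp (-a * ∑ i, x i ^ 2))
          ∂(Measure.pi fun _ : Fin k => gaussianReal 0 1) :=
        lintegral_lintegral_swap (by fun_prop)
    _ = ∫⁻ a in Set.Ioi (0 : ℝ), ENNReal.ofReal ((1 + 2 * a) ^ (-(k : ℝ) / 2)) := by
        refine setLIntegral_congr_fun measurableSet_Ioi fun a ha => ?_
        have ha' : (0 : ℝ) ≤ a := le_of_lt ha
        have h2 : ∀ x : Fin k → ℝ, ENNReal.ofReal (Real.exp (-a * ∑ i, x i ^ 2)) =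
            ∏ i, ENNReal.ofReal (Real.exp (-a * x i ^ 2)) := fun x => by
          rw [Finset.mul_sum, Real.exp_sum,
            ENNReal.ofReal_prod_of_nonneg fun i _ => (Real.exp_pos _).le]
        simp only [h2]
        rw [lintegral_prod_pi_gaussianReal k (f := fun x => ENNReal.ofReal (Real.exp (-a * x ^ 2)))
          (by fun_prop), lintegral_exp_neg_sq_gaussianReal ha', ← ENNReal.ofReal_pow (by positivity),
          ← Real.rpow_natCast, ← Real.rpow_mul (by positivity)]
        congr 2
        ring
    _ ≤ ENNReal.ofReal (1 / ((k : ℝ) - 2)) := by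
        set g : ℝ → ℝ := fun a => -(1 + 2 * a) ^ (-(k : ℝ) / 2 + 1) / ((k : ℝ) - 2) with hg
        have hd : ∀ a ∈ Set.Ici (0 : ℝ), HasDerivAt g ((1 + 2 * a) ^ (-(k : ℝ) / 2)) a := by
          intro a ha
          have ha' : (0 : ℝ) ≤ a := ha
          have e1 : HasDerivAt (fun a : ℝ => 1 + 2 * a) 2 a := by
            simpa using ((hasDerivAt_id a).const_mul 2).const_add 1
          have e2 := ((e1.rpow_const (p := -(k : ℝ) / 2 + 1)
            (Or.inl (by positivity))).neg).div_const ((k : ℝ) - 2)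
          refine e2.congr_deriv ?_
          rw [add_sub_cancel_right, div_eq_iff (by linarith)]
          ring
        have hlim : Filter.Tendsto g Filter.atTop (nhds 0) := by
          have e1 : Filter.Tendsto (fun a : ℝ => 1 + 2 * a) Filter.atTop Filter.atTop :=
            Filter.tendsto_atTop_add_const_left _ _
              (Filter.tendsto_id.const_mul_atTop two_pos)
          have e2 := (tendsto_rpow_neg_atTop (y := (k : ℝ) / 2 - 1) (by linarith)).comp e1
          have e3 := (e2.neg).div_const ((k : ℝ) - 2)
          simp only [neg_zero, zero_div] at e3
          refine e3.congr fun a => ?_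
          simp only [hg, Function.comp]
          congr 3
          ring
        have hpos : ∀ a ∈ Set.Ioi (0 : ℝ), 0 ≤ (1 + 2 * a) ^ (-(k : ℝ) / 2) := fun a ha => by
          have ha' : (0 : ℝ) < a := ha
          positivity
        have e1 := integrableOn_Ioi_deriv_of_nonneg' hd hpos hlim
        have e2 := integral_Ioi_of_hasDerivAt_of_nonneg' hd hpos hlim
        rw [← ofReal_integral_eq_lintegral_ofReal e1
          ((ae_restrict_iff' measurableSet_Ioi).2 (Filter.Eventually.of_forall hpos)), e2]
        refine ENNReal.ofReal_le_ofReal (le_of_eq ?_)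
        simp [hg]
        ring

theorem lintegral_inv_sq_Ioi {c : ℝ} (hc : 0 < c) :
    ∫⁻ u in Set.Ioi c, ENNReal.ofReal (u ^ 2)⁻¹ = ENNReal.ofReal c⁻¹ := by
  have hd : ∀ u ∈ Set.Ici c, HasDerivAt (fun u : ℝ => -u⁻¹) (u ^ 2)⁻¹ u := fun u hu => by
    have hu' : u ≠ 0 := (hc.trans_le hu).ne'
    simpa using (hasDerivAt_inv hu').fun_neg
  have hlim : Filter.Tendsto (fun u : ℝ => -u⁻¹) Filter.atTop (nhds 0) := by
    simpa using (tendsto_inv_atTop_zero (𝕜 := ℝ)).neg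
  have hpos : ∀ u ∈ Set.Ioi c, 0 ≤ (u ^ 2)⁻¹ := fun u _ => by positivity
  have e1 := integrableOn_Ioi_deriv_of_nonneg' hd hpos hlim
  have e2 := integral_Ioi_of_hasDerivAt_of_nonneg' hd hpos hlim
  rw [← ofReal_integral_eq_lintegral_ofReal e1
    ((ae_restrict_iff' measurableSet_Ioi).2 (Filter.Eventually.of_forall hpos)), e2]
  simp

/-- The `k`-th power is the probability that `k` independent squares are all at most `ru`, which
forces their sum `S` to be at most `kru`. For fixed `S` the integral of `u⁻²` over `u ≥ S/(kr)` is
`kr/S`, and the inverse chi-square moment gives `r k/(k - 2)`. -/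
theorem lintegral_gaussSq_pow_div_sq {k : ℕ} (hk : 3 ≤ k) {r : ℝ} (hr : 0 < r) :
    ∫⁻ u in Set.Ioi (0 : ℝ), ENNReal.ofReal (gaussSq (r * u) ^ k / u ^ 2) ≤
      ENNReal.ofReal (r * constC k) := by
  have hk' : (3 : ℝ) ≤ k := by exact_mod_cast hk
  set μ := Measure.pi fun _ : Fin k => gaussianReal 0 1 with hμ
  have h1 : ∀ u ∈ Set.Ioi (0 : ℝ), ENNReal.ofReal (gaussSq (r * u) ^ k / u ^ 2) ≤
      ∫⁻ x, (if ∑ i, x i ^ 2 ≤ k * (r * u) then ENNReal.ofReal (u ^ 2)⁻¹ else 0) ∂μ := by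
    intro u hu
    have e1 : ENNReal.ofReal (gaussSq (r * u) ^ k) = μ (Set.univ.pi fun _ => {x | x ^ 2 ≤ r * u}) := by
      rw [hμ, Measure.pi_pi, Finset.prod_const, Finset.card_univ, Fintype.card_fin,
        ENNReal.ofReal_pow (gaussSq_nonneg _), gaussSq, ofReal_measureReal]
    have e2 : (∫⁻ x, (if ∑ i, x i ^ 2 ≤ k * (r * u) then ENNReal.ofReal (u ^ 2)⁻¹ else 0) ∂μ) =
        ENNReal.ofReal (u ^ 2)⁻¹ * μ {x | ∑ i, x i ^ 2 ≤ k * (r * u)} := by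
      rw [← lintegral_indicator_const (measurableSet_le (by fun_prop) measurable_const)]
      refine lintegral_congr fun x => ?_
      simp [Set.indicator_apply]
    rw [e2, div_eq_mul_inv, mul_comm, ENNReal.ofReal_mul (by positivity), e1]
    refine mul_le_mul_right (measure_mono fun x hx => ?_) _
    have : ∑ i, x i ^ 2 ≤ ∑ i : Fin k, r * u :=
      Finset.sum_le_sum fun i _ => hx i (Set.mem_univ i)
    simpa using this
  have hne : ∀ᵐ x ∂μ, 0 < ∑ i, x i ^ 2 := by
    have h0 : ∀ᵐ x ∂μ, x ⟨0, by omega⟩ ≠ 0 := by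
      have hp : MeasurePreserving (Function.eval ⟨0, by omega⟩) μ (gaussianReal 0 1) :=
        measurePreserving_eval (fun _ : Fin k => gaussianReal 0 1) ⟨0, by omega⟩
      have : NullSingletonClass (gaussianReal 0 1) := nullSingletonClass_gaussianReal one_ne_zero
      have h2 : ∀ᵐ y ∂(gaussianReal 0 1), y ≠ 0 := by
        simp [ae_iff]
      exact hp.quasiMeasurePreserving.ae h2
    filter_upwards [h0] with x hx
    exact lt_of_lt_of_le (by positivity) (Finset.single_le_sum (f := fun i => x i ^ 2)
      (fun i _ => sq_nonneg _) (Finset.mem_univ ⟨0, by omega⟩))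
  calc ∫⁻ u in Set.Ioi (0 : ℝ), ENNReal.ofReal (gaussSq (r * u) ^ k / u ^ 2)
      ≤ ∫⁻ u in Set.Ioi (0 : ℝ),
        ∫⁻ x, (if ∑ i, x i ^ 2 ≤ k * (r * u) then ENNReal.ofReal (u ^ 2)⁻¹ else 0) ∂μ :=
        setLIntegral_mono' measurableSet_Ioi h1
    _ = ∫⁻ x, (∫⁻ u in Set.Ioi (0 : ℝ),
        (if ∑ i, x i ^ 2 ≤ k * (r * u) then ENNReal.ofReal (u ^ 2)⁻¹ else 0)) ∂μ := by
        refine lintegral_lintegral_swap (Measurable.aemeasurable ?_)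
        refine Measurable.ite (measurableSet_le (by fun_prop) (by fun_prop)) (by fun_prop)
          measurable_const
    _ ≤ ∫⁻ x, ENNReal.ofReal (k * r) * ENNReal.ofReal (∑ i, x i ^ 2)⁻¹ ∂μ := by
        refine lintegral_mono_ae ?_
        filter_upwards [hne] with x hx
        have hc : 0 < (∑ i, x i ^ 2) / (k * r) := by positivity
        have e3 : (∫⁻ u in Set.Ioi (0 : ℝ),
            (if ∑ i, x i ^ 2 ≤ k * (r * u) then ENNReal.ofReal (u ^ 2)⁻¹ else 0)) ≤
            ∫⁻ u in Set.Ici ((∑ i, x i ^ 2) / (k * r)), ENNReal.ofReal (u ^ 2)⁻¹ := by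
          rw [← lintegral_indicator measurableSet_Ici]
          refine (setLIntegral_le_lintegral _ _).trans (lintegral_mono fun u => ?_)
          by_cases hu : ∑ i, x i ^ 2 ≤ k * (r * u)
          · rw [if_pos hu, Set.indicator_of_mem]
            rw [Set.mem_Ici, div_le_iff₀ (by positivity)]
            linarith
          · rw [if_neg hu]; exact zero_le
        refine e3.trans (le_of_eq ?_)
        rw [setLIntegral_congr Ioi_ae_eq_Ici.symm, lintegral_inv_sq_Ioi hc,
          ← ENNReal.ofReal_mul (by positivity), inv_div, div_eq_mul_inv]
    _ ≤ ENNReal.ofReal (k * r) * ENNReal.ofReal (1 / ((k : ℝ) - 2)) := by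
        rw [lintegral_const_mul _ (by fun_prop)]
        exact mul_le_mul_right (lintegral_inv_chiSq hk) _
    _ = ENNReal.ofReal (r * constC k) := by
        rw [← ENNReal.ofReal_mul (by positivity), constC]
        congr 1
        ring

end StochSmooth

/-! ### The law of the sampled objective at a diagonal matrix. -/

namespace StochSmooth

open scoped NNReal ENNReal

/-! ### Integrability and distribution of the sampled objective -/

variable {n k : ℕ}

theorem integrable_sample_sq (i : Fin k) (j : Fin n) :
    Integrable (fun z : Fin k → Fin n → ℝ => z i j ^ 2) (gaussianSample n k) := by
  have h1 : MeasurePreserving (Function.eval i) (gaussianSample n k) (gaussianVec n) :=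
    measurePreserving_eval (fun _ : Fin k => gaussianVec n) i
  have h2 : MeasurePreserving (Function.eval j) (gaussianVec n) (gaussianReal 0 1) :=
    measurePreserving_eval (fun _ : Fin n => gaussianReal 0 1) j
  have h3 : Integrable (fun x : ℝ => x ^ 2) (gaussianReal 0 1) :=
    (memLp_id_gaussianReal (μ := 0) (v := 1) 2).integrable_sq
  exact (h2.comp h1).integrable_comp_of_integrable h3

theorem integrable_sampleF (hn : 0 < n) (hk : 0 < k) {ε : ℝ} (hε : 0 < ε)
    {X : Matrix (Fin n) (Fin n) ℝ} (hX : X.IsSymm) :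
    Integrable (fun z => sampleF ε X z) (gaussianSample n k) := by
  have hb : Integrable (fun z : Fin k → Fin n → ℝ => frobNorm X + ε / n * ∑ i, z i ⬝ᵥ z i)
      (gaussianSample n k) := by
    refine (integrable_const _).add (Integrable.const_mul ?_ _)
    refine integrable_finsetSum _ fun i _ => ?_
    simp only [dotProduct, ← pow_two]
    exact integrable_finsetSum _ fun j _ => integrable_sample_sq i j
  refine hb.mono' (measurable_sampleF hn hk hX).aestronglyMeasurable
    (Filter.Eventually.of_forall fun z => ?_)
  rw [Real.norm_eq_abs, abs_le]
  refine ⟨?_, sampleF_le_frobNorm_add hn hk hε hX z⟩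
  have h1 := neg_frobNorm_le_sampleF hn hk hε hX z
  have h2 : 0 ≤ ε / n * ∑ i, z i ⬝ᵥ z i :=
    mul_nonneg (by positivity) (Finset.sum_nonneg fun i _ =>
      Finset.sum_nonneg fun j _ => mul_self_nonneg _)
  linarith

/-- Probability that all `k` Gaussian vectors fall in the ellipsoid with squared axes `r m_i`. -/
noncomputable def levelMass (r : ℝ) (k : ℕ) (m : Fin n → ℝ) : ℝ :=
  open scoped Classical in if ∀ i, 0 < m i then ellMass r m ^ k else 0

/-- A rank one form is dominated by a positive diagonal form exactly when the dual norm of `v` is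
small. One direction tests the extremal vector `v_i/(s - μ_i)`; the other is Cauchy–Schwarz with
weights `s - μ_i`. -/
theorem forall_quadratic_le_iff {ε : ℝ} (hn : 0 < n) (hε : 0 < ε) {μ : Fin n → ℝ} {s : ℝ}
    (hm : ∀ i, 0 < s - μ i) (v : Fin n → ℝ) :
    (∀ x : Fin n → ℝ, x ⬝ᵥ (Matrix.diagonal μ).mulVec x + ε / n * (v ⬝ᵥ x) ^ 2 ≤ s * (x ⬝ᵥ x)) ↔
      ∑ i, v i ^ 2 / (s - μ i) ≤ n / ε := by
  have hn' : (0 : ℝ) < n := Nat.cast_pos.2 hn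
  have key : ∀ x : Fin n → ℝ, s * (x ⬝ᵥ x) - x ⬝ᵥ (Matrix.diagonal μ).mulVec x =
      ∑ i, (s - μ i) * x i ^ 2 := by
    intro x
    rw [dotProduct_diagonal_mulVec, dotProduct, Finset.mul_sum, ← Finset.sum_sub_distrib]
    exact Finset.sum_congr rfl fun i _ => by ring
  constructor
  · intro h
    have h1 := h fun i => v i / (s - μ i)
    have h2 := key fun i => v i / (s - μ i)
    have h3 : ∑ i, (s - μ i) * (v i / (s - μ i)) ^ 2 = ∑ i, v i ^ 2 / (s - μ i) :=
      Finset.sum_congr rfl fun i _ => by have := (hm i).ne'; field_simp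
    have h4 : (v ⬝ᵥ fun i => v i / (s - μ i)) = ∑ i, v i ^ 2 / (s - μ i) :=
      Finset.sum_congr rfl fun i _ => by ring
    rw [h3] at h2
    rw [h4] at h1
    set S := ∑ i, v i ^ 2 / (s - μ i)
    rcases le_or_gt S 0 with hS | hS
    · exact hS.trans (by positivity)
    have h5 : ε / n * S ^ 2 ≤ S := by linarith
    rw [le_div_iff₀ hε]
    have h6 : ε / n * S ≤ 1 := by nlinarith
    calc S * ε = ε / n * S * n := by field_simp
      _ ≤ 1 * n := mul_le_mul_of_nonneg_right h6 hn'.le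
      _ = n := one_mul _
  · intro h x
    have h1 : (v ⬝ᵥ x) ^ 2 ≤ (∑ i, v i ^ 2 / (s - μ i)) * ∑ i, (s - μ i) * x i ^ 2 := by
      refine Finset.sum_sq_le_sum_mul_sum_of_sq_le_mul Finset.univ
        (fun i _ => div_nonneg (sq_nonneg _) (hm i).le)
        (fun i _ => mul_nonneg (hm i).le (sq_nonneg _)) fun i _ => ?_
      have := (hm i).ne'
      exact le_of_eq (by field_simp)
    have h2 : 0 ≤ ∑ i, (s - μ i) * x i ^ 2 :=
      Finset.sum_nonneg fun i _ => mul_nonneg (hm i).le (sq_nonneg _)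
    have h3 : ε / n * (v ⬝ᵥ x) ^ 2 ≤ ∑ i, (s - μ i) * x i ^ 2 := by
      calc ε / n * (v ⬝ᵥ x) ^ 2 ≤ ε / n * (n / ε * ∑ i, (s - μ i) * x i ^ 2) :=
            mul_le_mul_of_nonneg_left (h1.trans (mul_le_mul_of_nonneg_right h h2)) (by positivity)
        _ = ∑ i, (s - μ i) * x i ^ 2 := by field_simp
    linarith [key x]

theorem sampleF_diagonal_cdf (hn : 0 < n) (hk : 0 < k) {ε : ℝ} (hε : 0 < ε) (μ : Fin n → ℝ)
    (s : ℝ) :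
    (gaussianSample n k).real {z | sampleF ε (Matrix.diagonal μ) z ≤ s} =
      levelMass (n / ε) k fun i => s - μ i := by
  set A : Set (Fin n → ℝ) := {v | ∀ x : Fin n → ℝ,
    x ⬝ᵥ (Matrix.diagonal μ).mulVec x + ε / n * (v ⬝ᵥ x) ^ 2 ≤ s * (x ⬝ᵥ x)} with hA
  have h1 : {z : Fin k → Fin n → ℝ | sampleF ε (Matrix.diagonal μ) z ≤ s} =
      Set.univ.pi fun _ => A := by
    ext z
    simp [sampleF_le_iff hn hk (Matrix.isSymm_diagonal μ), hA]
  have h2 : (gaussianSample n k).real {z | sampleF ε (Matrix.diagonal μ) z ≤ s} =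
      (gaussianVec n).real A ^ k := by
    rw [h1, gaussianSample, measureReal_def, Measure.pi_pi]
    simp [measureReal_def]
  rw [h2, levelMass]
  split_ifs with hm
  · congr 1
    rw [ellMass]
    congr 1
    ext v
    exact forall_quadratic_le_iff hn hε hm v
  -- When `s ≤ μ_i`, the test vector `e_i` forces `v_i = 0`, a null event; this agrees with the
  -- value 0 built into `levelMass`.
  · push Not at hm
    obtain ⟨i, hi⟩ := hm
    have hsub : A ⊆ {v | v i ^ 2 ≤ 0} := by
      intro v hv
      have h3 := hv (Pi.single i 1)
      rw [dotProduct_diagonal_mulVec] at h3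
      simp [Pi.single_apply] at h3
      have hn' : (0 : ℝ) < n := Nat.cast_pos.2 hn
      have h4 : ε / n * v i ^ 2 ≤ 0 := by linarith
      exact nonpos_of_mul_nonpos_right h4 (by positivity)
    have h5 : (gaussianVec n).real A = 0 := by
      refine le_antisymm ?_ measureReal_nonneg
      refine (measureReal_mono hsub).trans ?_
      rw [gaussianVec_real_sq_le]
      simpa using gaussSq_le_sqrt 0
    rw [h5, zero_pow hk.ne']

theorem levelMass_nonneg (r : ℝ) (k : ℕ) (m : Fin n → ℝ) : 0 ≤ levelMass r k m := by
  rw [levelMass]; split_ifs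
  · exact pow_nonneg (ellMass_nonneg _ _) _
  · exact le_rfl

theorem levelMass_of_pos {r : ℝ} {m : Fin n → ℝ} (hm : ∀ i, 0 < m i) :
    levelMass r k m = ellMass r m ^ k := by
  rw [levelMass, if_pos hm]

theorem levelMass_of_not_pos {r : ℝ} {m : Fin n → ℝ} (hm : ¬ ∀ i, 0 < m i) :
    levelMass r k m = 0 := by
  rw [levelMass, if_neg hm]

theorem levelMass_le_one (r : ℝ) (k : ℕ) (m : Fin n → ℝ) : levelMass r k m ≤ 1 := by
  rw [levelMass]; split_ifs
  · exact pow_le_one₀ (ellMass_nonneg _ _) (ellMass_le_one _ _)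
  · exact zero_le_one

theorem levelMass_le_gaussSq_pow {r : ℝ} {m : Fin n → ℝ} (i : Fin n) :
    levelMass r k m ≤ gaussSq (r * m i) ^ k := by
  rw [levelMass]; split_ifs with h
  · exact pow_le_pow_left₀ (ellMass_nonneg _ _) (ellMass_le_gaussSq h i) k
  · exact pow_nonneg (gaussSq_nonneg _) _

theorem levelMass_le_sqrt {r : ℝ} (hk : 0 < k) {m : Fin n → ℝ} (i : Fin n) :
    levelMass r k m ≤ Real.sqrt (r * m i) := by
  rw [levelMass]; split_ifs with h
  · exact (pow_le_of_le_one (ellMass_nonneg _ _) (ellMass_le_one _ _) hk.ne').trans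
      ((ellMass_le_gaussSq h i).trans (gaussSq_le_sqrt _))
  · exact Real.sqrt_nonneg _

/-- The layer-cake formula for the nonnegative function `f - s₀`, shifted back by `s₀`.
Integrability is recorded because integrands for different matrices are subtracted later. -/
theorem tail_integral {α : Type*} [MeasurableSpace α] {P : Measure α} [IsProbabilityMeasure P]
    {f : α → ℝ} (hf : Integrable f P) (hm : Measurable f) {s₀ : ℝ} (h0 : ∀ a, s₀ ≤ f a) :
    IntegrableOn (fun s => 1 - P.real {a | f a ≤ s}) (Set.Ioi s₀) ∧
      ∫ a, f a ∂P = s₀ + ∫ s in Set.Ioi s₀, (1 - P.real {a | f a ≤ s}) := by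
  have hg : Integrable (fun a => f a - s₀) P := hf.sub (integrable_const _)
  have hg0 : 0 ≤ᵐ[P] fun a => f a - s₀ := Filter.Eventually.of_forall fun a => sub_nonneg.2 (h0 a)
  have h1 : ∀ s, P.real {a | s < f a} = 1 - P.real {a | f a ≤ s} := by
    intro s
    have : {a | s < f a} = {a | f a ≤ s}ᶜ := by ext a; simp
    rw [this]; exact probReal_compl_eq_one_sub (hm measurableSet_Iic)
  have hmp : MeasurePreserving (fun s : ℝ => s + s₀) (volume.restrict (Set.Ioi 0))
      (volume.restrict (Set.Ioi s₀)) := by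
    have := (measurePreserving_add_right (volume : Measure ℝ) s₀).restrict_preimage
      (measurableSet_Ioi (a := s₀))
    simpa using this
  have hemb : MeasurableEmbedding fun s : ℝ => s + s₀ := measurableEmbedding_addRight s₀
  have h2 : ∀ t, {a | t < f a - s₀} = {a | t + s₀ < f a} := fun t => by
    ext a; simp [lt_sub_iff_add_lt]
  constructor
  · have key := lintegral_eq_lintegral_meas_lt P hg0 hg.aemeasurable
    have hfin := hg.lintegral_lt_top
    rw [key] at hfin
    have h3 : IntegrableOn (fun t => P.real {a | t < f a - s₀}) (Set.Ioi 0) := by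
      refine ⟨(Measurable.aestronglyMeasurable (Measurable.ennreal_toReal
        (Antitone.measurable fun _ _ hst => measure_mono fun _ h => lt_of_le_of_lt hst h))), ?_⟩
      rw [hasFiniteIntegral_iff_ofReal (Filter.Eventually.of_forall fun _ => measureReal_nonneg)]
      simpa [ofReal_measureReal] using hfin
    have h4 := (hmp.integrable_comp_emb hemb
      (g := fun s => 1 - P.real {a | f a ≤ s})).1 (by
        refine h3.congr_fun (fun t _ => ?_) measurableSet_Ioi
        simp only [h2, h1, Function.comp])
    exact h4
  · have h3 := hg.integral_eq_integral_meas_lt hg0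
    rw [integral_sub hf (integrable_const _)] at h3
    have h4 := hmp.integral_comp hemb fun s => 1 - P.real {a | f a ≤ s}
    rw [← h4]
    simp only [h2, h1, integral_const, probReal_univ, one_smul] at h3
    linarith

/-- Distribution-function representation of the smoothed objective at diagonal matrices. -/
theorem smoothF_diagonal (hn : 0 < n) (hk : 0 < k) {ε : ℝ} (hε : 0 < ε) (μ : Fin n → ℝ) {s₀ : ℝ}
    (h0 : s₀ ≤ -frobNorm (Matrix.diagonal μ)) :
    IntegrableOn (fun s => 1 - levelMass (n / ε) k fun i => s - μ i) (Set.Ioi s₀) ∧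
      smoothF k ε (Matrix.diagonal μ) =
        s₀ + ∫ s in Set.Ioi s₀, (1 - levelMass (n / ε) k fun i => s - μ i) := by
  have hs := Matrix.isSymm_diagonal μ
  have := tail_integral (integrable_sampleF hn hk hε hs) (measurable_sampleF hn hk hs)
    fun z => h0.trans (neg_frobNorm_le_sampleF hn hk hε hs z)
  simp only [sampleF_diagonal_cdf hn hk hε μ] at this
  exact this

end StochSmooth

/-! ### Second-order estimates for the level mass along lines. -/

namespace StochSmooth

open scoped NNReal ENNReal

/-! ### A one-sided Taylor bound for nonnegative functions -/

/-- `F` may vanish at `b`, where no derivative is available. The integral remainder bound is proved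
on `[0, x]` for `x < b`, and `x` then tends to `b`. -/
theorem taylor_lower_of_pos {F F' F'' β : ℝ → ℝ} {b : ℝ} (hb : 0 < b) (hFc : Continuous F)
    (hd : ∀ t, 0 < F t → HasDerivAt F (F' t) t) (hd2 : ∀ t, 0 < F t → HasDerivAt F' (F'' t) t)
    (hβ0 : ∀ t, 0 ≤ β t) (hβ : ∀ t, 0 < F t → -β t ≤ F'' t) (hβm : Measurable β)
    (hpos : ∀ t ∈ Set.Ico 0 b, 0 < F t)
    (hint : IntegrableOn (fun τ => (b - τ) * β τ) (Set.Ioc 0 b)) :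
    F 0 + F' 0 * b - F b ≤ ∫ τ in Set.Ioc 0 b, (b - τ) * β τ := by
  have hlim : Filter.Tendsto (fun x => F 0 + F' 0 * x - F x) (nhdsWithin b (Set.Iio b))
      (nhds (F 0 + F' 0 * b - F b)) :=
    (Continuous.tendsto (by fun_prop) b).mono_left nhdsWithin_le_nhds
  refine le_of_tendsto hlim ?_
  filter_upwards [Ioo_mem_nhdsLT hb] with x hx
  have hx0 : 0 < x := hx.1
  have hsub : Set.Ioc 0 x ⊆ Set.Ioc 0 b := Set.Ioc_subset_Ioc_right hx.2.le
  have hint' : IntegrableOn (fun τ => (x - τ) * β τ) (Set.Ioc 0 x) := by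
    refine (hint.mono_set hsub).mono' (by fun_prop) ?_
    refine (ae_restrict_iff' measurableSet_Ioc).2 (Filter.Eventually.of_forall fun τ hτ => ?_)
    rw [Real.norm_of_nonneg (mul_nonneg (sub_nonneg.2 hτ.2) (hβ0 τ))]
    exact mul_le_mul_of_nonneg_right (by linarith [hx.2]) (hβ0 τ)
  have hp : ∀ t ∈ Set.Icc 0 x, 0 < F t := fun t ht => hpos t ⟨ht.1, ht.2.trans_lt hx.2⟩
  have hder : ∀ t ∈ Set.Icc 0 x,
      HasDerivAt (fun τ => -(F' τ * (x - τ) + F τ)) (-(F'' t * (x - t))) t := by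
    intro t ht
    have e1 : HasDerivAt (fun τ : ℝ => x - τ) (-1) t := by
      simpa using (hasDerivAt_id t).const_sub x
    refine (((hd2 t (hp t ht)).fun_mul e1).fun_add (hd t (hp t ht))).fun_neg.congr_deriv ?_
    ring
  have := intervalIntegral.sub_le_integral_of_hasDeriv_right_of_le
    (g := fun τ => -(F' τ * (x - τ) + F τ)) (g' := fun t => -(F'' t * (x - t)))
    (φ := fun τ => (x - τ) * β τ) hx0.le
    (fun t ht => (hder t ht).continuousAt.continuousWithinAt)
    (fun t ht => (hder t (Set.Ioo_subset_Icc_self ht)).hasDerivWithinAt)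
    ((integrableOn_Icc_iff_integrableOn_Ioc enorm_ne_top).2 hint')
    (fun t ht => by
      have h1 := hβ t (hp t (Set.Ioo_subset_Icc_self ht))
      have h2 : 0 ≤ x - t := by linarith [ht.2]
      nlinarith)
  rw [intervalIntegral.integral_of_le hx0.le] at this
  have h3 : ∫ τ in Set.Ioc 0 x, (x - τ) * β τ ≤ ∫ τ in Set.Ioc 0 b, (b - τ) * β τ := by
    refine le_trans (setIntegral_mono_on hint' (hint.mono_set hsub) measurableSet_Ioc
      fun τ _ => mul_le_mul_of_nonneg_right (by linarith [hx.2]) (hβ0 τ)) ?_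
    refine setIntegral_mono_set hint ?_ hsub.eventuallyLE
    exact (ae_restrict_iff' measurableSet_Ioc).2 (Filter.Eventually.of_forall fun τ hτ =>
      mul_nonneg (sub_nonneg.2 hτ.2) (hβ0 τ))
  simp only [sub_self, mul_zero, zero_add, sub_zero] at this
  linarith

/-- Lines of matrices may leave the region where the level mass is positive, and `F` is not assumed
differentiable at its zeros. If `F` vanishes before `b`, the bound up to the first zero `c` is
stretched to `b`. Extended nonnegative integrals avoid any integrability assumption on `β`. -/
theorem taylor_lower {F F' F'' β : ℝ → ℝ} {b : ℝ} (hb : 0 < b) (hFc : Continuous F)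
    (hF0 : ∀ t, 0 ≤ F t) (hd : ∀ t, 0 < F t → HasDerivAt F (F' t) t)
    (hd2 : ∀ t, 0 < F t → HasDerivAt F' (F'' t) t) (hβ0 : ∀ t, 0 ≤ β t)
    (hβ : ∀ t, 0 < F t → -β t ≤ F'' t) (hβm : Measurable β) (h0 : 0 < F 0) :
    ENNReal.ofReal (F 0 + F' 0 * b - F b) ≤
      ∫⁻ τ in Set.Ioc 0 b, ENNReal.ofReal ((b - τ) * β τ) := by
  have hnn : 0 ≤ᵐ[volume.restrict (Set.Ioc 0 b)] fun τ => (b - τ) * β τ :=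
    (ae_restrict_iff' measurableSet_Ioc).2 (Filter.Eventually.of_forall fun τ hτ =>
      mul_nonneg (sub_nonneg.2 hτ.2) (hβ0 τ))
  by_cases hfin : ∫⁻ τ in Set.Ioc 0 b, ENNReal.ofReal ((b - τ) * β τ) = ∞
  · rw [hfin]; exact le_top
  have hint : IntegrableOn (fun τ => (b - τ) * β τ) (Set.Ioc 0 b) := by
    refine ⟨by fun_prop, ?_⟩
    rw [hasFiniteIntegral_iff_ofReal hnn]
    exact lt_top_iff_ne_top.2 hfin
  rw [← ofReal_integral_eq_lintegral_ofReal hint hnn]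
  refine ENNReal.ofReal_le_ofReal ?_
  by_cases hall : ∀ t ∈ Set.Ico 0 b, 0 < F t
  · exact taylor_lower_of_pos hb hFc hd hd2 hβ0 hβ hβm hall hint
  push Not at hall
  obtain ⟨t₀, ht₀, hFt₀⟩ := hall
  have hK : IsCompact (Set.Icc 0 b ∩ F ⁻¹' {0}) :=
    isCompact_Icc.inter_right (isClosed_singleton.preimage hFc)
  obtain ⟨c, ⟨hc, hFc0⟩, hmin⟩ := hK.exists_isLeast
    ⟨t₀, Set.Ico_subset_Icc_self ht₀, le_antisymm hFt₀ (hF0 t₀)⟩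
  have hFc0 : F c = 0 := hFc0
  have hc0 : 0 < c := lt_of_le_of_ne hc.1 fun h => by rw [← h] at hFc0; exact h0.ne' hFc0
  have hpos : ∀ t ∈ Set.Ico 0 c, 0 < F t := fun t ht =>
    lt_of_le_of_ne (hF0 t) fun h => absurd (hmin ⟨⟨ht.1, ht.2.le.trans hc.2⟩, h.symm⟩) (not_le.2 ht.2)
  have hsub : Set.Ioc 0 c ⊆ Set.Ioc 0 b := Set.Ioc_subset_Ioc_right hc.2
  have hint' : IntegrableOn (fun τ => (c - τ) * β τ) (Set.Ioc 0 c) := by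
    refine (hint.mono_set hsub).mono' (by fun_prop) ?_
    refine (ae_restrict_iff' measurableSet_Ioc).2 (Filter.Eventually.of_forall fun τ hτ => ?_)
    rw [Real.norm_of_nonneg (mul_nonneg (sub_nonneg.2 hτ.2) (hβ0 τ))]
    exact mul_le_mul_of_nonneg_right (by linarith [hc.2]) (hβ0 τ)
  have h1 := taylor_lower_of_pos hc0 hFc hd hd2 hβ0 hβ hβm hpos hint'
  -- Multiplying by `b/c ≥ 1` restores the linear term `F' 0 * b`, while the kernel `(b/c)(c - τ)`
  -- stays below `b - τ`. The values `F 0` and `F b` only help, being nonnegative.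
  have h2 : b / c * ∫ τ in Set.Ioc 0 c, (c - τ) * β τ ≤ ∫ τ in Set.Ioc 0 b, (b - τ) * β τ := by
    rw [← integral_const_mul]
    refine le_trans (setIntegral_mono_on (hint'.const_mul _) (hint.mono_set hsub) measurableSet_Ioc
      fun τ hτ => ?_) (setIntegral_mono_set hint hnn hsub.eventuallyLE)
    rw [← mul_assoc]
    refine mul_le_mul_of_nonneg_right ?_ (hβ0 τ)
    have : b / c * (c - τ) = b - b / c * τ := by field_simp
    rw [this]
    have h3 : 1 ≤ b / c := (one_le_div hc0).2 hc.2
    nlinarith [hτ.1]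
  rw [hFc0, sub_zero] at h1
  have h3 := mul_le_mul_of_nonneg_left h1 (by positivity : 0 ≤ b / c)
  have h4 : b / c * (F 0 + F' 0 * c) = b / c * F 0 + F' 0 * b := by field_simp
  have h5 : F 0 ≤ b / c * F 0 := le_mul_of_one_le_left (hF0 0) ((one_le_div hc0).2 hc.2)
  linarith [hF0 b]

/-! ### Regularity of the level mass -/

variable {n k : ℕ}

theorem continuous_ballInt {r : ℝ} {q : (Fin n → ℝ) → ℝ} (hq : Continuous q) :
    Continuous fun m => ballInt r m q := by
  unfold ballInt
  refine continuous_parametric_integral_of_continuous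
    (f := fun (m w : Fin n → ℝ) => q w * Real.exp (-(∑ i, m i * w i ^ 2) / 2)) ?_
    (isCompact_sqBall r)
  unfold Function.uncurry
  fun_prop

theorem continuousAt_varDefect {r : ℝ} (hr : 0 < r) {m : Fin n → ℝ} (hm : ∀ i, 0 < m i)
    (i : Fin n) : ContinuousAt (fun m => varDefect r m i) m := by
  refine ContinuousAt.sub ((continuous_apply i).continuousAt.inv₀ (hm i).ne') ?_
  exact (continuous_ballInt (by fun_prop)).continuousAt.div
    (continuous_ballInt (by fun_prop)).continuousAt (ballInt_one_pos hr m).ne'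

theorem measurable_varDefect (r : ℝ) (i : Fin n) :
    Measurable fun m : Fin n → ℝ => varDefect r m i :=
  (measurable_pi_apply i).inv.sub ((continuous_ballInt (by fun_prop)).measurable.div
    (continuous_ballInt (by fun_prop)).measurable)

theorem measurable_logMass {r : ℝ} : Measurable fun m : Fin n → ℝ => logMass r m := by
  refine Measurable.add (by fun_prop) ?_
  exact Real.measurable_log.comp (continuous_ballInt (by fun_prop)).measurable

theorem isOpen_pos : IsOpen {m : Fin n → ℝ | ∀ i, 0 < m i} := by
  rw [Set.ofPred_forall]
  exact isOpen_iInter_of_finite fun i => isOpen_lt continuous_const (continuous_apply i)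

theorem measurable_levelMass {r : ℝ} (hr : 0 < r) (k : ℕ) :
    Measurable fun m : Fin n → ℝ => levelMass r k m := by
  classical
  have : (fun m : Fin n → ℝ => levelMass r k m) = fun m => if m ∈ {m : Fin n → ℝ | ∀ i, 0 < m i}
      then ((Real.sqrt (2 * Real.pi) ^ n)⁻¹ * Real.exp (logMass r m)) ^ k else 0 := by
    ext m
    rw [levelMass]
    by_cases hm : ∀ i, 0 < m i
    · rw [if_pos hm, if_pos (show m ∈ {m : Fin n → ℝ | ∀ i, 0 < m i} from hm), ellMass_eq hr hm]
    · rw [if_neg hm, if_neg (show ¬ m ∈ {m : Fin n → ℝ | ∀ i, 0 < m i} from hm)]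
  rw [this]
  refine Measurable.ite isOpen_pos.measurableSet ?_ measurable_const
  exact ((Real.measurable_exp.comp measurable_logMass).const_mul _).pow_const k

theorem levelMass_pos_iff {r : ℝ} (hr : 0 < r) {m : Fin n → ℝ} :
    0 < levelMass r k m ↔ ∀ i, 0 < m i := by
  constructor
  · intro h
    by_contra hm
    rw [levelMass_of_not_pos hm] at h
    exact lt_irrefl _ h
  · intro hm
    rw [levelMass_of_pos hm, ellMass_eq hr hm]
    have := Real.exp_pos (logMass r m)
    have := Real.pi_pos
    positivity

theorem hasDerivAt_levelMass {r : ℝ} (hr : 0 < r) (k : ℕ) (m e : Fin n → ℝ) (t : ℝ)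
    (hm : ∀ i, 0 < (m + t • e) i) :
    HasDerivAt (fun t : ℝ => levelMass r k (m + t • e))
      (levelMass r k (m + t • e) * (k * ((∑ i, e i * varDefect r (m + t • e) i) / 2))) t := by
  have hev : (fun t : ℝ => levelMass r k (m + t • e)) =ᶠ[nhds t]
      fun t => ((Real.sqrt (2 * Real.pi) ^ n)⁻¹) ^ k * Real.exp (k * logMass r (m + t • e)) := by
    have hc : Continuous fun t : ℝ => m + t • e := by fun_prop
    filter_upwards [hc.continuousAt.preimage_mem_nhds (isOpen_pos.mem_nhds hm)] with s hs
    rw [levelMass_of_pos hs, ellMass_eq hr hs, mul_pow, ← Real.exp_nat_mul]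
  have h1 := (((hasDerivAt_logMass hr m e t hm).const_mul (k : ℝ)).exp).const_mul
    (((Real.sqrt (2 * Real.pi) ^ n)⁻¹) ^ k)
  refine (h1.congr_of_eventuallyEq hev).congr_deriv ?_
  rw [levelMass_of_pos hm, ellMass_eq hr hm, mul_pow, ← Real.exp_nat_mul]
  ring

/-- Inside the positive region the function is differentiable. Outside it is 0, and
`levelMass_le_sqrt` squeezes nearby values by the root of an axis parameter that becomes
nonpositive. -/
theorem continuous_levelMass_line {r : ℝ} (hr : 0 < r) (hk : 0 < k) (m e : Fin n → ℝ) :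
    Continuous fun t : ℝ => levelMass r k (m + t • e) := by
  rw [continuous_iff_continuousAt]
  intro t
  by_cases hm : ∀ i, 0 < (m + t • e) i
  · exact (hasDerivAt_levelMass hr k m e t hm).continuousAt
  · have h0 := levelMass_of_not_pos (r := r) (k := k) hm
    push Not at hm
    obtain ⟨i, hi⟩ := hm
    rw [ContinuousAt, h0]
    have hc : Continuous fun t : ℝ => Real.sqrt (r * (m + t • e) i) := by
      simp only [Pi.add_apply, Pi.smul_apply, smul_eq_mul]; fun_prop
    have hlim := hc.tendsto t
    rw [Real.sqrt_eq_zero_of_nonpos (mul_nonpos_of_nonneg_of_nonpos hr.le hi)] at hlim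
    exact squeeze_zero (fun s => levelMass_nonneg _ _ _) (fun s => levelMass_le_sqrt hk i) hlim

/-- Rate of change of the level mass when all squared axes grow at unit speed. -/
noncomputable def levelRate (r : ℝ) (k : ℕ) (m : Fin n → ℝ) : ℝ :=
  levelMass r k m * (k * ((∑ i, varDefect r m i) / 2))

/-- Upper bound for the negative part of the second derivative of the level mass. -/
noncomputable def curvBound (r : ℝ) (k : ℕ) (m : Fin n → ℝ) : ℝ :=
  levelRate r k m * ((⨅ i, m i)⁻¹ + 3 / 4 * r)

theorem measurable_levelRate {r : ℝ} (hr : 0 < r) (k : ℕ) :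
    Measurable fun m : Fin n → ℝ => levelRate r k m := by
  refine (measurable_levelMass hr k).mul (Measurable.const_mul (Measurable.div_const ?_ _) _)
  exact Finset.measurable_fun_sum _ fun i _ => measurable_varDefect r i

theorem measurable_curvBound {r : ℝ} (hr : 0 < r) (k : ℕ) :
    Measurable fun m : Fin n → ℝ => curvBound r k m :=
  (measurable_levelRate hr k).mul
    (((Measurable.iInf fun i => measurable_pi_apply i).inv).add_const _)

theorem levelRate_nonneg {r : ℝ} (hr : 0 < r) (m : Fin n → ℝ) : 0 ≤ levelRate r k m := by
  rw [levelRate]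
  by_cases hm : ∀ i, 0 < m i
  · have := Finset.sum_nonneg fun i (_ : i ∈ Finset.univ) => varDefect_nonneg hr hm i
    have := levelMass_nonneg r k m
    positivity
  · rw [levelMass_of_not_pos hm, zero_mul]

theorem curvBound_nonneg {r : ℝ} (hr : 0 < r) (m : Fin n → ℝ) : 0 ≤ curvBound r k m := by
  by_cases hm : ∀ i, 0 < m i
  · have := levelRate_nonneg (k := k) hr m
    have := Real.iInf_nonneg fun i => (hm i).le
    rw [curvBound]
    positivity
  · rw [curvBound, levelRate, levelMass_of_not_pos hm, zero_mul, zero_mul]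

/-- With `f` the log mass, the second derivative of `exp(k f)` is `exp(k f)(k f'' + (k f')²)`. The
square is dropped, and the reverse variance inequality bounds `-f''` with `V` the inverse of the
smallest precision. -/
theorem second_deriv_levelMass {r : ℝ} (hr : 0 < r) (k : ℕ) (m e : Fin n → ℝ) (t : ℝ)
    (hm : ∀ i, 0 < (m + t • e) i) :
    ∃ F'' : ℝ, HasDerivAt (fun t : ℝ => levelMass r k (m + t • e) *
        (k * ((∑ i, e i * varDefect r (m + t • e) i) / 2))) F'' t ∧
      -(curvBound r k (m + t • e) * ∑ i, e i ^ 2) ≤ F'' := by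
  refine ⟨_, (hasDerivAt_levelMass hr k m e t hm).fun_mul
    ((hasDerivAt_varDefect hr m e t hm).const_mul (k : ℝ)), ?_⟩
  set p := m + t • e
  have hV : ∀ i, (p i)⁻¹ ≤ (⨅ i, p i)⁻¹ := by
    intro i
    have : Nonempty (Fin n) := ⟨i⟩
    obtain ⟨j, hj⟩ := exists_eq_ciInf_of_finite (f := p)
    have h1 : (⨅ i, p i) ≤ p i := ciInf_le (Set.finite_range p).bddBelow i
    have h2 : 0 < ⨅ i, p i := by rw [← hj]; exact hm j
    exact inv_anti₀ h2 h1
  have h1 := sum_sq_sub_ballVar_le hr hm hV e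
  have h2 := mul_le_mul_of_nonneg_left h1
    (mul_nonneg (Nat.cast_nonneg (α := ℝ) k) (levelMass_nonneg r k p))
  have h3 : 0 ≤ levelMass r k p * (k * ((∑ i, e i * varDefect r p i) / 2)) ^ 2 :=
    mul_nonneg (levelMass_nonneg r k p) (sq_nonneg _)
  rw [curvBound, levelRate]
  nlinarith

end StochSmooth

/-! ### From integrated curvature to semiconcavity on diagonal matrices. -/

namespace StochSmooth

open scoped NNReal ENNReal

/-! ### Integrated curvature -/

variable {n k : ℕ}

/-- Exhaustion by compact intervals. The term `T⁻¹` makes room for a boundary contribution that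
disappears at infinity. -/
theorem lintegral_Ioi_le_of_Ioc {f : ℝ → ℝ≥0∞} {K : ℝ≥0∞}
    (h : ∀ δ T : ℝ, 0 < δ → δ ≤ T → ∫⁻ u in Set.Ioc δ T, f u ≤ ENNReal.ofReal T⁻¹ + K) :
    ∫⁻ u in Set.Ioi 0, f u ≤ K := by
  have hU : Set.Ioi (0 : ℝ) = ⋃ j : ℕ, Set.Ioc ((j : ℝ) + 1)⁻¹ ((j : ℝ) + 1) := by
    ext u
    simp only [Set.mem_Ioi, Set.mem_iUnion, Set.mem_Ioc]
    constructor
    · intro hu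
      obtain ⟨j, hj⟩ := exists_nat_gt (max u u⁻¹)
      have h1 := (le_max_left u u⁻¹).trans_lt hj
      have h2 := (le_max_right u u⁻¹).trans_lt hj
      refine ⟨j, ?_, by linarith⟩
      exact inv_lt_of_inv_lt₀ hu (by linarith)
    · rintro ⟨j, hj, -⟩
      exact lt_trans (by positivity) hj
  have hmono : Monotone fun j : ℕ => Set.Ioc ((j : ℝ) + 1)⁻¹ ((j : ℝ) + 1) := by
    intro i j hij
    have : (i : ℝ) ≤ j := by exact_mod_cast hij
    exact Set.Ioc_subset_Ioc (inv_anti₀ (by positivity) (by linarith)) (by linarith)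
  rw [hU, setLIntegral_iUnion_of_directed _ hmono.directed_le]
  refine iSup_le fun j => ?_
  have hlim : Filter.Tendsto (fun i : ℕ => ENNReal.ofReal ((i : ℝ) + 1)⁻¹ + K) Filter.atTop
      (nhds (0 + K)) := by
    refine Filter.Tendsto.add ?_ tendsto_const_nhds
    have h1 := tendsto_one_div_add_atTop_nhds_zero_nat (𝕜 := ℝ)
    simp only [one_div] at h1
    simpa using ENNReal.tendsto_ofReal h1
  rw [zero_add] at hlim
  refine ge_of_tendsto hlim ?_
  filter_upwards [Filter.eventually_ge_atTop j] with i hi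
  refine (lintegral_mono_set (hmono hi)).trans (h _ _ (by positivity) ?_)
  exact (inv_le_one_of_one_le₀ (by linarith [Nat.cast_nonneg (α := ℝ) i])).trans
    (by linarith [Nat.cast_nonneg (α := ℝ) i])

/-- `levelRate` is the `u`-derivative of the level mass `R`, so the weight is moved by integration
by parts. The boundary term at `δ` has a favourable sign, the one at `T` is at most `1/T + 3r/4`
because `R ≤ 1`, and the remaining `∫ R/u²` is at most `r C_k`: since `m j = 0`, coordinate `j`
alone gives `R(u) ≤ gaussSq (r u)^k`. -/
theorem lintegral_levelRate_mul_le {r : ℝ} (hr : 0 < r) (hk : 3 ≤ k) {m : Fin n → ℝ}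
    (hm : ∀ i, 0 ≤ m i) {j : Fin n} (hj : m j = 0) :
    ∫⁻ u in Set.Ioi (0 : ℝ), ENNReal.ofReal
      (levelRate r k (m + u • (1 : Fin n → ℝ)) * (u⁻¹ + 3 / 4 * r)) ≤
      ENNReal.ofReal (r * (constC k + 3 / 4)) := by
  have hC : 0 ≤ constC k := by
    have : (3 : ℝ) ≤ k := by exact_mod_cast hk
    exact div_nonneg (by linarith) (by linarith)
  have hpos : ∀ u : ℝ, 0 < u → ∀ i, 0 < (m + u • (1 : Fin n → ℝ)) i := fun u hu i => by
    simpa using add_pos_of_nonneg_of_pos (hm i) hu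
  have hd : ∀ u : ℝ, 0 < u → HasDerivAt (fun u : ℝ => levelMass r k (m + u • (1 : Fin n → ℝ)))
      (levelRate r k (m + u • (1 : Fin n → ℝ))) u := fun u hu => by
    simpa [levelRate] using hasDerivAt_levelMass hr k m 1 u (hpos u hu)
  refine lintegral_Ioi_le_of_Ioc fun δ T hδ hδT => ?_
  have hT : 0 < T := hδ.trans_le hδT
  set R : ℝ → ℝ := fun u => levelMass r k (m + u • (1 : Fin n → ℝ)) with hR
  set ρ : ℝ → ℝ := fun u => levelRate r k (m + u • (1 : Fin n → ℝ)) with hρ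
  have hIcc : ∀ u ∈ Set.Icc δ T, 0 < u := fun u hu => hδ.trans_le hu.1
  have hRc : ContinuousOn R (Set.Icc δ T) := fun u hu =>
    (hd u (hIcc u hu)).continuousAt.continuousWithinAt
  have hρc : ContinuousOn ρ (Set.Icc δ T) := by
    intro u hu
    have hline : ContinuousAt (fun u : ℝ => m + u • (1 : Fin n → ℝ)) u := by fun_prop
    have h1 : ContinuousAt (fun u : ℝ => ∑ i, varDefect r (m + u • (1 : Fin n → ℝ)) i) u :=
      tendsto_finsetSum _ fun i _ =>
        (continuousAt_varDefect hr (hpos u (hIcc u hu)) i).comp_of_eq hline rfl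
    exact ((hd u (hIcc u hu)).continuousAt.mul
      (continuousAt_const.mul (h1.div_const 2))).continuousWithinAt
  have hinv : ContinuousOn (fun u : ℝ => u⁻¹) (Set.Icc δ T) := fun u hu =>
    (continuousAt_inv₀ (hIcc u hu).ne').continuousWithinAt
  have hA : IntegrableOn (fun u => ρ u * (u⁻¹ + 3 / 4 * r)) (Set.Icc δ T) :=
    (hρc.mul (hinv.add continuousOn_const)).integrableOn_compact isCompact_Icc
  have hB : IntegrableOn (fun u => R u / u ^ 2) (Set.Icc δ T) := by
    refine ContinuousOn.integrableOn_compact isCompact_Icc ?_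
    exact hRc.div (by fun_prop) fun u hu => (pow_pos (hIcc u hu) 2).ne'
  have hW : ∀ u ∈ Set.uIcc δ T, HasDerivAt (fun u => R u * (u⁻¹ + 3 / 4 * r))
      (ρ u * (u⁻¹ + 3 / 4 * r) - R u / u ^ 2) u := by
    intro u hu
    rw [Set.uIcc_of_le hδT] at hu
    refine ((hd u (hIcc u hu)).fun_mul
      ((hasDerivAt_inv (hIcc u hu).ne').add_const (3 / 4 * r))).congr_deriv ?_
    simp only [hR, hρ]
    ring
  have hA' := hA.mono_set Set.Ioc_subset_Icc_self
  have hB' := hB.mono_set Set.Ioc_subset_Icc_self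
  have hftc := intervalIntegral.integral_eq_sub_of_hasDerivAt hW
    ((intervalIntegrable_iff_integrableOn_Ioc_of_le hδT).2 (hA'.sub hB'))
  rw [intervalIntegral.integral_of_le hδT, integral_sub hA' hB'] at hftc
  have hR0 : ∀ u, 0 ≤ R u := fun u => levelMass_nonneg _ _ _
  have hWδ : 0 ≤ R δ * (δ⁻¹ + 3 / 4 * r) := mul_nonneg (hR0 δ) (by positivity)
  have hWT : R T * (T⁻¹ + 3 / 4 * r) ≤ T⁻¹ + 3 / 4 * r :=
    mul_le_of_le_one_left (by positivity) (levelMass_le_one _ _ _)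
  have hnn : ∀ᵐ u ∂(volume.restrict (Set.Ioc δ T)), 0 ≤ ρ u * (u⁻¹ + 3 / 4 * r) :=
    (ae_restrict_iff' measurableSet_Ioc).2 (Filter.Eventually.of_forall fun u hu =>
      mul_nonneg (levelRate_nonneg hr _) (by have := hδ.trans hu.1; positivity))
  rw [← ofReal_integral_eq_lintegral_ofReal hA' hnn]
  have hB2 : ENNReal.ofReal (∫ u in Set.Ioc δ T, R u / u ^ 2) ≤ ENNReal.ofReal (r * constC k) := by
    rw [ofReal_integral_eq_lintegral_ofReal hB' (Filter.Eventually.of_forall fun u =>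
      div_nonneg (hR0 u) (sq_nonneg u))]
    refine le_trans ?_ (lintegral_gaussSq_pow_div_sq hk hr)
    refine le_trans (lintegral_mono fun u => ?_)
      (lintegral_mono_set (fun u hu => hδ.trans hu.1))
    refine ENNReal.ofReal_le_ofReal (div_le_div_of_nonneg_right ?_ (sq_nonneg u))
    have := levelMass_le_gaussSq_pow (r := r) (k := k) (m := m + u • (1 : Fin n → ℝ)) j
    simpa [hj] using this
  have hB3 : ∫ u in Set.Ioc δ T, R u / u ^ 2 ≤ r * constC k :=
    (ENNReal.ofReal_le_ofReal_iff (mul_nonneg hr.le hC)).1 hB2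
  rw [← ENNReal.ofReal_add (by positivity) (by positivity)]
  refine ENNReal.ofReal_le_ofReal ?_
  linarith

/-- With `u` the height of `s` above the largest `ν_j`, the smallest precision equals `u`, and the
curvature bound vanishes for `u ≤ 0`. The resulting bound does not depend on `ν`. -/
theorem lintegral_curvBound_le (hn : 0 < n) {r : ℝ} (hr : 0 < r) (hk : 3 ≤ k) (ν : Fin n → ℝ) :
    ∫⁻ s : ℝ, ENNReal.ofReal (curvBound r k fun i => s - ν i) ≤
      ENNReal.ofReal (r * (constC k + 3 / 4)) := by
  have : Nonempty (Fin n) := ⟨⟨0, hn⟩⟩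
  obtain ⟨j, hj⟩ := Finite.exists_max ν
  have hm : ∀ i, 0 ≤ (fun i => ν j - ν i) i := fun i => sub_nonneg.2 (hj i)
  refine le_trans ?_ (lintegral_levelRate_mul_le hr hk hm (j := j) (sub_self _))
  rw [← lintegral_add_right_eq_self _ (ν j), ← lintegral_indicator measurableSet_Ioi]
  refine lintegral_mono fun u => ?_
  have hline : (fun i => u + ν j - ν i) = (fun i => ν j - ν i) + u • (1 : Fin n → ℝ) := by
    ext i; simp; ring
  rcases le_or_gt u 0 with hu | hu
  · have : ¬ ∀ i, 0 < u + ν j - ν i := fun h => by have := h j; linarith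
    rw [curvBound, levelRate, levelMass_of_not_pos this]
    simp
  · rw [Set.indicator_of_mem (Set.mem_Ioi.2 hu), curvBound, hline]
    have hinf : (⨅ i, ((fun i => ν j - ν i) + u • (1 : Fin n → ℝ)) i) = u := by
      refine le_antisymm ?_ (le_ciInf fun i => ?_)
      · refine (ciInf_le (Set.finite_range _).bddBelow j).trans (le_of_eq ?_)
        simp
      · simp [hj i]
    rw [hinf]

/-! ### Semiconcavity of the smoothed objective on diagonal matrices -/

/-- Taylor bounds in the opposite directions `-h` and `h`, over lengths `1 - l` and `l` and with
weights `l` and `1 - l`, have cancelling first-order terms. -/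
theorem levelMass_second_difference {r : ℝ} (hr : 0 < r) (hk : 0 < k) (μ h : Fin n → ℝ) (s : ℝ)
    {l : ℝ} (hl0 : 0 < l) (hl1 : l < 1) :
    ENNReal.ofReal ((levelMass r k fun i => s - μ i) -
        (1 - l) * (levelMass r k fun i => s - (μ + (-l) • h) i) -
        l * (levelMass r k fun i => s - (μ + (1 - l) • h) i)) ≤
      ENNReal.ofReal l * (∫⁻ τ in Set.Ioc 0 (1 - l), ENNReal.ofReal ((1 - l - τ) *
        ((curvBound r k fun i => s - (μ + τ • h) i) * ∑ i, h i ^ 2))) +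
      ENNReal.ofReal (1 - l) * (∫⁻ τ in Set.Ioc 0 l, ENNReal.ofReal ((l - τ) *
        ((curvBound r k fun i => s - (μ + (-τ) • h) i) * ∑ i, h i ^ 2))) := by
  set p : Fin n → ℝ := fun i => s - μ i with hp
  have hline : ∀ t : ℝ, (fun i => s - (μ + t • h) i) = p + t • (-h) := fun t => by
    ext i; simp [hp]; ring
  have hline' : ∀ t : ℝ, (fun i => s - (μ + (-t) • h) i) = p + t • h := fun t => by
    ext i; simp [hp]; ring
  have e1 : (fun i => s - (μ + (-l) • h) i) = p + l • h := hline' l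
  rw [e1, hline (1 - l)]
  simp only [hline']
  simp only [hline]
  -- If the central mass is zero, the second difference is nonpositive and no Taylor expansion is
  -- needed.
  rcases (levelMass_nonneg r k p).eq_or_lt with h0 | h0
  · rw [← h0, ENNReal.ofReal_of_nonpos]
    · exact zero_le
    · have h1 := mul_nonneg (sub_nonneg.2 hl1.le) (levelMass_nonneg r k (p + l • h))
      have h2 := mul_nonneg hl0.le (levelMass_nonneg r k (p + (1 - l) • (-h)))
      linarith
  have taylor : ∀ (e : Fin n → ℝ) (b : ℝ), 0 < b →
      ENNReal.ofReal (levelMass r k p +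
        levelMass r k p * (k * ((∑ i, e i * varDefect r p i) / 2)) * b -
        levelMass r k (p + b • e)) ≤ ∫⁻ τ in Set.Ioc 0 b, ENNReal.ofReal ((b - τ) *
          (curvBound r k (p + τ • e) * ∑ i, e i ^ 2)) := by
    intro e b hb
    have hsec := fun t (ht : ∀ i, 0 < (p + t • e) i) => second_deriv_levelMass hr k p e t ht
    choose! F'' hF1 hF2 using hsec
    have := taylor_lower (F := fun t => levelMass r k (p + t • e))
      (F' := fun t => levelMass r k (p + t • e) *
        (k * ((∑ i, e i * varDefect r (p + t • e) i) / 2)))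
      (F'' := F'') (β := fun t => curvBound r k (p + t • e) * ∑ i, e i ^ 2) hb
      (continuous_levelMass_line hr hk p e) (fun t => levelMass_nonneg _ _ _)
      (fun t ht => hasDerivAt_levelMass hr k p e t ((levelMass_pos_iff hr).1 ht))
      (fun t ht => hF1 t ((levelMass_pos_iff hr).1 ht))
      (fun t => mul_nonneg (curvBound_nonneg hr _) (Finset.sum_nonneg fun i _ => sq_nonneg _))
      (fun t ht => hF2 t ((levelMass_pos_iff hr).1 ht))
      (((measurable_curvBound hr k).comp (by fun_prop)).mul_const _) (by simpa using h0)
    simpa using this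
  have t1 := taylor (-h) (1 - l) (by linarith)
  have t2 := taylor h l hl0
  simp only [Pi.neg_apply, neg_mul, Finset.sum_neg_distrib, neg_sq] at t1
  set D := levelMass r k p * (k * ((∑ i, h i * varDefect r p i) / 2)) with hD
  have hD' : levelMass r k p * (k * (-(∑ i, h i * varDefect r p i) / 2)) = -D := by
    rw [hD]; ring
  rw [hD'] at t1
  refine le_trans ?_ (add_le_add (mul_le_mul_right t1 _) (mul_le_mul_right t2 _))
  rw [← ENNReal.ofReal_mul hl0.le, ← ENNReal.ofReal_mul (by linarith)]
  refine le_trans (ENNReal.ofReal_le_ofReal (le_of_eq ?_)) ENNReal.ofReal_add_le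
  ring

/-- After exchanging the integrals the curvature bound is uniform in the base point, so `ν` may move
with `τ`; the factor `b²/2` is the integral of `b - τ`. -/
theorem lintegral_weighted_curvBound_le (hn : 0 < n) {r : ℝ} (hr : 0 < r) (hk : 3 ≤ k)
    {ν : ℝ → Fin n → ℝ} (hν : Measurable ν) {H b : ℝ} (hH : 0 ≤ H) (hb : 0 ≤ b) :
    ∫⁻ s : ℝ, ∫⁻ τ in Set.Ioc 0 b,
      ENNReal.ofReal ((b - τ) * ((curvBound r k fun i => s - ν τ i) * H)) ≤
      ENNReal.ofReal (b ^ 2 / 2 * (r * (constC k + 3 / 4) * H)) := by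
  have hC : 0 ≤ constC k := by
    have : (3 : ℝ) ≤ k := by exact_mod_cast hk
    exact div_nonneg (by linarith) (by linarith)
  have hmeas : Measurable fun p : ℝ × ℝ => curvBound r k fun i => p.1 - ν p.2 i := by
    refine (measurable_curvBound hr k).comp (measurable_pi_lambda _ fun i => ?_)
    exact measurable_fst.sub ((measurable_pi_apply i).comp (hν.comp measurable_snd))
  rw [lintegral_lintegral_swap (by fun_prop)]
  calc ∫⁻ τ in Set.Ioc 0 b, ∫⁻ s : ℝ,
        ENNReal.ofReal ((b - τ) * ((curvBound r k fun i => s - ν τ i) * H))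
      ≤ ∫⁻ τ in Set.Ioc 0 b, ENNReal.ofReal ((b - τ) * (r * (constC k + 3 / 4) * H)) := by
        refine setLIntegral_mono' measurableSet_Ioc fun τ hτ => ?_
        have h1 : ∀ s, ENNReal.ofReal ((b - τ) * ((curvBound r k fun i => s - ν τ i) * H)) =
            ENNReal.ofReal ((b - τ) * H) * ENNReal.ofReal (curvBound r k fun i => s - ν τ i) :=
          fun s => by
            rw [← ENNReal.ofReal_mul (mul_nonneg (sub_nonneg.2 hτ.2) hH)]
            congr 1; ring
        simp only [h1]
        rw [lintegral_const_mul' _ _ ENNReal.ofReal_ne_top]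
        refine (mul_le_mul_right (lintegral_curvBound_le hn hr hk (ν τ)) _).trans (le_of_eq ?_)
        rw [← ENNReal.ofReal_mul (mul_nonneg (sub_nonneg.2 hτ.2) hH)]
        congr 1; ring
    _ = ENNReal.ofReal (b ^ 2 / 2 * (r * (constC k + 3 / 4) * H)) := by
        rw [← ofReal_integral_eq_lintegral_ofReal
          ((by fun_prop : Continuous fun τ => (b - τ) * (r * (constC k + 3 / 4) * H)).integrableOn_Ioc)
          ((ae_restrict_iff' measurableSet_Ioc).2 (Filter.Eventually.of_forall fun τ hτ =>
            mul_nonneg (sub_nonneg.2 hτ.2) (by positivity)))]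
        congr 1
        rw [← intervalIntegral.integral_of_le hb, intervalIntegral.integral_mul_const]
        congr 1
        rw [intervalIntegral.integral_sub (by simp) (by simp)]
        simp
        ring

/-- The second difference of the objective is the integral over `s` of that of the level mass with
opposite sign. The constant arises from `l(1 - l)²/2 + (1 - l)l²/2 = l(1 - l)/2`. -/
theorem smoothF_diagonal_semiconcave (hn : 0 < n) (hk : 3 ≤ k) {ε : ℝ} (hε : 0 < ε)
    (μ h : Fin n → ℝ) {l : ℝ} (hl0 : 0 < l) (hl1 : l < 1) :
    (1 - l) * smoothF k ε (Matrix.diagonal (μ + (-l) • h)) +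
        l * smoothF k ε (Matrix.diagonal (μ + (1 - l) • h)) ≤
      smoothF k ε (Matrix.diagonal μ) +
        l * (1 - l) / 2 * (n / ε * (constC k + 3 / 4) * ∑ i, h i ^ 2) := by
  have hk0 : 0 < k := by omega
  have hr : 0 < (n : ℝ) / ε := div_pos (Nat.cast_pos.2 hn) hε
  have hC : 0 ≤ constC k := by
    have : (3 : ℝ) ≤ k := by exact_mod_cast hk
    exact div_nonneg (by linarith) (by linarith)
  set H := ∑ i, h i ^ 2 with hH
  have hH0 : 0 ≤ H := Finset.sum_nonneg fun i _ => sq_nonneg _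
  -- One starting level below all three objectives, so that the three tail formulas share their
  -- domain.
  set s₀ := min (-frobNorm (Matrix.diagonal μ)) (min
    (-frobNorm (Matrix.diagonal (μ + (-l) • h))) (-frobNorm (Matrix.diagonal (μ + (1 - l) • h))))
  obtain ⟨i0, f0⟩ := smoothF_diagonal hn hk0 hε μ (s₀ := s₀) (min_le_left _ _)
  obtain ⟨i1, f1⟩ := smoothF_diagonal hn hk0 hε (μ + (-l) • h) (s₀ := s₀)
    ((min_le_right _ _).trans (min_le_left _ _))
  obtain ⟨i2, f2⟩ := smoothF_diagonal hn hk0 hε (μ + (1 - l) • h) (s₀ := s₀)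
    ((min_le_right _ _).trans (min_le_right _ _))
  set D : ℝ → ℝ := fun s => (levelMass (n / ε) k fun i => s - μ i) -
        (1 - l) * (levelMass (n / ε) k fun i => s - (μ + (-l) • h) i) -
        l * (levelMass (n / ε) k fun i => s - (μ + (1 - l) • h) i) with hD
  have hDint : IntegrableOn D (Set.Ioi s₀) := by
    refine (((i1.const_mul (1 - l)).add (i2.const_mul l)).sub i0).congr
      (Filter.Eventually.of_forall fun s => ?_)
    simp only [hD, Pi.add_apply, Pi.sub_apply]
    ring
  have hDeq : ∫ s in Set.Ioi s₀, D s = (1 - l) * smoothF k ε (Matrix.diagonal (μ + (-l) • h)) +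
        l * smoothF k ε (Matrix.diagonal (μ + (1 - l) • h)) - smoothF k ε (Matrix.diagonal μ) := by
    have key : ∀ a₀ a₁ a₂ : ℝ → ℝ, IntegrableOn a₀ (Set.Ioi s₀) → IntegrableOn a₁ (Set.Ioi s₀) →
        IntegrableOn a₂ (Set.Ioi s₀) → ∫ s in Set.Ioi s₀, ((1 - l) * a₁ s + l * a₂ s - a₀ s) =
          (1 - l) * (∫ s in Set.Ioi s₀, a₁ s) + l * (∫ s in Set.Ioi s₀, a₂ s) -
            ∫ s in Set.Ioi s₀, a₀ s := by
      intro a₀ a₁ a₂ j0 j1 j2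
      rw [← integral_const_mul, ← integral_const_mul,
        ← integral_add (j1.const_mul _) (j2.const_mul _)]
      exact integral_sub ((j1.const_mul _).add (j2.const_mul _)) j0
    have e2 := key _ _ _ i0 i1 i2
    rw [f0, f1, f2]
    have e3 : ∫ s in Set.Ioi s₀, D s = _ := (integral_congr_ae
      (Filter.Eventually.of_forall fun s => by simp only [hD]; ring)).trans e2
    rw [e3]
    ring
  have hbound : ENNReal.ofReal (∫ s in Set.Ioi s₀, D s) ≤
      ENNReal.ofReal (l * (1 - l) / 2 * (n / ε * (constC k + 3 / 4) * H)) := by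
    have m1 : Measurable fun τ : ℝ => μ + τ • h := by fun_prop
    have m2 : Measurable fun τ : ℝ => μ + (-τ) • h := by fun_prop
    have w1 := lintegral_weighted_curvBound_le hn hr hk m1 hH0 (b := 1 - l) (by linarith)
    have w2 := lintegral_weighted_curvBound_le hn hr hk m2 hH0 (b := l) hl0.le
    have hmeas1 : Measurable fun s : ℝ => ∫⁻ τ in Set.Ioc 0 (1 - l), ENNReal.ofReal ((1 - l - τ) *
        ((curvBound (n / ε) k fun i => s - (μ + τ • h) i) * H)) := by
      have : Measurable fun p : ℝ × ℝ => curvBound (n / ε) k fun i => p.1 - (μ + p.2 • h) i :=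
        (measurable_curvBound hr k).comp (by fun_prop)
      exact Measurable.lintegral_prod_right' (f := fun p : ℝ × ℝ => ENNReal.ofReal ((1 - l - p.2) *
        ((curvBound (n / ε) k fun i => p.1 - (μ + p.2 • h) i) * H))) (by fun_prop)
    calc ENNReal.ofReal (∫ s in Set.Ioi s₀, D s)
        ≤ ENNReal.ofReal (∫ s in Set.Ioi s₀, max (D s) 0) :=
          ENNReal.ofReal_le_ofReal (integral_mono hDint hDint.pos_part fun s => le_max_left _ _)
      _ = ∫⁻ s in Set.Ioi s₀, ENNReal.ofReal (D s) := by
          rw [ofReal_integral_eq_lintegral_ofReal hDint.pos_part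
            (Filter.Eventually.of_forall fun s => le_max_right _ _)]
          refine lintegral_congr fun s => ?_
          rcases le_total (D s) 0 with h0 | h0
          · rw [max_eq_right h0, ENNReal.ofReal_of_nonpos h0, ENNReal.ofReal_zero]
          · rw [max_eq_left h0]
      _ ≤ ∫⁻ s : ℝ, ENNReal.ofReal (D s) := setLIntegral_le_lintegral _ _
      _ ≤ _ := lintegral_mono fun s => levelMass_second_difference hr hk0 μ h s hl0 hl1
      _ ≤ ENNReal.ofReal l * ENNReal.ofReal
            ((1 - l) ^ 2 / 2 * (n / ε * (constC k + 3 / 4) * H)) +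
          ENNReal.ofReal (1 - l) * ENNReal.ofReal
            (l ^ 2 / 2 * (n / ε * (constC k + 3 / 4) * H)) := by
          rw [lintegral_add_left (hmeas1.const_mul _), lintegral_const_mul' _ _ ENNReal.ofReal_ne_top,
            lintegral_const_mul' _ _ ENNReal.ofReal_ne_top]
          exact add_le_add (mul_le_mul_right w1 _) (mul_le_mul_right w2 _)
      _ = _ := by
          have : 0 ≤ 1 - l := by linarith
          rw [← ENNReal.ofReal_mul hl0.le, ← ENNReal.ofReal_mul this,
            ← ENNReal.ofReal_add (by positivity) (by positivity)]
          congr 1; ring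
  have : 0 ≤ 1 - l := by linarith
  have := (ENNReal.ofReal_le_ofReal_iff (by positivity)).1 hbound
  rw [hDeq] at this
  linarith

end StochSmooth

/-! ### From diagonal matrices to all symmetric matrices. -/

namespace StochSmooth

open Matrix

variable {n k : ℕ}

/-! ### Rotation invariance and Davis' lifting from diagonal matrices -/

/-- An orthogonal matrix is a linear isometry of Euclidean space; the invariance of `stdGaussian` is
transported back to the product measure. -/
theorem measurePreserving_orthogonal_mulVec {U : Matrix (Fin n) (Fin n) ℝ} (hU : Uᵀ * U = 1) :
    MeasurePreserving (fun x : Fin n → ℝ => U *ᵥ x) (gaussianVec n) (gaussianVec n) := by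
  have hm : Measurable fun x : Fin n → ℝ => U *ᵥ x := by
    exact (Continuous.matrix_mulVec continuous_const continuous_id).measurable
  refine ⟨hm, ?_⟩
  let f : EuclideanSpace ℝ (Fin n) →ₗᵢ[ℝ] EuclideanSpace ℝ (Fin n) :=
    { toLinearMap := Matrix.toEuclideanLin U
      norm_map' := fun x => by
        have : ‖Matrix.toEuclideanLin U x‖ ^ 2 = ‖x‖ ^ 2 := by
          rw [EuclideanSpace.real_norm_sq_eq, EuclideanSpace.real_norm_sq_eq]
          have := dotProduct_orthogonal_mulVec hU x.ofLp x.ofLp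
          simpa [dotProduct, ← pow_two] using this
        exact (sq_eq_sq₀ (norm_nonneg _) (norm_nonneg _)).1 this }
  let e := f.toLinearIsometryEquiv rfl
  have he := stdGaussian_map e
  rw [← map_pi_eq_stdGaussian] at he
  have h2 := congrArg (fun m => m.map (WithLp.ofLp : EuclideanSpace ℝ (Fin n) → Fin n → ℝ)) he
  simp only at h2
  have ho : Measurable (WithLp.ofLp : EuclideanSpace ℝ (Fin n) → Fin n → ℝ) := by fun_prop
  have ht : Measurable (WithLp.toLp 2 : (Fin n → ℝ) → EuclideanSpace ℝ (Fin n)) := by fun_prop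
  have hem : Measurable e := e.continuous.measurable
  rw [Measure.map_map ho hem, Measure.map_map (ho.comp hem) ht, Measure.map_map ho ht] at h2
  have h3 : (WithLp.ofLp : EuclideanSpace ℝ (Fin n) → Fin n → ℝ) ∘ WithLp.toLp 2 = id := rfl
  rw [h3, Measure.map_id] at h2
  exact h2

theorem smoothF_conj (hn : 0 < n) (hk : 0 < k) {ε : ℝ} {X U : Matrix (Fin n) (Fin n) ℝ}
    (hX : X.IsSymm) (h1 : U * Uᵀ = 1) (h2 : Uᵀ * U = 1) :
    smoothF k ε (U * X * Uᵀ) = smoothF k ε X := by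
  have hp : MeasurePreserving (fun (z : Fin k → Fin n → ℝ) i => U *ᵥ z i)
      (gaussianSample n k) (gaussianSample n k) :=
    measurePreserving_pi _ _ fun _ => measurePreserving_orthogonal_mulVec h2
  unfold smoothF
  rw [← hp.map_eq, integral_map hp.measurable.aemeasurable
    (measurable_sampleF hn hk (conj_isSymm hX U)).aestronglyMeasurable]
  simp only [sampleF_conj hn hk hX h1 h2]
  rw [hp.map_eq]

/-- The semiconcavity constant of the smoothed objective. -/
noncomputable def semiconcavityConst (n k : ℕ) (ε : ℝ) : ℝ := n / ε * (constC k + 3 / 4)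

/-- The diagonal restriction of the smoothed objective, made concave by a quadratic term. -/
noncomputable def diagProfile (k : ℕ) (ε : ℝ) (y : Fin n → ℝ) : ℝ :=
  smoothF k ε (diagonal y) - semiconcavityConst n k ε / 2 * ∑ i, y i ^ 2

/-- The convexity gap of the quadratic term equals exactly the error permitted by
`smoothF_diagonal_semiconcave`. -/
theorem concaveOn_diagProfile (hn : 0 < n) (hk : 3 ≤ k) {ε : ℝ} (hε : 0 < ε) :
    ConcaveOn ℝ Set.univ (diagProfile k ε : (Fin n → ℝ) → ℝ) := by
  rw [concaveOn_iff_forall_pos]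
  refine ⟨convex_univ, fun x _ y _ a b ha hb hab => ?_⟩
  obtain rfl : a = 1 - b := by linarith
  have h := smoothF_diagonal_semiconcave hn hk hε ((1 - b) • x + b • y) (y - x) hb (by linarith)
  have e1 : (1 - b) • x + b • y + -b • (y - x) = x := by
    ext i; simp only [Pi.add_apply, Pi.smul_apply, Pi.sub_apply, smul_eq_mul]; ring
  have e2 : (1 - b) • x + b • y + (1 - b) • (y - x) = y := by
    ext i; simp only [Pi.add_apply, Pi.smul_apply, Pi.sub_apply, smul_eq_mul]; ring
  rw [e1, e2] at h
  have e3 : ∑ i, ((1 - b) • x + b • y) i ^ 2 =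
      (1 - b) * ∑ i, x i ^ 2 + b * ∑ i, y i ^ 2 - b * (1 - b) * ∑ i, (y - x) i ^ 2 := by
    simp only [Finset.mul_sum]
    rw [← Finset.sum_add_distrib, ← Finset.sum_sub_distrib]
    refine Finset.sum_congr rfl fun i _ => ?_
    simp only [Pi.add_apply, Pi.smul_apply, Pi.sub_apply, smul_eq_mul]; ring
  simp only [diagProfile, smul_eq_mul]
  rw [e3]
  simp only [semiconcavityConst]
  linarith

theorem diagonal_comp_perm (σ : Equiv.Perm (Fin n)) (y : Fin n → ℝ) :
    diagonal (y ∘ σ) = σ.permMatrix ℝ * diagonal y * (σ.permMatrix ℝ)ᵀ := by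
  ext i j
  simp [Equiv.Perm.permMatrix, PEquiv.toMatrix_apply, Matrix.mul_apply, diagonal_apply,
    Equiv.toPEquiv_apply]
  rw [Finset.sum_eq_single (σ i) (fun b _ hb => by simp [hb.symm]) (by simp)]
  simp

theorem permMatrix_mul_transpose (σ : Equiv.Perm (Fin n)) :
    σ.permMatrix ℝ * (σ.permMatrix ℝ)ᵀ = 1 := by
  rw [transpose_permMatrix, ← permMatrix_mul]; simp

theorem diagProfile_comp_perm (hn : 0 < n) (hk : 0 < k) (ε : ℝ) (σ : Equiv.Perm (Fin n))
    (y : Fin n → ℝ) : diagProfile k ε (y ∘ σ) = diagProfile k ε y := by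
  unfold diagProfile
  rw [diagonal_comp_perm, smoothF_conj hn hk (isSymm_diagonal y) (permMatrix_mul_transpose σ)
    (mul_eq_one_comm.1 (permMatrix_mul_transpose σ))]
  congr 2
  exact Equiv.sum_comp σ (fun i => y i ^ 2)

/-- By Birkhoff's theorem `S y` is an average of permutations of `y`. The profile is concave and
symmetric, so averaging can only increase it. -/
theorem diagProfile_le_mulVec (hn : 0 < n) (hk : 3 ≤ k) {ε : ℝ} (hε : 0 < ε)
    {S : Matrix (Fin n) (Fin n) ℝ} (hS : S ∈ doublyStochastic ℝ (Fin n)) (y : Fin n → ℝ) :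
    diagProfile k ε y ≤ diagProfile k ε (S *ᵥ y) := by
  obtain ⟨w, hw0, hw1, rfl⟩ := exists_eq_sum_perm_of_mem_doublyStochastic hS
  have h := (concaveOn_diagProfile hn hk hε).le_map_sum (t := Finset.univ) (w := w)
    (p := fun σ : Equiv.Perm (Fin n) => y ∘ σ) (fun σ _ => hw0 σ) hw1 fun _ _ => Set.mem_univ _
  simp only [diagProfile_comp_perm hn (by omega : 0 < k), smul_eq_mul] at h
  rw [← Finset.sum_mul, hw1, one_mul] at h
  refine h.trans (le_of_eq ?_)
  congr 1
  rw [sum_mulVec]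
  refine Finset.sum_congr rfl fun σ _ => ?_
  rw [smul_mulVec, permMatrix_mulVec]

theorem frobInner_conj {U : Matrix (Fin n) (Fin n) ℝ} (h2 : Uᵀ * U = 1)
    (A B : Matrix (Fin n) (Fin n) ℝ) :
    frobInner (U * A * Uᵀ) (U * B * Uᵀ) = frobInner A B := by
  unfold frobInner
  have : (U * A * Uᵀ)ᵀ * (U * B * Uᵀ) = U * (Aᵀ * B * Uᵀ) := by
    simp only [transpose_mul, transpose_transpose]
    calc U * (Aᵀ * Uᵀ) * (U * B * Uᵀ) = U * (Aᵀ * (Uᵀ * U) * B * Uᵀ) := by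
          simp only [Matrix.mul_assoc]
      _ = _ := by rw [h2, Matrix.mul_one]
  rw [this, trace_mul_comm, Matrix.mul_assoc, h2, Matrix.mul_one]

theorem frobInner_diagonal (y : Fin n → ℝ) :
    frobInner (diagonal y) (diagonal y) = ∑ i, y i ^ 2 := by
  simp [frobInner, trace_diagonal, pow_two]

theorem orthogonal_sq_mem_doublyStochastic {V : Matrix (Fin n) (Fin n) ℝ} (h1 : V * Vᵀ = 1)
    (h2 : Vᵀ * V = 1) : (Matrix.of fun i j => V i j ^ 2) ∈ doublyStochastic ℝ (Fin n) := by
  rw [mem_doublyStochastic_iff_sum]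
  refine ⟨fun i j => sq_nonneg _, fun i => ?_, fun j => ?_⟩
  · have := congrFun (congrFun h1 i) i
    simpa [mul_apply, pow_two] using this
  · have := congrFun (congrFun h2 j) j
    simpa [mul_apply, pow_two] using this

/-- Davis' comparison: passing to the diagonal increases the concave profile. -/
theorem smoothF_sub_le_diagProfile (hn : 0 < n) (hk : 3 ≤ k) {ε : ℝ} (hε : 0 < ε)
    {Y : Matrix (Fin n) (Fin n) ℝ} (hY : Y.IsSymm) :
    smoothF k ε Y - semiconcavityConst n k ε / 2 * frobInner Y Y ≤
      diagProfile k ε fun i => Y i i := by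
  obtain ⟨V, y, h1, h2, rfl, -⟩ := exists_orthogonal_diagonalization hY
  rw [smoothF_conj hn (by omega) (isSymm_diagonal y) h1 h2, frobInner_conj h2,
    frobInner_diagonal]
  refine (diagProfile_le_mulVec hn hk hε (orthogonal_sq_mem_doublyStochastic h1 h2) y).trans
    (le_of_eq ?_)
  congr 1
  ext i
  rw [mul_apply]
  simp only [mulVec, dotProduct, mul_diagonal, of_apply, transpose_apply]
  exact Finset.sum_congr rfl fun j _ => by ring

/-- After a rotation `X` is diagonal. Davis' comparison replaces each endpoint by its diagonal part
at the cost of the off-diagonal energy of the direction, and the diagonal estimate covers the rest;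
both costs carry the same factor `l(1 - l)/2`. -/
theorem smoothF_semiconcave (hn : 0 < n) (hk : 3 ≤ k) {ε : ℝ} (hε : 0 < ε)
    {X H : Matrix (Fin n) (Fin n) ℝ} (hX : X.IsSymm) (hH : H.IsSymm) {l : ℝ} (hl0 : 0 < l)
    (hl1 : l < 1) :
    (1 - l) * smoothF k ε (X + (-l) • H) + l * smoothF k ε (X + (1 - l) • H) ≤
      smoothF k ε X + l * (1 - l) / 2 * (semiconcavityConst n k ε * frobInner H H) := by
  obtain ⟨U, μ, h1, h2, rfl, -⟩ := exists_orthogonal_diagonalization hX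
  have hk0 : 0 < k := by omega
  have ht1 : Uᵀ * (Uᵀ)ᵀ = 1 := by rw [transpose_transpose, h2]
  have ht2 : (Uᵀ)ᵀ * Uᵀ = 1 := by rw [transpose_transpose, h1]
  set K : Matrix (Fin n) (Fin n) ℝ := Uᵀ * H * U with hK
  have hHK : H = U * K * Uᵀ := by
    calc H = (U * Uᵀ) * H * (U * Uᵀ) := by rw [h1, Matrix.one_mul, Matrix.mul_one]
      _ = _ := by simp only [hK, Matrix.mul_assoc]
  have hKs : K.IsSymm := by have := conj_isSymm hH Uᵀ; rwa [transpose_transpose] at this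
  have hconj : ∀ c : ℝ, U * diagonal μ * Uᵀ + c • H = U * (diagonal μ + c • K) * Uᵀ := by
    intro c
    rw [hHK, Matrix.mul_add, Matrix.add_mul, Matrix.mul_smul, Matrix.smul_mul]
  have hs : ∀ c : ℝ, (diagonal μ + c • K).IsSymm := fun c =>
    (isSymm_diagonal μ).add (hKs.smul c)
  rw [hconj, hconj, smoothF_conj hn hk0 (hs _) h1 h2, smoothF_conj hn hk0 (hs _) h1 h2,
    smoothF_conj hn hk0 (isSymm_diagonal μ) h1 h2, hHK, frobInner_conj h2]
  -- The two quadratic terms differ only by the off-diagonal entries, which come solely from `c •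
  -- K`.
  have key : ∀ c : ℝ, smoothF k ε (diagonal μ + c • K) ≤
      smoothF k ε (diagonal (μ + c • fun i => K i i)) + semiconcavityConst n k ε / 2 *
        (c ^ 2 * (frobInner K K - ∑ i, K i i ^ 2)) := by
    intro c
    have h := smoothF_sub_le_diagProfile hn hk hε (hs c)
    have e1 : (fun i => (diagonal μ + c • K) i i) = μ + c • fun i => K i i := by
      ext i; simp
    rw [e1, diagProfile] at h
    have e2 : frobInner (diagonal μ + c • K) (diagonal μ + c • K) =
        ∑ i, (μ + c • fun i => K i i) i ^ 2 + c ^ 2 * (frobInner K K - ∑ i, K i i ^ 2) := by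
      have e3 : frobInner (diagonal μ) K = ∑ i, μ i * K i i := by
        simp [frobInner, trace, diagonal_mul]
      rw [frobInner_add_left, frobInner_add_right, frobInner_add_right, frobInner_smul_left,
        frobInner_smul_left, frobInner_smul_right, frobInner_smul_right, frobInner_comm K,
        e3, frobInner_diagonal]
      simp only [Pi.add_apply, Pi.smul_apply, smul_eq_mul, add_sq, mul_pow,
        Finset.sum_add_distrib, ← Finset.mul_sum]
      have : ∑ i, 2 * μ i * (c * K i i) = 2 * c * ∑ i, μ i * K i i := by
        rw [Finset.mul_sum]; exact Finset.sum_congr rfl fun i _ => by ring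
      rw [this]; ring
    rw [e2] at h
    linarith
  have hd := smoothF_diagonal_semiconcave hn hk hε μ (fun i => K i i) hl0 hl1
  have ha := mul_le_mul_of_nonneg_left (key (-l)) (by linarith : 0 ≤ 1 - l)
  have hb := mul_le_mul_of_nonneg_left (key (1 - l)) hl0.le
  have hd' : n / ε * (constC k + 3 / 4) = semiconcavityConst n k ε := rfl
  rw [hd'] at hd
  linear_combination ha + hb + hd

end StochSmooth

/-! ### Descent inequality, prox steps and one accelerated iteration. -/

namespace StochSmooth

open Matrix

variable {n k : ℕ}

/-! ### The averaged oracle and the descent inequality -/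

/-- The expectation of the stochastic gradient. -/
noncomputable def meanOracle (Φ : Matrix (Fin n) (Fin n) ℝ → (Fin k → Fin n → ℝ) → (Fin n → ℝ))
    (X : Matrix (Fin n) (Fin n) ℝ) : Matrix (Fin n) (Fin n) ℝ :=
  Matrix.of fun i j => ∫ z, Φ X z i * Φ X z j ∂gaussianSample n k

section

variable {ε : ℝ} {Φ : Matrix (Fin n) (Fin n) ℝ → (Fin k → Fin n → ℝ) → (Fin n → ℝ)}

theorem IsLeadingEigenvectorRule.measurable_apply (hΦ : IsLeadingEigenvectorRule ε Φ)
    (X : Matrix (Fin n) (Fin n) ℝ) : Measurable (Φ X) :=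
  hΦ.measurable.comp (measurable_const (a := (fun i j => X i j)).prodMk measurable_id)

theorem IsLeadingEigenvectorRule.abs_apply_le (hΦ : IsLeadingEigenvectorRule ε Φ)
    {X : Matrix (Fin n) (Fin n) ℝ} (hX : X.IsSymm) (z : Fin k → Fin n → ℝ) (i : Fin n) :
    |Φ X z i| ≤ 1 := by
  rw [← sq_le_one_iff_abs_le_one, ← hΦ.unit X hX z, dotProduct, pow_two]
  exact Finset.single_le_sum (f := fun i => Φ X z i * Φ X z i)
    (fun j _ => mul_self_nonneg _) (Finset.mem_univ i)

theorem integrable_mul_apply (hΦ : IsLeadingEigenvectorRule ε Φ)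
    {X : Matrix (Fin n) (Fin n) ℝ} (hX : X.IsSymm) (i j : Fin n) :
    Integrable (fun z => Φ X z i * Φ X z j) (gaussianSample n k) := by
  have hm := hΦ.measurable_apply X
  refine Integrable.of_bound (C := 1) (((measurable_pi_apply i).comp hm).mul
    ((measurable_pi_apply j).comp hm)).aestronglyMeasurable (.of_forall fun z => ?_)
  rw [Real.norm_eq_abs, abs_mul]
  exact mul_le_one₀ (hΦ.abs_apply_le hX z i) (abs_nonneg _) (hΦ.abs_apply_le hX z j)

theorem integrable_frobInner_vecMulVec (hΦ : IsLeadingEigenvectorRule ε Φ)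
    {X : Matrix (Fin n) (Fin n) ℝ} (hX : X.IsSymm) (H : Matrix (Fin n) (Fin n) ℝ) :
    Integrable (fun z => frobInner (vecMulVec (Φ X z) (Φ X z)) H) (gaussianSample n k) := by
  simp only [frobInner_eq_sum, vecMulVec_apply]
  exact integrable_finsetSum _ fun i _ => integrable_finsetSum _ fun j _ =>
    (integrable_mul_apply hΦ hX _ _).mul_const _

theorem frobInner_meanOracle (hΦ : IsLeadingEigenvectorRule ε Φ)
    {X : Matrix (Fin n) (Fin n) ℝ} (hX : X.IsSymm) (H : Matrix (Fin n) (Fin n) ℝ) :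
    frobInner (meanOracle Φ X) H =
      ∫ z, frobInner (vecMulVec (Φ X z) (Φ X z)) H ∂gaussianSample n k := by
  simp only [frobInner_eq_sum, vecMulVec_apply]
  have hI : ∀ i j, Integrable (fun z => Φ X z i * Φ X z j * H i j) (gaussianSample n k) :=
    fun i j => (integrable_mul_apply hΦ hX i j).mul_const _
  rw [integral_finsetSum _ fun i _ => integrable_finsetSum _ fun j _ => hI i j]
  refine Finset.sum_congr rfl fun i _ => ?_
  rw [integral_finsetSum _ fun j _ => hI i j]
  refine Finset.sum_congr rfl fun j _ => ?_
  rw [integral_mul_const]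
  rfl

theorem smoothF_subgradient (hn : 0 < n) (hk : 0 < k) (hε : 0 < ε)
    (hΦ : IsLeadingEigenvectorRule ε Φ) {X Y : Matrix (Fin n) (Fin n) ℝ} (hX : X.IsSymm)
    (hY : Y.IsSymm) :
    smoothF k ε X + frobInner (meanOracle Φ X) (Y - X) ≤ smoothF k ε Y := by
  rw [frobInner_meanOracle hΦ hX, smoothF, smoothF, ← integral_add
    (integrable_sampleF hn hk hε hX) (integrable_frobInner_vecMulVec hΦ hX _)]
  exact integral_mono ((integrable_sampleF hn hk hε hX).add
    (integrable_frobInner_vecMulVec hΦ hX _)) (integrable_sampleF hn hk hε hY)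
    fun z => sampleF_subgradient hn hk hΦ hX hY z

theorem smoothF_le_add_frobNorm (hn : 0 < n) (hk : 0 < k) (hε : 0 < ε)
    {X Y : Matrix (Fin n) (Fin n) ℝ} (hX : X.IsSymm) (hY : Y.IsSymm) :
    smoothF k ε Y ≤ smoothF k ε X + frobNorm (Y - X) := by
  have h : smoothF k ε X + frobNorm (Y - X) =
      ∫ z, (sampleF ε X z + frobNorm (Y - X)) ∂gaussianSample n k := by
    rw [integral_add (integrable_sampleF hn hk hε hX) (integrable_const _)]
    simp [smoothF]
  rw [h]
  exact integral_mono (integrable_sampleF hn hk hε hY)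
    ((integrable_sampleF hn hk hε hX).add (integrable_const _))
    fun z => sampleF_le_add hn hk hX hY z

theorem continuousOn_smoothF (hn : 0 < n) (hk : 0 < k) (hε : 0 < ε) :
    ContinuousOn (smoothF k ε) {X : Matrix (Fin n) (Fin n) ℝ | X.IsSymm} := by
  intro X hX
  have hc : Filter.Tendsto (fun Y : Matrix (Fin n) (Fin n) ℝ => frobNorm (Y - X))
      (nhdsWithin X {X | X.IsSymm}) (nhds 0) := by
    have : Continuous fun Y : Matrix (Fin n) (Fin n) ℝ => frobNorm (Y - X) :=
      (continuous_frobInner (continuous_id.sub continuous_const)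
        (continuous_id.sub continuous_const)).sqrt
    have h0 := this.tendsto X
    simp only [sub_self, frobNorm, frobInner, mul_zero, trace_zero, Real.sqrt_zero] at h0
    exact h0.mono_left nhdsWithin_le_nhds
  rw [ContinuousWithinAt, tendsto_iff_dist_tendsto_zero]
  refine squeeze_zero' (.of_forall fun _ => dist_nonneg) ?_ hc
  filter_upwards [self_mem_nhdsWithin] with Y hY
  rw [Real.dist_eq, abs_le]
  have h1 := smoothF_le_add_frobNorm hn hk hε hX hY
  have h2 := smoothF_le_add_frobNorm hn hk hε hY hX
  rw [frobNorm_sub_comm] at h2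
  constructor <;> linarith

/-- The descent inequality for the smoothed objective. -/
theorem smoothF_descent (hn : 0 < n) (hk : 3 ≤ k) (hε : 0 < ε)
    (hΦ : IsLeadingEigenvectorRule ε Φ) {X Y : Matrix (Fin n) (Fin n) ℝ} (hX : X.IsSymm)
    (hY : Y.IsSymm) :
    smoothF k ε Y ≤ smoothF k ε X + frobInner (meanOracle Φ X) (Y - X) +
      semiconcavityConst n k ε / 2 * frobInner (Y - X) (Y - X) := by
  obtain ⟨H, rfl⟩ : ∃ H, Y = X + H := ⟨Y - X, by abel⟩
  have hH : H.IsSymm := by simpa using hY.sub hX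
  rw [add_sub_cancel_left]
  -- Semiconcavity at the points `X - τH` and `X + H`, whose weighted mean is `X`. The subgradient
  -- inequality bounds the value at `X - τH` from below; dividing by `τ` and letting `τ → 0` gives
  -- the descent inequality.
  have hb : ∀ τ : ℝ, 0 < τ → smoothF k ε (X + H) ≤ smoothF k ε X + frobInner (meanOracle Φ X) H +
      (1 + τ) * (semiconcavityConst n k ε / 2 * frobInner H H) := by
    intro τ hτ
    have hτ1 : 0 < 1 + τ := by linarith
    have h := smoothF_semiconcave hn hk hε hX (hH.smul (1 + τ)) (l := τ / (1 + τ)) (by positivity)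
      (by rw [div_lt_one hτ1]; linarith)
    have e1 : 1 - τ / (1 + τ) = 1 / (1 + τ) := by field_simp; ring
    rw [e1, smul_smul, smul_smul, frobInner_smul_left, frobInner_smul_right,
      show -(τ / (1 + τ)) * (1 + τ) = -τ by field_simp,
      show 1 / (1 + τ) * (1 + τ) = 1 by field_simp, one_smul] at h
    have h2 := smoothF_subgradient hn (by omega) hε hΦ hX (hX.add (hH.smul (-τ)))
    rw [add_sub_cancel_left, frobInner_smul_right] at h2
    have h3 := mul_le_mul_of_nonneg_left h hτ1.le
    have e3 : (1 + τ) * (1 / (1 + τ) * smoothF k ε (X + -τ • H) +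
        τ / (1 + τ) * smoothF k ε (X + H)) = smoothF k ε (X + -τ • H) +
        τ * smoothF k ε (X + H) := by field_simp
    have e4 : (1 + τ) * (smoothF k ε X + τ / (1 + τ) * (1 / (1 + τ)) / 2 *
        (semiconcavityConst n k ε * ((1 + τ) * ((1 + τ) * frobInner H H)))) =
        (1 + τ) * smoothF k ε X +
        τ * ((1 + τ) * (semiconcavityConst n k ε / 2 * frobInner H H)) := by field_simp
    rw [e3, e4] at h3
    refine le_of_mul_le_mul_left ?_ hτ
    linarith
  have hlim : Filter.Tendsto (fun τ : ℝ => smoothF k ε X + frobInner (meanOracle Φ X) H +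
      (1 + τ) * (semiconcavityConst n k ε / 2 * frobInner H H)) (nhdsWithin 0 (Set.Ioi 0))
      (nhds (smoothF k ε X + frobInner (meanOracle Φ X) H +
      (1 + 0) * (semiconcavityConst n k ε / 2 * frobInner H H))) :=
    (Continuous.tendsto (by fun_prop) 0).mono_left nhdsWithin_le_nhds
  rw [add_zero, one_mul] at hlim
  refine ge_of_tendsto hlim ?_
  filter_upwards [self_mem_nhdsWithin] with τ hτ using hb τ hτ

end

/-! ### Euclidean prox steps -/

theorem proxV_eq (X Y : Matrix (Fin n) (Fin n) ℝ) : proxV X Y = frobInner (Y - X) (Y - X) / 2 := by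
  simp only [proxV, dgf, frobInner_sub_left, frobInner_sub_right]
  rw [frobInner_comm Y X]; ring

/-- First-order optimality: compare `Z` with the feasible points `Z + t(W - Z)`, divide by `t` and
let `t → 0`. -/
theorem IsProxStep.variational {Q : Set (Matrix (Fin n) (Fin n) ℝ)} (hQ : Convex ℝ Q)
    {X Y Z W : Matrix (Fin n) (Fin n) ℝ} (h : IsProxStep Q X Y Z) (hW : W ∈ Q) :
    0 ≤ frobInner (Y + Z - X) (W - Z) := by
  have hb : ∀ t : ℝ, 0 < t → t ≤ 1 →
      0 ≤ frobInner (Y + Z - X) (W - Z) + t * (frobInner (W - Z) (W - Z) / 2) := by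
    intro t ht ht1
    have hm : Z + t • (W - Z) ∈ Q := hQ.add_smul_sub_mem h.1 hW ⟨ht.le, ht1⟩
    have h1 := isMinOn_iff.1 h.2 _ hm
    rw [proxV_eq, proxV_eq, show Z + t • (W - Z) - X = (Z - X) + t • (W - Z) by abel] at h1
    generalize W - Z = U at h1 ⊢
    rw [show Y + Z - X = Y + (Z - X) by abel]
    generalize Z - X = A at h1 ⊢
    simp only [frobInner_add_left, frobInner_add_right, frobInner_smul_left,
      frobInner_smul_right] at h1 ⊢
    rw [frobInner_comm U A] at h1
    refine nonneg_of_mul_nonneg_right (a := t) ?_ ht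
    nlinarith
  have hlim : Filter.Tendsto (fun t : ℝ => frobInner (Y + Z - X) (W - Z) +
      t * (frobInner (W - Z) (W - Z) / 2)) (nhdsWithin 0 (Set.Ioi 0))
      (nhds (frobInner (Y + Z - X) (W - Z) + 0 * (frobInner (W - Z) (W - Z) / 2))) :=
    (Continuous.tendsto (by fun_prop) 0).mono_left nhdsWithin_le_nhds
  rw [zero_mul, add_zero] at hlim
  refine ge_of_tendsto hlim ?_
  filter_upwards [Ioc_mem_nhdsGT (zero_lt_one' ℝ)] with t ht using hb t ht.1 ht.2

theorem IsProxStep.three_point {Q : Set (Matrix (Fin n) (Fin n) ℝ)} (hQ : Convex ℝ Q)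
    {X Y Z W : Matrix (Fin n) (Fin n) ℝ} (h : IsProxStep Q X Y Z) (hW : W ∈ Q) :
    frobInner Y (Z - W) ≤ proxV X W - proxV Z W - frobInner (Z - X) (Z - X) / 2 := by
  have h1 := h.variational hQ hW
  rw [proxV_eq, proxV_eq]
  simp only [frobInner_add_left, frobInner_sub_left, frobInner_sub_right] at h1 ⊢
  rw [frobInner_comm X W, frobInner_comm Z X, frobInner_comm Z W] at *
  linarith

/-- A prox step is the Euclidean projection of `X - Y`, hence nonexpansive in it. This yields
uniqueness, and later continuity and measurability of the iterates. -/
theorem IsProxStep.frobNorm_sub_le {Q : Set (Matrix (Fin n) (Fin n) ℝ)} (hQ : Convex ℝ Q)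
    {X Y Z X' Y' Z' : Matrix (Fin n) (Fin n) ℝ} (h : IsProxStep Q X Y Z)
    (h' : IsProxStep Q X' Y' Z') :
    frobNorm (Z - Z') ≤ frobNorm ((X - Y) - (X' - Y')) := by
  have h1 := h.variational hQ h'.1
  have h2 := h'.variational hQ h.1
  have h3 : frobInner (Z - Z') (Z - Z') ≤ frobInner ((X - Y) - (X' - Y')) (Z - Z') := by
    simp only [frobInner_add_left, frobInner_sub_left, frobInner_sub_right] at h1 h2 ⊢
    linarith
  rw [← frobNorm_sq] at h3
  have h4 := (le_abs_self _).trans (abs_frobInner_le ((X - Y) - (X' - Y')) (Z - Z'))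
  rcases (frobNorm_nonneg (Z - Z')).eq_or_lt with h0 | h0
  · rw [← h0]; exact frobNorm_nonneg _
  · exact le_of_mul_le_mul_right (by nlinarith) h0

theorem frobNorm_eq_zero {A : Matrix (Fin n) (Fin n) ℝ} (h : frobNorm A = 0) : A = 0 :=
  frobInner_self_eq_zero (by rw [← frobNorm_sq, h]; norm_num)

theorem IsProxStep.unique {Q : Set (Matrix (Fin n) (Fin n) ℝ)} (hQ : Convex ℝ Q)
    {X Y Z X' Y' Z' : Matrix (Fin n) (Fin n) ℝ} (h : IsProxStep Q X Y Z)
    (h' : IsProxStep Q X' Y' Z') (e : X - Y = X' - Y') : Z = Z' := by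
  have h1 := h.frobNorm_sub_le hQ h'
  have h2 : frobNorm ((X - Y) - (X' - Y')) = 0 := by
    rw [e, sub_self, frobNorm, frobInner, mul_zero, trace_zero, Real.sqrt_zero]
  exact sub_eq_zero.1 (frobNorm_eq_zero (le_antisymm (h1.trans h2.le) (frobNorm_nonneg _)))

theorem exists_isProxStep {Q : Set (Matrix (Fin n) (Fin n) ℝ)} (hQ : IsCompact Q)
    (hne : Q.Nonempty) (X Y : Matrix (Fin n) (Fin n) ℝ) : ∃ Z, IsProxStep Q X Y Z := by
  obtain ⟨Z, hZ, hmin⟩ := hQ.exists_isMinOn hne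
    (f := fun W => frobInner Y (W - X) + proxV X W) (by
      refine Continuous.continuousOn ?_
      simp only [proxV_eq]
      exact (continuous_frobInner continuous_const (continuous_id.sub continuous_const)).add
        ((continuous_frobInner (continuous_id.sub continuous_const)
          (continuous_id.sub continuous_const)).div_const _))
  exact ⟨Z, hZ, hmin⟩

/-! ### One accelerated step -/

/-- One iteration of the accelerated method for an objective with a subgradient `g`
satisfying the descent inequality with constant `M`. -/
theorem accelerated_step {Q : Set (Matrix (Fin n) (Fin n) ℝ)} (hQ : Convex ℝ Q)
    {F : Matrix (Fin n) (Fin n) ℝ → ℝ} {g : Matrix (Fin n) (Fin n) ℝ → Matrix (Fin n) (Fin n) ℝ}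
    {M : ℝ} (hsub : ∀ X ∈ Q, ∀ Y ∈ Q, F X + frobInner (g X) (Y - X) ≤ F Y)
    (hdesc : ∀ X ∈ Q, ∀ Y ∈ Q,
      F Y ≤ F X + frobInner (g X) (Y - X) + M / 2 * frobInner (Y - X) (Y - X))
    {c β : ℝ} (hc : 0 ≤ c) (hβ : 1 ≤ β) (hM : M * c ≤ 7 / 8)
    {X A X' x G : Matrix (Fin n) (Fin n) ℝ} (hX : X ∈ Q) (hA : A ∈ Q) (hx : x ∈ Q)
    (hprox : IsProxStep Q X ((β * c) • G) X') :
    c * β ^ 2 * (F (β⁻¹ • X' + (1 - β⁻¹) • A) - F x) + proxV X' x ≤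
      c * (β * (β - 1)) * (F A - F x) + proxV X x +
        (-(β * c * frobInner (G - g (β⁻¹ • X + (1 - β⁻¹) • A)) (X - x)) +
          4 * (β * c) ^ 2 * frobInner (G - g (β⁻¹ • X + (1 - β⁻¹) • A))
            (G - g (β⁻¹ • X + (1 - β⁻¹) • A))) := by
  have hβ0 : 0 < β := by linarith
  have hb0 : 0 ≤ β⁻¹ := by positivity
  have hb1 : 0 ≤ 1 - β⁻¹ := by have := inv_le_one_of_one_le₀ hβ; linarith
  have hmd : β⁻¹ • X + (1 - β⁻¹) • A ∈ Q := hQ hX hA hb0 hb1 (by ring)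
  have hag : β⁻¹ • X' + (1 - β⁻¹) • A ∈ Q := hQ hprox.1 hA hb0 hb1 (by ring)
  set m := β⁻¹ • X + (1 - β⁻¹) • A with hm
  set a := β⁻¹ • X' + (1 - β⁻¹) • A with ha
  have ham : a - m = β⁻¹ • (X' - X) := by rw [ha, hm, smul_sub]; abel
  have h1 := hdesc m hmd a hag
  have h2 := hsub m hmd A hA
  have h3 := hsub m hmd x hx
  have h4 := hprox.three_point hQ hx
  rw [ham, frobInner_smul_left, frobInner_smul_right, frobInner_smul_right] at h1
  rw [frobInner_smul_left] at h4
  obtain ⟨δ, rfl⟩ : ∃ δ, G = g m + δ := ⟨G - g m, by abel⟩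
  rw [add_sub_cancel_left]
  have e1 : frobInner (g m) (X' - X) = frobInner (g m) (X' - x) + frobInner (g m) (x - m)
      - frobInner (g m) (X - m) := by
    simp only [frobInner_sub_right]; ring
  -- As `m` is a convex combination of `X` and `A`, the subgradient term at `X` becomes one at `A`,
  -- with the factor `β - 1` that the telescoping needs.
  have e2 : X - m = -((β - 1) • (A - m)) := by
    have : β • m = X + (β - 1) • A := by
      rw [hm, smul_add, smul_smul, smul_smul, mul_inv_cancel₀ hβ0.ne', one_smul, mul_sub,
        mul_inv_cancel₀ hβ0.ne', mul_one]
    rw [eq_sub_of_add_eq this.symm, smul_sub, sub_smul β 1 m, one_smul]; abel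
  have e3 : frobInner (g m) (X - m) = -((β - 1) * frobInner (g m) (A - m)) := by
    rw [e2, ← neg_one_smul ℝ, frobInner_smul_right, frobInner_smul_right]; ring
  have e4 : frobInner δ (X' - x) = frobInner δ (X' - X) + frobInner δ (X - x) := by
    simp only [frobInner_sub_right]; ring
  rw [frobInner_add_left, e4] at h4
  have h5 := neg_le_of_abs_le (abs_frobInner_le δ (X' - X))
  rw [← frobNorm_sq] at h1 h4
  rw [← frobNorm_sq δ]
  have hd0 := frobNorm_nonneg (X' - X)
  set d := frobNorm (X' - X)
  set r := frobNorm δ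
  have h6 := mul_le_mul_of_nonneg_left h1 (by positivity : 0 ≤ c * β ^ 2)
  have e6 : c * β ^ 2 * (F m + β⁻¹ * frobInner (g m) (X' - X) + M / 2 * (β⁻¹ * (β⁻¹ * d ^ 2))) =
      c * β ^ 2 * F m + c * β * frobInner (g m) (X' - X) + M * c / 2 * d ^ 2 := by
    field_simp
  rw [e6, e1, e3] at h6
  have h7 := mul_le_mul_of_nonneg_left h2
    (mul_nonneg hc (mul_nonneg hβ0.le (by linarith : 0 ≤ β - 1)))
  have h8 := mul_le_mul_of_nonneg_left h3 (mul_nonneg hc hβ0.le)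
  have h9 := mul_le_mul_of_nonneg_left h5 (mul_nonneg hβ0.le hc)
  have h10 := mul_le_mul_of_nonneg_right hM (by positivity : 0 ≤ d ^ 2)
  -- Since `M c ≤ 7/8`, the prox term leaves `d²/16`, which absorbs the noise term `βc·r·d` at the
  -- price `4(βc r)²`.
  nlinarith [sq_nonneg (d / 4 - 2 * (β * c * r))]

end StochSmooth

/-! ### Telescoping, step sizes and the deterministic form of the rate. -/

namespace StochSmooth

open Matrix

variable {n k : ℕ}

/-! ### Constants and telescoping -/

theorem one_le_constC (hk : 3 ≤ k) : 1 ≤ constC k := by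
  have : (3 : ℝ) ≤ k := by exact_mod_cast hk
  rw [constC, le_div_iff₀ (by linarith)]; linarith

theorem constC_le_three (hk : 3 ≤ k) : constC k ≤ 3 := by
  have : (3 : ℝ) ≤ k := by exact_mod_cast hk
  rw [constC, div_le_iff₀ (by linarith)]; linarith

/-- The common factor of the step sizes `γ_t`. -/
noncomputable def stepScale (L σ D : ℝ) (N : ℕ) : ℝ :=
  min (1 / (2 * L)) (Real.sqrt 6 * D / (((N : ℝ) + 2) ^ (3 / 2 : ℝ) * σ))

theorem stepGamma_eq (L σ D : ℝ) (N t : ℕ) :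
    stepGamma L σ D N t = stepBeta t * stepScale L σ D N := rfl

theorem stepScale_nonneg {L σ D : ℝ} (hL : 0 ≤ L) (hσ : 0 ≤ σ) (hD : 0 ≤ D) (N : ℕ) :
    0 ≤ stepScale L σ D N := le_min (by positivity) (by positivity)

theorem one_le_stepBeta {t : ℕ} (ht : 1 ≤ t) : 1 ≤ stepBeta t := by
  have : (1 : ℝ) ≤ t := by exact_mod_cast ht
  unfold stepBeta; linarith

/-- The product is at most `1/2 + 3/(8 C_k)`, and `C_k ≥ 1`: this is where the halved step size pays
for the extra `3/4`. -/
theorem semiconcavityConst_mul_stepScale_le (hn : 0 < n) (hk : 3 ≤ k) {ε : ℝ} (hε : 0 < ε)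
    (σ D : ℝ) (N : ℕ) :
    semiconcavityConst n k ε * stepScale (constC k * n / ε) σ D N ≤ 7 / 8 := by
  have hC := one_le_constC hk
  have hn' : (0 : ℝ) < n := by exact_mod_cast hn
  have h1 : stepScale (constC k * n / ε) σ D N ≤ 1 / (2 * (constC k * n / ε)) := min_le_left _ _
  have h2 : 0 ≤ semiconcavityConst n k ε := by unfold semiconcavityConst; positivity
  refine (mul_le_mul_of_nonneg_left h1 h2).trans ?_
  have : semiconcavityConst n k ε * (1 / (2 * (constC k * n / ε))) =
      (constC k + 3 / 4) / (2 * constC k) := by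
    unfold semiconcavityConst; field_simp
  rw [this, div_le_div_iff₀ (by linarith) (by norm_num)]
  linarith

/-- Telescoping needs `β_{t+1}(β_{t+1} - 1) ≤ β_t²`, that is `t(t + 2) ≤ (t + 1)²`, together with
nonnegative gaps. -/
theorem telescoped_bound {c : ℝ} (hc : 0 ≤ c) {A V : ℕ → ℝ} (hV : ∀ s, 0 ≤ V s) {N : ℕ}
    (hN : 0 < N) (hA : ∀ s ≤ N, 0 ≤ A s) {e : Fin N → ℝ}
    (h : ∀ s : Fin N, c * stepBeta (s + 1) ^ 2 * A (s + 1) + V (s + 1) ≤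
      c * (stepBeta (s + 1) * (stepBeta (s + 1) - 1)) * A s + V s + e s) :
    c * stepBeta N ^ 2 * A N ≤ V 0 + ∑ s, e s := by
  suffices hs : c * stepBeta N ^ 2 * A N + V N ≤ V 0 + ∑ s, e s by linarith [hV N]
  induction N with
  | zero => exact absurd hN (lt_irrefl _)
  | succ N ih =>
    have hl := h (Fin.last N)
    rw [Fin.sum_univ_castSucc]
    simp only [Fin.val_last] at hl
    rcases Nat.eq_zero_or_pos N with rfl | hN0
    -- As `β_1 = 1`, the initial gap has weight zero, so only `V 0` survives from the start.
    · simp only [stepBeta] at hl ⊢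
      norm_num at hl ⊢
      linarith
    · have h1 := ih hN0 (fun s hs => hA s (by omega)) (e := fun s => e s.castSucc)
        fun s => h s.castSucc
      have h2 : c * (stepBeta (N + 1) * (stepBeta (N + 1) - 1)) * A N ≤
          c * stepBeta N ^ 2 * A N := by
        refine mul_le_mul_of_nonneg_right (mul_le_mul_of_nonneg_left ?_ hc) (hA N (by omega))
        simp only [stepBeta]; push_cast
        nlinarith
      linarith

section

variable {N q : ℕ} {ε : ℝ} {Q : Set (Matrix (Fin n) (Fin n) ℝ)}
  {Φ : Matrix (Fin n) (Fin n) ℝ → (Fin k → Fin n → ℝ) → (Fin n → ℝ)}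
  {z : Fin N → Fin q → Fin k → Fin n → ℝ} {X Xmd Xag : ℕ → Matrix (Fin n) (Fin n) ℝ}

theorem IsACSARun.mem (h : IsACSARun ε Q Φ z X Xmd Xag) (hQ : Convex ℝ Q) {s : ℕ} (hs : s ≤ N) :
    X (s + 1) ∈ Q ∧ Xag (s + 1) ∈ Q := by
  induction s with
  | zero => exact ⟨h.init_mem, by rw [h.init_ag]; exact h.init_mem⟩
  | succ s ih =>
    obtain ⟨-, h2⟩ := ih (by omega)
    have h3 := (h.prox_step ⟨s, by omega⟩).1
    refine ⟨h3, ?_⟩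
    have h4 := h.ag_step ⟨s, by omega⟩
    simp only at h3 h4
    rw [h4]
    have hb := one_le_stepBeta (show 1 ≤ s + 1 by omega)
    have hb' := inv_le_one_of_one_le₀ hb
    exact hQ h3 h2 (by positivity) (by linarith) (by ring)

/-- Viewing the starting point as a prox step gives it the same optimality and uniqueness statements
as every other iterate. -/
theorem isProxStep_zero {x : Matrix (Fin n) (Fin n) ℝ} (hx : x ∈ Q) (hmin : IsMinOn dgf Q x) :
    IsProxStep Q 0 0 x := by
  refine ⟨hx, isMinOn_iff.2 fun W hW => ?_⟩
  have := isMinOn_iff.1 hmin W hW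
  rw [proxV_eq, proxV_eq]
  simpa [frobInner, dgf] using this

theorem bddAbove_dgf (hQ : IsCompact Q) : BddAbove (dgf '' Q) :=
  hQ.bddAbove_image ((continuous_frobInner continuous_id continuous_id).div_const _).continuousOn

theorem bddBelow_dgf (hQ : IsCompact Q) : BddBelow (dgf '' Q) :=
  hQ.bddBelow_image ((continuous_frobInner continuous_id continuous_id).div_const _).continuousOn

theorem dgf_sub_le_diam_sq (hQ : IsCompact Q) {x y : Matrix (Fin n) (Fin n) ℝ} (hx : x ∈ Q)
    (hy : y ∈ Q) : dgf y - dgf x ≤ diam Q ^ 2 := by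
  have h1 := le_csSup (bddAbove_dgf hQ) (Set.mem_image_of_mem dgf hy)
  have h2 := csInf_le (bddBelow_dgf hQ) (Set.mem_image_of_mem dgf hx)
  have h3 := csInf_le (bddBelow_dgf hQ) (Set.mem_image_of_mem dgf hy)
  rw [diam, Real.sq_sqrt (by linarith)]
  linarith

/-- Optimality of `x` makes the linear term `⟨x, y - x⟩` nonnegative, so `V(x, y) ≤ ω(y) - ω(x)`. -/
theorem proxV_le_diam_sq (hQ : IsCompact Q) (hQc : Convex ℝ Q) {x y : Matrix (Fin n) (Fin n) ℝ}
    (hx : x ∈ Q) (hmin : IsMinOn dgf Q x) (hy : y ∈ Q) : proxV x y ≤ diam Q ^ 2 := by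
  have h1 := (isProxStep_zero hx hmin).variational hQc hy
  rw [zero_add, sub_zero] at h1
  have h2 := dgf_sub_le_diam_sq hQ hx hy
  rw [proxV]; linarith

/-- A set of diameter zero is a singleton. -/
theorem eq_of_diam_eq_zero (hQ : IsCompact Q) (hQc : Convex ℝ Q) (hD : diam Q = 0)
    {x y : Matrix (Fin n) (Fin n) ℝ} (hx : x ∈ Q) (hy : y ∈ Q) : x = y := by
  have hm : ∀ w ∈ Q, ∀ v ∈ Q, dgf w ≤ dgf v := fun w hw v hv => by
    have := dgf_sub_le_diam_sq hQ hv hw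
    rw [hD] at this; linarith
  exact (isProxStep_zero hx (isMinOn_iff.2 fun v hv => hm x hx v hv)).unique hQc
    (isProxStep_zero hy (isMinOn_iff.2 fun v hv => hm y hy v hv)) rfl

/-- The stochastic error of one iteration, relative to a reference point `x`. -/
noncomputable def stepError (Φ : Matrix (Fin n) (Fin n) ℝ → (Fin k → Fin n → ℝ) → (Fin n → ℝ))
    (x : Matrix (Fin n) (Fin n) ℝ) (γ : ℝ) (X Xmd : Matrix (Fin n) (Fin n) ℝ)
    (ζ : Fin q → Fin k → Fin n → ℝ) : ℝ :=
  -(γ * frobInner (oracle Φ Xmd ζ - meanOracle Φ Xmd) (X - x)) +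
    4 * γ ^ 2 * frobInner (oracle Φ Xmd ζ - meanOracle Φ Xmd) (oracle Φ Xmd ζ - meanOracle Φ Xmd)

theorem IsACSARun.gap_le (h : IsACSARun ε Q Φ z X Xmd Xag) (hn : 0 < n) (hk : 3 ≤ k) (hε : 0 < ε)
    (hΦ : IsLeadingEigenvectorRule ε Φ) (hQsymm : ∀ X ∈ Q, X.IsSymm) (hQ : IsCompact Q)
    (hQc : Convex ℝ Q) {x : Matrix (Fin n) (Fin n) ℝ} (hx : x ∈ Q)
    (hmin : ∀ Y ∈ Q, smoothF k ε x ≤ smoothF k ε Y) (hN : 0 < N) {c : ℝ}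
    (hc : c = stepScale (constC k * n / ε) (Real.sqrt (1 / (q : ℝ))) (diam Q) N) :
    c * stepBeta N ^ 2 * (smoothF k ε (Xag (N + 1)) - smoothF k ε x) ≤
      diam Q ^ 2 + ∑ s : Fin N, stepError Φ x (stepBeta (s + 1) * c) (X (s + 1)) (Xmd (s + 1))
        (z s) := by
  have hC := one_le_constC hk
  have hc0 : 0 ≤ c := by
    rw [hc]
    exact stepScale_nonneg (by positivity) (Real.sqrt_nonneg _) (Real.sqrt_nonneg _) N
  have hMc := semiconcavityConst_mul_stepScale_le hn hk hε (Real.sqrt (1 / (q : ℝ)))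
    (diam Q) N
  rw [← hc] at hMc
  have ht := telescoped_bound hc0 (A := fun s => smoothF k ε (Xag (s + 1)) - smoothF k ε x)
    (V := fun s => proxV (X (s + 1)) x)
    (fun s => by rw [proxV_eq]; exact div_nonneg (frobInner_self_nonneg _) (by norm_num)) hN
    (fun s hs => sub_nonneg.2 (hmin _ (h.mem hQc hs).2))
    (e := fun s : Fin N => stepError Φ x (stepBeta (s + 1) * c) (X (s + 1)) (Xmd (s + 1)) (z s))
    (fun s => by
      obtain ⟨h1, h2⟩ := h.mem hQc s.2.le
      have hp := h.prox_step s
      rw [stepGamma_eq, ← hc] at hp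
      have := accelerated_step (F := smoothF k ε) (g := meanOracle Φ) hQc
        (fun X hX Y hY => smoothF_subgradient hn (by omega) hε hΦ (hQsymm X hX) (hQsymm Y hY))
        (fun X hX Y hY => smoothF_descent hn hk hε hΦ (hQsymm X hX) (hQsymm Y hY)) hc0
        (one_le_stepBeta (show 1 ≤ (s : ℕ) + 1 by omega)) hMc h1 h2 hx hp
      rw [← h.md_step s, ← h.ag_step s] at this
      exact this)
  refine ht.trans (add_le_add_left ?_ _)
  exact proxV_le_diam_sq hQ hQc h.init_mem h.init_min hx

end

/-! ### The rate -/

theorem sum_stepBeta_sq_le (N : ℕ) : ∑ s : Fin N, stepBeta (s + 1) ^ 2 ≤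
    ((N : ℝ) + 1) * (N + 2) * (2 * N + 3) / 24 := by
  rw [Fin.sum_univ_eq_sum_range fun s => stepBeta (s + 1) ^ 2]
  induction N with
  | zero => norm_num
  | succ N ih =>
    rw [Finset.sum_range_succ]
    simp only [stepBeta] at ih ⊢
    push_cast at ih ⊢
    nlinarith

/-- `N(N + 2) ≤ (N + 1)²` bounds `√N w`, and `19/6` is the value for which the last quadratic
inequality is an equality at `N = 1`. -/
theorem rate_aux {N : ℕ} (hN : 0 < N) {w : ℝ} (hw : 0 < w) (hw2 : w ^ 2 = ((N : ℝ) + 2) ^ 3) :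
    (w + ((N : ℝ) + 1) * (N + 2) * (2 * N + 3) / w) * Real.sqrt N ≤
      19 / 6 * ((N : ℝ) + 1) ^ 2 := by
  have hN1 : (1 : ℝ) ≤ N := by exact_mod_cast hN
  have h1 : Real.sqrt N * w ≤ ((N : ℝ) + 1) * (N + 2) := by
    refine abs_le_of_sq_le_sq' ?_ (by positivity) |>.2
    rw [mul_pow, hw2, Real.sq_sqrt (by positivity)]
    have : 0 ≤ ((N : ℝ) + 2) ^ 2 := by positivity
    nlinarith
  have h2 : (w + ((N : ℝ) + 1) * (N + 2) * (2 * N + 3) / w) * Real.sqrt N =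
      (Real.sqrt N * w) * (1 + ((N : ℝ) + 1) * (2 * N + 3) / (N + 2) ^ 2) := by
    have : ((N : ℝ) + 1) * (N + 2) * (2 * N + 3) / w =
        w * (((N : ℝ) + 1) * (2 * N + 3) / (N + 2) ^ 2) := by
      rw [div_eq_iff hw.ne']
      have : w * (((N : ℝ) + 1) * (2 * N + 3) / (N + 2) ^ 2) * w =
        w ^ 2 * (((N : ℝ) + 1) * (2 * N + 3) / (N + 2) ^ 2) := by ring
      rw [this, hw2]; field_simp
    rw [this]; ring
  rw [h2]
  refine (mul_le_mul_of_nonneg_right h1 (by positivity)).trans ?_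
  have h3 : ((N : ℝ) + 1) * (N + 2) * (1 + ((N : ℝ) + 1) * (2 * N + 3) / (N + 2) ^ 2) =
      ((N : ℝ) + 1) * (((N : ℝ) + 2) ^ 2 + (N + 1) * (2 * N + 3)) / (N + 2) := by
    field_simp
  rw [h3, div_le_iff₀ (by positivity)]
  have : ((N : ℝ) + 2) ^ 2 + (N + 1) * (2 * N + 3) ≤ 19 / 6 * ((N + 1) * (N + 2)) := by nlinarith
  nlinarith

/-- The convergence rate obtained from the telescoped bound. -/
theorem rate_bound {L σ D g S : ℝ} (hL : 0 < L) (hσ : 0 < σ) (hD : 0 < D) {N : ℕ} (hN : 0 < N)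
    (hS : S ≤ ((N : ℝ) + 1) * (N + 2) * (2 * N + 3) / 24)
    (h : stepScale L σ D N * stepBeta N ^ 2 * g ≤
      D ^ 2 + 4 * stepScale L σ D N ^ 2 * σ ^ 2 * S) :
    g ≤ 8 * L * D ^ 2 / (N * (N + 2)) + 4 * Real.sqrt 2 * D * σ / Real.sqrt N := by
  have hN0 : (0 : ℝ) < N := by exact_mod_cast hN
  set w : ℝ := ((N : ℝ) + 2) ^ (3 / 2 : ℝ) with hw
  have hw0 : 0 < w := by positivity
  have hw2 : w ^ 2 = ((N : ℝ) + 2) ^ 3 := by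
    rw [hw, ← Real.rpow_natCast, ← Real.rpow_mul (by positivity)]
    norm_num
  set b : ℝ := Real.sqrt 6 * D / (w * σ) with hb
  have h6 : 0 < Real.sqrt 6 := by positivity
  have hb0 : 0 < b := by positivity
  have ha0 : 0 < 1 / (2 * L) := by positivity
  set c : ℝ := stepScale L σ D N with hc
  have hc0 : 0 < c := lt_min ha0 hb0
  have hcb : c ≤ b := min_le_right _ _
  -- The reciprocal of a minimum is the larger reciprocal, hence at most the sum of the two; this
  -- splits the rate into a smooth and a noise part.
  have hinv : 1 / c ≤ 2 * L + 1 / b := by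
    rcases min_choice (1 / (2 * L)) b with h' | h'
    · have : c = 1 / (2 * L) := h'
      rw [this, one_div_one_div]
      have : 0 < 1 / b := by positivity
      linarith
    · have : c = b := h'
      rw [this]; linarith
  set P : ℝ := ((N : ℝ) + 1) * (N + 2) * (2 * N + 3) with hP
  have h1 : stepBeta N ^ 2 * g ≤ 2 * L * D ^ 2 + D * σ / Real.sqrt 6 * (w + P / w) := by
    have e1 : stepBeta N ^ 2 * g ≤ D ^ 2 * (1 / c) + 4 * c * σ ^ 2 * S := by
      refine le_of_mul_le_mul_left ?_ hc0
      have : c * (D ^ 2 * (1 / c) + 4 * c * σ ^ 2 * S) = D ^ 2 + 4 * c ^ 2 * σ ^ 2 * S := by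
        field_simp
      rw [this]; linarith
    have e2 := mul_le_mul_of_nonneg_left hinv (sq_nonneg D)
    have e3 : 4 * c * σ ^ 2 * S ≤ 4 * b * σ ^ 2 * (P / 24) :=
      (mul_le_mul_of_nonneg_left hS (by positivity)).trans
        (mul_le_mul_of_nonneg_right (by gcongr) (by positivity))
    have e4 : D ^ 2 * (2 * L + 1 / b) = 2 * L * D ^ 2 + D * σ / Real.sqrt 6 * w := by
      rw [hb]; field_simp
    have e5 : 4 * b * σ ^ 2 * (P / 24) = D * σ / Real.sqrt 6 * (P / w) := by
      have h66 : Real.sqrt 6 * Real.sqrt 6 = 6 := Real.mul_self_sqrt (by norm_num)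
      rw [hb]; field_simp
      linear_combination 4 * P * h66
    linarith
  have h2 := rate_aux hN hw0 hw2
  -- Equivalent to `19/6 ≤ √12`; this produces the `√2` of the noise term.
  have h12 : 19 / 6 * (1 / Real.sqrt 6) ≤ Real.sqrt 2 := by
    have e : Real.sqrt 2 * Real.sqrt 6 = Real.sqrt 12 := by
      rw [← Real.sqrt_mul (by norm_num)]; norm_num
    rw [mul_one_div, div_le_iff₀ h6, e]
    exact Real.le_sqrt_of_sq_le (by norm_num)
  have hsN : 0 < Real.sqrt N := by positivity
  have h3 : D * σ / Real.sqrt 6 * (w + P / w) ≤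
      Real.sqrt 2 * D * σ * (N + 1) ^ 2 / Real.sqrt N := by
    rw [le_div_iff₀ hsN]
    calc D * σ / Real.sqrt 6 * (w + P / w) * Real.sqrt N
        = D * σ / Real.sqrt 6 * ((w + P / w) * Real.sqrt N) := by ring
      _ ≤ D * σ / Real.sqrt 6 * (19 / 6 * ((N : ℝ) + 1) ^ 2) :=
          mul_le_mul_of_nonneg_left h2 (by positivity)
      _ = 19 / 6 * (1 / Real.sqrt 6) * (D * σ * ((N : ℝ) + 1) ^ 2) := by ring
      _ ≤ Real.sqrt 2 * (D * σ * ((N : ℝ) + 1) ^ 2) :=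
          mul_le_mul_of_nonneg_right h12 (by positivity)
      _ = _ := by ring
  have h4 : g ≤ 8 * L * D ^ 2 / (N + 1) ^ 2 + 4 * Real.sqrt 2 * D * σ / Real.sqrt N := by
    have : 0 < ((N : ℝ) + 1) ^ 2 / 4 := by positivity
    refine le_of_mul_le_mul_left ?_ this
    have e1 : stepBeta N ^ 2 = ((N : ℝ) + 1) ^ 2 / 4 := by unfold stepBeta; ring
    rw [← e1]
    refine h1.trans ((add_le_add_right h3 _).trans (le_of_eq ?_))
    rw [e1]; field_simp; ring
  refine h4.trans (add_le_add_left ?_ _)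
  exact div_le_div_of_nonneg_left (by positivity) (by positivity) (by nlinarith)

/-- The first term uses `N²ε² ≥ 4D²n`; in the second, `√n` cancels in the product and `Nq ≥
2(D/ε)²`. -/
theorem complexity_bound (hn : 0 < n) (hk : 3 ≤ k) {ε D : ℝ} (hε : 0 < ε) (hD : 0 < D) {N q : ℕ}
    (hN : 2 * D * Real.sqrt n / ε ≤ N) (hq : D / (ε * Real.sqrt n) ≤ q) :
    8 * n * constC k * D ^ 2 / (ε * N * (N + 2)) + 4 * Real.sqrt 2 * D / Real.sqrt (N * q) ≤
      (2 * constC k + 4) * ε := by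
  have hn' : (0 : ℝ) < n := by exact_mod_cast hn
  have hC := one_le_constC hk
  have hsn : 0 < Real.sqrt n := by positivity
  have hN0 : (0 : ℝ) < N := lt_of_lt_of_le (by positivity) hN
  have h1 : 8 * n * constC k * D ^ 2 / (ε * N * (N + 2)) ≤ 2 * constC k * ε := by
    rw [div_le_iff₀ (by positivity)]
    have e1 : (2 * D * Real.sqrt n) ^ 2 ≤ (N * ε) ^ 2 :=
      pow_le_pow_left₀ (by positivity) ((div_le_iff₀ hε).1 hN) 2
    rw [mul_pow, Real.sq_sqrt hn'.le] at e1
    have e2 : (N : ℝ) ^ 2 * ε ^ 2 ≤ ε ^ 2 * (N * (N + 2)) := by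
      nlinarith [mul_pos hN0 (by positivity : 0 < ε ^ 2)]
    calc 8 * n * constC k * D ^ 2 = 2 * constC k * ((2 * D) ^ 2 * n) := by ring
      _ ≤ 2 * constC k * (N * ε) ^ 2 := mul_le_mul_of_nonneg_left e1 (by linarith)
      _ ≤ 2 * constC k * (ε ^ 2 * (N * (N + 2))) := by
          refine mul_le_mul_of_nonneg_left ?_ (by linarith)
          rwa [mul_pow]
      _ = _ := by ring
  have h2 : 4 * Real.sqrt 2 * D / Real.sqrt (N * q) ≤ 4 * ε := by
    have hq0 : (0 : ℝ) < q := lt_of_lt_of_le (by positivity) hq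
    rw [div_le_iff₀ (by positivity)]
    have e1 : 2 * D * Real.sqrt n / ε * (D / (ε * Real.sqrt n)) = 2 * (D / ε) ^ 2 := by
      field_simp
    have e2 : 2 * (D / ε) ^ 2 ≤ N * q := by
      rw [← e1]; exact mul_le_mul hN hq (by positivity) hN0.le
    have e3 : Real.sqrt 2 * (D / ε) ≤ Real.sqrt (N * q) := by
      refine Real.le_sqrt_of_sq_le ?_
      rw [mul_pow, Real.sq_sqrt (by norm_num)]; exact e2
    calc 4 * Real.sqrt 2 * D = 4 * ε * (Real.sqrt 2 * (D / ε)) := by field_simp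
      _ ≤ _ := mul_le_mul_of_nonneg_left e3 (by positivity)
  linarith

end StochSmooth

/-! ### Bias, variance and measurability of the oracle. -/

namespace StochSmooth

open Matrix

variable {n k q : ℕ}

/-! ### Moments of the stochastic oracle -/

/-- The law of a batch of `q` samples. -/
noncomputable def batchLaw (n k q : ℕ) : Measure (Fin q → Fin k → Fin n → ℝ) :=
  Measure.pi fun _ : Fin q => gaussianSample n k

instance : IsProbabilityMeasure (batchLaw n k q) := by
  unfold batchLaw; infer_instance

section

variable {ε : ℝ} {Φ : Matrix (Fin n) (Fin n) ℝ → (Fin k → Fin n → ℝ) → (Fin n → ℝ)}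

theorem oracle_apply (X : Matrix (Fin n) (Fin n) ℝ) (ζ : Fin q → Fin k → Fin n → ℝ)
    (i j : Fin n) :
    oracle Φ X ζ i j = (1 / (q : ℝ)) * ∑ l, Φ X (ζ l) i * Φ X (ζ l) j := by
  simp [oracle, Matrix.sum_apply, vecMulVec_apply]

theorem measurable_mul_apply (hΦ : IsLeadingEigenvectorRule ε Φ) (X : Matrix (Fin n) (Fin n) ℝ)
    (i j : Fin n) : Measurable fun z => Φ X z i * Φ X z j :=
  ((measurable_pi_apply i).comp (hΦ.measurable_apply X)).mul
    ((measurable_pi_apply j).comp (hΦ.measurable_apply X))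

theorem abs_mul_apply_le (hΦ : IsLeadingEigenvectorRule ε Φ) {X : Matrix (Fin n) (Fin n) ℝ}
    (hX : X.IsSymm) (z : Fin k → Fin n → ℝ) (i j : Fin n) : |Φ X z i * Φ X z j| ≤ 1 := by
  rw [abs_mul]
  exact mul_le_one₀ (hΦ.abs_apply_le hX z i) (abs_nonneg _) (hΦ.abs_apply_le hX z j)

theorem abs_oracle_apply_le (hΦ : IsLeadingEigenvectorRule ε Φ) (hq : 0 < q)
    {X : Matrix (Fin n) (Fin n) ℝ} (hX : X.IsSymm) (ζ : Fin q → Fin k → Fin n → ℝ)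
    (i j : Fin n) : |oracle Φ X ζ i j| ≤ 1 := by
  have hq' : (0 : ℝ) < q := by exact_mod_cast hq
  rw [oracle_apply, abs_mul, abs_of_pos (by positivity), one_div, inv_mul_le_iff₀ hq', mul_one]
  refine (Finset.abs_sum_le_sum_abs _ _).trans ?_
  refine (Finset.sum_le_sum fun l _ => abs_mul_apply_le hΦ hX (ζ l) i j).trans ?_
  simp

theorem abs_meanOracle_apply_le (hΦ : IsLeadingEigenvectorRule ε Φ)
    {X : Matrix (Fin n) (Fin n) ℝ} (hX : X.IsSymm) (i j : Fin n) : |meanOracle Φ X i j| ≤ 1 := by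
  have := norm_integral_le_of_norm_le_const (μ := gaussianSample n k) (C := 1)
    (f := fun z => Φ X z i * Φ X z j) (.of_forall fun z => abs_mul_apply_le hΦ hX z i j)
  rw [probReal_univ, mul_one] at this
  exact this

theorem measurePreserving_eval_batch (l : Fin q) :
    MeasurePreserving (Function.eval l) (batchLaw n k q) (gaussianSample n k) :=
  measurePreserving_eval (fun _ : Fin q => gaussianSample n k) l

theorem integrable_oracle_apply (hΦ : IsLeadingEigenvectorRule ε Φ)
    {X : Matrix (Fin n) (Fin n) ℝ} (hX : X.IsSymm) (i j : Fin n) :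
    Integrable (fun ζ => oracle Φ X ζ i j) (batchLaw n k q) := by
  simp only [oracle_apply]
  exact (integrable_finsetSum _ fun l _ => (measurePreserving_eval_batch l).integrable_comp_of_integrable
    (integrable_mul_apply hΦ hX i j)).const_mul _

theorem integral_oracle_apply (hΦ : IsLeadingEigenvectorRule ε Φ) (hq : 0 < q)
    {X : Matrix (Fin n) (Fin n) ℝ} (hX : X.IsSymm) (i j : Fin n) :
    ∫ ζ, oracle Φ X ζ i j ∂batchLaw n k q = meanOracle Φ X i j := by
  have hq' : (q : ℝ) ≠ 0 := by exact_mod_cast hq.ne'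
  simp only [oracle_apply]
  have hI : ∀ l : Fin q, Integrable (fun ζ => Φ X (ζ l) i * Φ X (ζ l) j) (batchLaw n k q) :=
    fun l => (measurePreserving_eval_batch l).integrable_comp_of_integrable
      (integrable_mul_apply hΦ hX i j)
  rw [integral_const_mul, integral_finsetSum _ fun l _ => hI l]
  have h : ∀ l : Fin q, ∫ ζ, Φ X (ζ l) i * Φ X (ζ l) j ∂batchLaw n k q = meanOracle Φ X i j := by
    intro l
    have hm := measurePreserving_eval_batch (n := n) (k := k) l
    have := integral_map (μ := batchLaw n k q) hm.measurable.aemeasurable (f := fun z => Φ X z i * Φ X z j)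
      (measurable_mul_apply hΦ X i j).aestronglyMeasurable
    rw [hm.map_eq] at this
    exact this.symm
  rw [Finset.sum_congr rfl fun l _ => h l]
  simp only [Finset.sum_const, Finset.card_univ, Fintype.card_fin, nsmul_eq_mul]
  field_simp

/-- Variances of independent terms add, so averaging over `q` samples divides by `q`; the variance
is then bounded by the second moment, to be summed over entries. -/
theorem integral_oracle_apply_sub_sq_le (hΦ : IsLeadingEigenvectorRule ε Φ) (hq : 0 < q)
    {X : Matrix (Fin n) (Fin n) ℝ} (hX : X.IsSymm) (i j : Fin n) :
    ∫ ζ, (oracle Φ X ζ i j - meanOracle Φ X i j) ^ 2 ∂batchLaw n k q ≤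
      1 / q * ∫ z, (Φ X z i * Φ X z j) ^ 2 ∂gaussianSample n k := by
  have hq' : (0 : ℝ) < q := by exact_mod_cast hq
  have hf : MemLp (fun z => Φ X z i * Φ X z j) 2 (gaussianSample n k) :=
    MemLp.of_bound (measurable_mul_apply hΦ X i j).aestronglyMeasurable 1
      (.of_forall fun z => abs_mul_apply_le hΦ hX z i j)
  have hv := variance_sum_pi (μ := fun _ : Fin q => gaussianSample n k) fun _ => hf
  have h1 := variance_const_mul (1 / (q : ℝ))
    (∑ l : Fin q, fun ζ : Fin q → Fin k → Fin n → ℝ => Φ X (ζ l) i * Φ X (ζ l) j) (batchLaw n k q)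
  have e : (fun ζ => 1 / (q : ℝ) *
      (∑ l : Fin q, fun ζ : Fin q → Fin k → Fin n → ℝ => Φ X (ζ l) i * Φ X (ζ l) j) ζ) =
      fun ζ => oracle Φ X ζ i j := by
    ext ζ; rw [oracle_apply, Finset.sum_apply]
  rw [e, variance_eq_integral (integrable_oracle_apply hΦ hX i j).aemeasurable,
    integral_oracle_apply hΦ hq hX] at h1
  rw [h1, batchLaw, hv]
  have hle := variance_le_expectation_sq (μ := gaussianSample n k)
    (measurable_mul_apply hΦ X i j).aestronglyMeasurable
  simp only [Finset.sum_const, Finset.card_univ, Fintype.card_fin, nsmul_eq_mul]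
  have e2 : (1 / (q : ℝ)) ^ 2 * (q * variance (fun z => Φ X z i * Φ X z j) (gaussianSample n k)) =
      1 / q * variance (fun z => Φ X z i * Φ X z j) (gaussianSample n k) := by field_simp
  rw [e2]
  exact mul_le_mul_of_nonneg_left hle (by positivity)

theorem integrable_oracle_apply_sub_sq (hΦ : IsLeadingEigenvectorRule ε Φ) (hq : 0 < q)
    {X : Matrix (Fin n) (Fin n) ℝ} (hX : X.IsSymm) (i j : Fin n) :
    Integrable (fun ζ => (oracle Φ X ζ i j - meanOracle Φ X i j) ^ 2) (batchLaw n k q) := by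
  refine Integrable.of_bound (C := 4) (((integrable_oracle_apply hΦ hX i j).aestronglyMeasurable.sub
    aestronglyMeasurable_const).pow 2) (.of_forall fun ζ => ?_)
  have h1 := abs_le.1 (abs_oracle_apply_le hΦ hq hX ζ i j)
  have h2 := abs_le.1 (abs_meanOracle_apply_le hΦ hX i j)
  rw [Real.norm_eq_abs, abs_of_nonneg (sq_nonneg _)]
  nlinarith

/-- The entrywise second moments sum to `‖φφᵀ‖_F² = (φᵀφ)² = 1`, so no dimension enters. -/
theorem integral_frobInner_oracle_sub_sq_le (hΦ : IsLeadingEigenvectorRule ε Φ) (hq : 0 < q)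
    {X : Matrix (Fin n) (Fin n) ℝ} (hX : X.IsSymm) :
    ∫ ζ, frobInner (oracle Φ X ζ - meanOracle Φ X) (oracle Φ X ζ - meanOracle Φ X)
      ∂batchLaw n k q ≤ 1 / q := by
  have hI := fun i j => integrable_oracle_apply_sub_sq hΦ hq hX i j
  simp only [frobInner_eq_sum, Matrix.sub_apply, ← pow_two]
  rw [integral_finsetSum _ fun i _ => integrable_finsetSum _ fun j _ => hI i j]
  have hJ : ∀ i j, Integrable (fun z => (Φ X z i * Φ X z j) ^ 2) (gaussianSample n k) := by
    intro i j
    refine Integrable.of_bound (C := 1)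
      ((measurable_mul_apply hΦ X i j).pow_const 2).aestronglyMeasurable (.of_forall fun z => ?_)
    rw [Real.norm_eq_abs, abs_pow]
    exact pow_le_one₀ (abs_nonneg _) (abs_mul_apply_le hΦ hX z i j)
  calc ∑ i, ∫ ζ, ∑ j, (oracle Φ X ζ i j - meanOracle Φ X i j) ^ 2 ∂batchLaw n k q
      = ∑ i, ∑ j, ∫ ζ, (oracle Φ X ζ i j - meanOracle Φ X i j) ^ 2 ∂batchLaw n k q :=
        Finset.sum_congr rfl fun i _ => integral_finsetSum _ fun j _ => hI i j
    _ ≤ ∑ i, ∑ j, 1 / q * ∫ z, (Φ X z i * Φ X z j) ^ 2 ∂gaussianSample n k :=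
        Finset.sum_le_sum fun i _ => Finset.sum_le_sum fun j _ =>
          integral_oracle_apply_sub_sq_le hΦ hq hX i j
    _ = 1 / q * ∫ z, ∑ i, ∑ j, (Φ X z i * Φ X z j) ^ 2 ∂gaussianSample n k := by
        rw [integral_finsetSum _ fun i _ => integrable_finsetSum _ fun j _ => hJ i j,
          Finset.mul_sum]
        refine Finset.sum_congr rfl fun i _ => ?_
        rw [integral_finsetSum _ fun j _ => hJ i j, Finset.mul_sum]
    _ = 1 / q * ∫ z, (1 : ℝ) ∂gaussianSample n k := by
        congr 2
        ext z
        have := hΦ.unit X hX z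
        simp only [dotProduct, ← pow_two] at this
        simp only [mul_pow, ← Finset.mul_sum, this, mul_one]
    _ = 1 / q := by simp

theorem integral_frobInner_oracle_sub (hΦ : IsLeadingEigenvectorRule ε Φ) (hq : 0 < q)
    {X : Matrix (Fin n) (Fin n) ℝ} (hX : X.IsSymm) (H : Matrix (Fin n) (Fin n) ℝ) :
    Integrable (fun ζ => frobInner (oracle Φ X ζ - meanOracle Φ X) H) (batchLaw n k q) ∧
    ∫ ζ, frobInner (oracle Φ X ζ - meanOracle Φ X) H ∂batchLaw n k q = 0 := by
  have hI : ∀ i j, Integrable (fun ζ => (oracle Φ X ζ i j - meanOracle Φ X i j) * H i j)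
      (batchLaw n k q) := fun i j =>
    ((integrable_oracle_apply hΦ hX i j).sub (integrable_const _)).mul_const _
  simp only [frobInner_eq_sum, Matrix.sub_apply]
  refine ⟨integrable_finsetSum _ fun i _ => integrable_finsetSum _ fun j _ => hI i j, ?_⟩
  rw [integral_finsetSum _ fun i _ => integrable_finsetSum _ fun j _ => hI i j]
  refine Finset.sum_eq_zero fun i _ => ?_
  rw [integral_finsetSum _ fun j _ => hI i j]
  refine Finset.sum_eq_zero fun j _ => ?_
  rw [integral_mul_const, integral_sub (integrable_oracle_apply hΦ hX i j) (integrable_const _),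
    integral_oracle_apply hΦ hq hX]
  simp

theorem integral_stepError_le (hΦ : IsLeadingEigenvectorRule ε Φ) (hq : 0 < q)
    {x X Y : Matrix (Fin n) (Fin n) ℝ} (hY : Y.IsSymm) (γ : ℝ) :
    ∫ ζ, stepError Φ x γ X Y ζ ∂batchLaw n k q ≤ 4 * γ ^ 2 * (1 / q) := by
  obtain ⟨h1, h2⟩ := integral_frobInner_oracle_sub (k := k) hΦ hq hY (X - x)
  have h3 : Integrable (fun ζ => frobInner (oracle Φ Y ζ - meanOracle Φ Y)
      (oracle Φ Y ζ - meanOracle Φ Y)) (batchLaw n k q) := by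
    simp only [frobInner_eq_sum, Matrix.sub_apply, ← pow_two]
    exact integrable_finsetSum _ fun i _ => integrable_finsetSum _ fun j _ =>
      integrable_oracle_apply_sub_sq hΦ hq hY i j
  unfold stepError
  rw [integral_add (h1.const_mul _).fun_neg (h3.const_mul _), integral_neg, integral_const_mul,
    integral_const_mul, h2, mul_zero, neg_zero, zero_add]
  exact mul_le_mul_of_nonneg_left (integral_frobInner_oracle_sub_sq_le hΦ hq hY) (by positivity)

/-- A crude deterministic bound, used only for integrability; its dependence on `n` does not reach
the rate. -/
theorem abs_stepError_le (hΦ : IsLeadingEigenvectorRule ε Φ) (hq : 0 < q)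
    {x X Y : Matrix (Fin n) (Fin n) ℝ} (hY : Y.IsSymm) (γ : ℝ) {K : ℝ}
    (hK : frobNorm (X - x) ≤ K) (ζ : Fin q → Fin k → Fin n → ℝ) :
    |stepError Φ x γ X Y ζ| ≤ |γ| * (2 * n * K) + 4 * γ ^ 2 * (2 * n) ^ 2 := by
  have hδ : frobNorm (oracle Φ Y ζ - meanOracle Φ Y) ≤ 2 * n := by
    rw [frobNorm, Real.sqrt_le_left (by positivity), frobInner_eq_sum]
    have : ∀ i j : Fin n, (oracle Φ Y ζ - meanOracle Φ Y) i j * (oracle Φ Y ζ - meanOracle Φ Y) i j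
        ≤ 4 := by
      intro i j
      have h1 := abs_le.1 (abs_oracle_apply_le hΦ hq hY ζ i j)
      have h2 := abs_le.1 (abs_meanOracle_apply_le hΦ hY i j)
      rw [Matrix.sub_apply]; nlinarith
    refine (Finset.sum_le_sum fun i _ => Finset.sum_le_sum fun j _ => this i j).trans (le_of_eq ?_)
    simp; ring
  have h0 := frobNorm_nonneg (oracle Φ Y ζ - meanOracle Φ Y)
  have h1 := (abs_frobInner_le (oracle Φ Y ζ - meanOracle Φ Y) (X - x)).trans
    (mul_le_mul hδ hK (frobNorm_nonneg _) (by positivity))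
  have h2 := pow_le_pow_left₀ h0 hδ 2
  rw [frobNorm_sq] at h2
  refine (abs_add_le _ _).trans (add_le_add ?_ ?_)
  · rw [abs_neg, abs_mul]
    exact mul_le_mul_of_nonneg_left h1 (abs_nonneg _)
  · rw [abs_of_nonneg (mul_nonneg (by positivity) (frobInner_self_nonneg _))]
    exact mul_le_mul_of_nonneg_left h2 (by positivity)

end

/-! ### Measurability on matrices -/

instance : MeasurableSpace (Matrix (Fin n) (Fin n) ℝ) :=
  inferInstanceAs (MeasurableSpace (Fin n → Fin n → ℝ))

instance : BorelSpace (Matrix (Fin n) (Fin n) ℝ) :=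
  inferInstanceAs (BorelSpace (Fin n → Fin n → ℝ))

section

variable {ε : ℝ} {Φ : Matrix (Fin n) (Fin n) ℝ → (Fin k → Fin n → ℝ) → (Fin n → ℝ)}
  {α : Type*} [MeasurableSpace α]

theorem measurable_matrix_iff {f : α → Matrix (Fin n) (Fin n) ℝ} :
    Measurable f ↔ ∀ i j, Measurable fun a => f a i j := by
  refine (measurable_pi_iff (X := fun _ : Fin n => Fin n → ℝ)).trans (forall_congr' fun i => ?_)
  exact measurable_pi_iff

theorem _root_.Measurable.matrix_apply {f : α → Matrix (Fin n) (Fin n) ℝ} (hf : Measurable f)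
    (i j : Fin n) : Measurable fun a => f a i j := measurable_matrix_iff.1 hf i j

theorem _root_.Measurable.matrix_sub {f g : α → Matrix (Fin n) (Fin n) ℝ} (hf : Measurable f)
    (hg : Measurable g) : Measurable fun a => f a - g a :=
  measurable_matrix_iff.2 fun i j => (hf.matrix_apply i j).sub (hg.matrix_apply i j)

theorem _root_.Measurable.matrix_add {f g : α → Matrix (Fin n) (Fin n) ℝ} (hf : Measurable f)
    (hg : Measurable g) : Measurable fun a => f a + g a :=
  measurable_matrix_iff.2 fun i j => (hf.matrix_apply i j).add (hg.matrix_apply i j)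

theorem _root_.Measurable.matrix_smul {f : α → Matrix (Fin n) (Fin n) ℝ} (hf : Measurable f)
    (c : ℝ) : Measurable fun a => c • f a :=
  measurable_matrix_iff.2 fun i j => (hf.matrix_apply i j).const_mul c

theorem _root_.Measurable.frobInner {f g : α → Matrix (Fin n) (Fin n) ℝ} (hf : Measurable f)
    (hg : Measurable g) : Measurable fun a => frobInner (f a) (g a) := by
  simp only [frobInner_eq_sum]
  exact Finset.measurable_fun_sum _ fun i _ => Finset.measurable_fun_sum _ fun j _ =>
    (hf.matrix_apply i j).mul (hg.matrix_apply i j)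

theorem IsLeadingEigenvectorRule.measurable_comp (hΦ : IsLeadingEigenvectorRule ε Φ)
    {f : α → Matrix (Fin n) (Fin n) ℝ} {z : α → Fin k → Fin n → ℝ} (hf : Measurable f)
    (hz : Measurable z) (i : Fin n) : Measurable fun a => Φ (f a) (z a) i := by
  have h1 : Measurable fun a => ((f a : Fin n → Fin n → ℝ), z a) := Measurable.prodMk hf hz
  exact (measurable_pi_apply i).comp (hΦ.measurable.comp h1)

theorem measurable_oracle (hΦ : IsLeadingEigenvectorRule ε Φ)
    {f : α → Matrix (Fin n) (Fin n) ℝ} {z : α → Fin q → Fin k → Fin n → ℝ} (hf : Measurable f)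
    (hz : Measurable z) : Measurable fun a => oracle Φ (f a) (z a) := by
  refine measurable_matrix_iff.2 fun i j => ?_
  simp only [oracle_apply]
  have hz' : ∀ l, Measurable fun a => z a l := fun l => (measurable_pi_apply l).comp hz
  exact (Finset.measurable_fun_sum _ fun l _ => (hΦ.measurable_comp hf (hz' l) i).mul
    (hΦ.measurable_comp hf (hz' l) j)).const_mul _

theorem measurable_meanOracle (hΦ : IsLeadingEigenvectorRule ε Φ)
    {f : α → Matrix (Fin n) (Fin n) ℝ} (hf : Measurable f) :
    Measurable fun a => meanOracle Φ (f a) := by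
  refine measurable_matrix_iff.2 fun i j => ?_
  have h := ((hΦ.measurable_comp (hf.comp measurable_fst) measurable_snd i).mul
    (hΦ.measurable_comp (hf.comp measurable_fst) measurable_snd j)).stronglyMeasurable
  exact (h.integral_prod_right' (ν := gaussianSample n k)).measurable

theorem measurable_stepError (hΦ : IsLeadingEigenvectorRule ε Φ) (x : Matrix (Fin n) (Fin n) ℝ)
    (γ : ℝ) {f g : α → Matrix (Fin n) (Fin n) ℝ} {z : α → Fin q → Fin k → Fin n → ℝ}
    (hf : Measurable f) (hg : Measurable g) (hz : Measurable z) :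
    Measurable fun a => stepError Φ x γ (f a) (g a) (z a) := by
  have hδ := (measurable_oracle hΦ hg hz).matrix_sub (measurable_meanOracle hΦ hg)
  exact (((hδ.frobInner (hf.matrix_sub measurable_const)).const_mul _).neg).add
    ((hδ.frobInner hδ).const_mul _)

end

end StochSmooth

/-! ### Expectations along a random trajectory. -/

namespace StochSmooth

open Matrix

variable {n k N q : ℕ}

/-! ### The joint law of the samples -/

theorem hasLaw_pi_of_iIndepFun {ι E Ω : Type*} [Fintype ι] [MeasurableSpace E] [MeasurableSpace Ω]
    {P : Measure Ω} {Y : ι → Ω → E} {ν : Measure E} [IsProbabilityMeasure ν]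
    (hlaw : ∀ i, HasLaw (Y i) ν P) (h : iIndepFun Y P) :
    HasLaw (fun ω i => Y i ω) (Measure.pi fun _ : ι => ν) P := by
  rw [← Measure.infinitePi_eq_pi]
  exact h.hasLaw_infinitePi hlaw (aemeasurable_pi_lambda _ fun i => (hlaw i).aemeasurable)

theorem measurePreserving_curry_pi {ι κ E : Type*} [Fintype ι] [Fintype κ] [MeasurableSpace E]
    (ν : Measure E) [IsProbabilityMeasure ν] :
    MeasurePreserving (Function.curry : (ι × κ → E) → ι → κ → E)
      (Measure.pi fun _ => ν) (Measure.pi fun _ => Measure.pi fun _ => ν) := by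
  refine ⟨measurable_curry, ?_⟩
  have := Measure.infinitePi_map_curry (fun (_ : ι) (_ : κ) => ν)
  simp only [Measure.infinitePi_eq_pi] at this
  exact this

theorem hasLaw_batches {Ω : Type*} [MeasurableSpace Ω] {P : Measure Ω}
    {z : Fin N → Fin q → Fin k → Ω → (Fin n → ℝ)}
    (hlaw : ∀ s l i, HasLaw (z s l i) (gaussianVec n) P)
    (hindep : iIndepFun (fun p : Fin N × Fin q × Fin k => z p.1 p.2.1 p.2.2) P) :
    HasLaw (fun ω s l i => z s l i ω) (Measure.pi fun _ : Fin N => batchLaw n k q) P := by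
  have h1 := hasLaw_pi_of_iIndepFun (fun p : Fin N × Fin q × Fin k => hlaw p.1 p.2.1 p.2.2) hindep
  have h2 := measurePreserving_curry_pi (ι := Fin N) (κ := Fin q × Fin k) (gaussianVec n)
  have h3 := measurePreserving_pi (fun _ : Fin N => Measure.pi fun _ : Fin q × Fin k => gaussianVec n)
    (fun _ => Measure.pi fun _ : Fin q => Measure.pi fun _ : Fin k => gaussianVec n)
    fun _ => measurePreserving_curry_pi (ι := Fin q) (κ := Fin k) (gaussianVec n)
  have h4 := h3.comp h2
  refine ⟨h4.measurable.comp_aemeasurable h1.aemeasurable, ?_⟩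
  have h5 := AEMeasurable.map_map_of_aemeasurable (μ := P) h4.measurable.aemeasurable
    h1.aemeasurable
  rw [h1.map_eq, h4.map_eq] at h5
  exact h5.symm

/-- Replacing one coordinate of a product space by an independent copy preserves the law. -/
theorem measurePreserving_update {ι E : Type*} [Fintype ι] [DecidableEq ι] [MeasurableSpace E]
    (ν : Measure E) [IsProbabilityMeasure ν] (s : ι) :
    MeasurePreserving (fun p : (ι → E) × E => Function.update p.1 s p.2)
      ((Measure.pi fun _ => ν).prod ν) (Measure.pi fun _ => ν) := by
  have hm : Measurable fun p : (ι → E) × E => Function.update p.1 s p.2 := by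
    refine measurable_pi_lambda _ fun i => ?_
    rcases eq_or_ne i s with rfl | hi
    · simpa using measurable_snd
    · simpa [Function.update_of_ne hi, Function.comp_def] using
        (measurable_pi_apply i).comp (measurable_fst (α := ι → E) (β := E))
  refine ⟨hm, (Measure.pi_eq fun A hA => ?_).symm⟩
  rw [Measure.map_apply hm (MeasurableSet.univ_pi hA)]
  have e : (fun p : (ι → E) × E => Function.update p.1 s p.2) ⁻¹' (Set.univ.pi A) =
      (Set.univ.pi (Function.update A s Set.univ)) ×ˢ A s := by
    ext ⟨w, ζ⟩
    simp only [Set.mem_preimage, Set.mem_pi, Set.mem_univ, true_implies, Set.mem_prod]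
    constructor
    · intro h
      refine ⟨fun i => ?_, by simpa using h s⟩
      rcases eq_or_ne i s with rfl | hi
      · simp
      · simpa [Function.update_of_ne hi] using h i
    · rintro ⟨h1, h2⟩ i
      rcases eq_or_ne i s with rfl | hi
      · simpa using h2
      · simpa [Function.update_of_ne hi] using h1 i
  rw [e, Measure.prod_prod, Measure.pi_pi, ← Finset.mul_prod_erase _ _ (Finset.mem_univ s),
    ← Finset.mul_prod_erase _ (fun i => ν (A i)) (Finset.mem_univ s), Function.update_self,
    measure_univ, one_mul, mul_comm]
  congr 1
  refine Finset.prod_congr rfl fun i hi => ?_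
  rw [Function.update_of_ne (Finset.ne_of_mem_erase hi)]

/-- This takes the place of conditioning on the past: resampling coordinate `s` preserves the law,
so by Fubini it suffices to bound the average over that coordinate with the others frozen. -/
theorem integral_le_of_update {ι E : Type*} [Fintype ι] [DecidableEq ι] [MeasurableSpace E]
    (ν : Measure E) [IsProbabilityMeasure ν] (s : ι) {f : (ι → E) → ℝ} (hf : Measurable f) {B C : ℝ}
    (hB : ∀ w, |f w| ≤ B) (hC : ∀ w, ∫ ζ, f (Function.update w s ζ) ∂ν ≤ C) :
    ∫ w, f w ∂(Measure.pi fun _ => ν) ≤ C := by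
  have hp := measurePreserving_update ν s
  have h1 : ∫ w, f w ∂(Measure.pi fun _ => ν) =
      ∫ p : (ι → E) × E, f (Function.update p.1 s p.2) ∂((Measure.pi fun _ => ν).prod ν) := by
    rw [← integral_map (φ := fun p : (ι → E) × E => Function.update p.1 s p.2)
      hp.measurable.aemeasurable hf.aestronglyMeasurable, hp.map_eq]
  have hI : Integrable (fun p : (ι → E) × E => f (Function.update p.1 s p.2))
      ((Measure.pi fun _ => ν).prod ν) :=
    Integrable.of_bound (hf.comp hp.measurable).aestronglyMeasurable B
      (.of_forall fun p => hB _)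
  rw [h1, integral_prod _ hI]
  have h2 := integral_mono hI.integral_prod_left (integrable_const C) hC
  simpa using h2

/-! ### The iterates as functions of the samples -/

theorem abs_apply_le_frobNorm (A : Matrix (Fin n) (Fin n) ℝ) (i j : Fin n) :
    |A i j| ≤ frobNorm A := by
  refine Real.abs_le_sqrt ?_
  rw [frobInner_eq_sum_prod, pow_two]
  exact Finset.single_le_sum (f := fun p : Fin n × Fin n => A p.1 p.2 * A p.1 p.2)
    (fun p _ => mul_self_nonneg _) (Finset.mem_univ (i, j))

/-- The Euclidean projection, as a choice of prox step with zero gradient. -/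
noncomputable def proxPoint (Q : Set (Matrix (Fin n) (Fin n) ℝ)) (A : Matrix (Fin n) (Fin n) ℝ) :
    Matrix (Fin n) (Fin n) ℝ :=
  Classical.epsilon (IsProxStep Q A 0)

section

variable {Q : Set (Matrix (Fin n) (Fin n) ℝ)}

theorem isProxStep_proxPoint (hQ : IsCompact Q) (hne : Q.Nonempty)
    (A : Matrix (Fin n) (Fin n) ℝ) : IsProxStep Q A 0 (proxPoint Q A) :=
  Classical.epsilon_spec (exists_isProxStep hQ hne A 0)

theorem IsProxStep.eq_proxPoint (hQ : IsCompact Q) (hQc : Convex ℝ Q)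
    {X Y Z : Matrix (Fin n) (Fin n) ℝ} (h : IsProxStep Q X Y Z) : Z = proxPoint Q (X - Y) :=
  h.unique hQc (isProxStep_proxPoint hQ ⟨Z, h.1⟩ _) (sub_zero _).symm

theorem continuous_proxPoint (hQ : IsCompact Q) (hQc : Convex ℝ Q) (hne : Q.Nonempty) :
    Continuous (proxPoint Q) := by
  refine continuous_matrix fun i j => continuous_iff_continuousAt.2 fun A => ?_
  have hc : Filter.Tendsto (fun B : Matrix (Fin n) (Fin n) ℝ => frobNorm (B - A))
      (nhds A) (nhds 0) := by
    have : Continuous fun B : Matrix (Fin n) (Fin n) ℝ => frobNorm (B - A) :=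
      (continuous_frobInner (continuous_id.sub continuous_const)
        (continuous_id.sub continuous_const)).sqrt
    simpa [frobNorm, frobInner] using this.tendsto A
  rw [ContinuousAt, tendsto_iff_dist_tendsto_zero]
  refine squeeze_zero (fun _ => dist_nonneg) (fun B => ?_) hc
  rw [Real.dist_eq, ← Matrix.sub_apply]
  refine (abs_apply_le_frobNorm _ i j).trans ?_
  simpa using (isProxStep_proxPoint hQ hne B).frobNorm_sub_le hQc (isProxStep_proxPoint hQ hne A)

variable {ε : ℝ} {Φ : Matrix (Fin n) (Fin n) ℝ → (Fin k → Fin n → ℝ) → (Fin n → ℝ)}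

/-- Uniqueness of prox steps makes the iterates determined by the samples, so measurability need not
be assumed of the given trajectory. The invariance under updating batches `r ≥ s` says that state `s
+ 1` uses only the batches with index below `s`. -/
theorem exists_measurable_state (hΦ : IsLeadingEigenvectorRule ε Φ) (hQ : IsCompact Q)
    (hQc : Convex ℝ Q) (hne : Q.Nonempty) {s : ℕ} (hs : s ≤ N) :
    ∃ T A : (Fin N → Fin q → Fin k → Fin n → ℝ) → Matrix (Fin n) (Fin n) ℝ,
      Measurable T ∧ Measurable A ∧ (∀ w, T w ∈ Q ∧ A w ∈ Q) ∧
      (∀ w (r : Fin N) ζ, s ≤ r → T (Function.update w r ζ) = T w ∧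
        A (Function.update w r ζ) = A w) ∧
      ∀ w X Xmd Xag, IsACSARun ε Q Φ w X Xmd Xag → X (s + 1) = T w ∧ Xag (s + 1) = A w := by
  induction s with
  | zero =>
    refine ⟨fun _ => proxPoint Q 0, fun _ => proxPoint Q 0, measurable_const, measurable_const,
      fun _ => ⟨(isProxStep_proxPoint hQ hne 0).1, (isProxStep_proxPoint hQ hne 0).1⟩,
      fun _ _ _ _ => ⟨rfl, rfl⟩, fun w X Xmd Xag h => ?_⟩
    have h1 := (isProxStep_zero h.init_mem h.init_min).eq_proxPoint hQ hQc
    rw [sub_zero] at h1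
    exact ⟨h1, h.init_ag.trans h1⟩
  | succ s ih =>
    obtain ⟨T, A, hT, hA, hmem, hupd, hrun⟩ := ih (by omega)
    set b : ℝ := (stepBeta (s + 1))⁻¹ with hb
    set γ : ℝ := stepGamma (constC k * n / ε) (Real.sqrt (1 / (q : ℝ))) (diam Q) N (s + 1)
    set σ : Fin N := ⟨s, by omega⟩
    have hmd : Measurable fun w => b • T w + (1 - b) • A w :=
      (hT.matrix_smul b).matrix_add (hA.matrix_smul (1 - b))
    have hT' : Measurable fun w : Fin N → Fin q → Fin k → Fin n → ℝ =>
        proxPoint Q (T w - γ • oracle Φ (b • T w + (1 - b) • A w) (w σ)) :=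
      (continuous_proxPoint hQ hQc hne).measurable.comp
        (hT.matrix_sub ((measurable_oracle hΦ hmd (measurable_pi_apply σ)).matrix_smul γ))
    refine ⟨fun w => proxPoint Q (T w - γ • oracle Φ (b • T w + (1 - b) • A w) (w σ)),
      fun w => b • proxPoint Q (T w - γ • oracle Φ (b • T w + (1 - b) • A w) (w σ)) +
        (1 - b) • A w, hT', (hT'.matrix_smul b).matrix_add (hA.matrix_smul (1 - b)),
      fun w => ?_, fun w r ζ hr => ?_, fun w X Xmd Xag h => ?_⟩
    · have hm := (isProxStep_proxPoint hQ hne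
        (T w - γ • oracle Φ (b • T w + (1 - b) • A w) (w σ))).1
      have hβ := one_le_stepBeta (show 1 ≤ s + 1 by omega)
      have hβ' := inv_le_one_of_one_le₀ hβ
      exact ⟨hm, hQc hm (hmem w).2 (by positivity) (by linarith) (by ring)⟩
    · obtain ⟨h1, h2⟩ := hupd w r ζ (by omega)
      have h3 : Function.update w r ζ σ = w σ :=
        Function.update_of_ne (fun h => by rw [← h] at hr; simp [σ] at hr) _ _
      simp only [h1, h2, h3, and_self]
    · obtain ⟨h1, h2⟩ := hrun w X Xmd Xag h
      have h3 := h.md_step σ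
      have h4 := (h.prox_step σ).eq_proxPoint hQ hQc
      have h5 := h.ag_step σ
      simp only [σ] at h3 h4 h5
      rw [h1, h2] at h3
      rw [h3, h1] at h4
      rw [h4, h2] at h5
      exact ⟨h4, h5⟩

/-- The expected stochastic error of one iteration. -/
theorem integral_stepError_run_le (hΦ : IsLeadingEigenvectorRule ε Φ)
    (hQsymm : ∀ X ∈ Q, X.IsSymm) (hQ : IsCompact Q) (hQc : Convex ℝ Q) (hne : Q.Nonempty)
    (hq : 0 < q) {Ω : Type*} [MeasurableSpace Ω] {P : Measure Ω} [IsProbabilityMeasure P]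
    {w : Ω → Fin N → Fin q → Fin k → Fin n → ℝ}
    (hw : HasLaw w (Measure.pi fun _ : Fin N => batchLaw n k q) P)
    {X Xmd Xag : ℕ → Ω → Matrix (Fin n) (Fin n) ℝ}
    (hrun : ∀ ω, IsACSARun ε Q Φ (w ω) (fun t => X t ω) (fun t => Xmd t ω) (fun t => Xag t ω))
    (x : Matrix (Fin n) (Fin n) ℝ) (γ : ℝ) (s : Fin N) :
    Integrable (fun ω => stepError Φ x γ (X (s + 1) ω) (Xmd (s + 1) ω) (w ω s)) P ∧
    ∫ ω, stepError Φ x γ (X (s + 1) ω) (Xmd (s + 1) ω) (w ω s) ∂P ≤ 4 * γ ^ 2 * (1 / q) := by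
  obtain ⟨T, A, hT, hA, hmem, hupd, hst⟩ :=
    exists_measurable_state (N := N) (q := q) hΦ hQ hQc hne s.2.le
  set b : ℝ := (stepBeta (s + 1))⁻¹ with hb
  have hβ := one_le_stepBeta (show 1 ≤ (s : ℕ) + 1 by omega)
  have hβ' := inv_le_one_of_one_le₀ hβ
  have hmdQ : ∀ w, b • T w + (1 - b) • A w ∈ Q := fun w =>
    hQc (hmem w).1 (hmem w).2 (by positivity) (by linarith) (by ring)
  have hmd : Measurable fun w => b • T w + (1 - b) • A w :=
    (hT.matrix_smul b).matrix_add (hA.matrix_smul (1 - b))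
  set f : (Fin N → Fin q → Fin k → Fin n → ℝ) → ℝ := fun w =>
    stepError Φ x γ (T w) (b • T w + (1 - b) • A w) (w s) with hf
  have hfm : Measurable f := measurable_stepError hΦ x γ hT hmd (measurable_pi_apply s)
  obtain ⟨K, hK⟩ := hQ.bddAbove_image (f := fun X => frobNorm (X - x))
    ((continuous_frobInner (continuous_id.sub continuous_const)
      (continuous_id.sub continuous_const)).sqrt).continuousOn
  have hfb : ∀ w, |f w| ≤ |γ| * (2 * n * K) + 4 * γ ^ 2 * (2 * n) ^ 2 := fun w =>
    abs_stepError_le hΦ hq (hQsymm _ (hmdQ w)) γ (hK ⟨_, (hmem w).1, rfl⟩) _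
  have hfi : Integrable f (Measure.pi fun _ : Fin N => batchLaw n k q) :=
    Integrable.of_bound hfm.aestronglyMeasurable _ (.of_forall hfb)
  have e : (fun ω => stepError Φ x γ (X (s + 1) ω) (Xmd (s + 1) ω) (w ω s)) = fun ω => f (w ω) := by
    ext ω
    obtain ⟨h1, h2⟩ := hst (w ω) _ _ _ (hrun ω)
    have h3 := (hrun ω).md_step s
    rw [hf]
    simp only at h3 ⊢
    rw [h3, h1, h2]
  rw [e]
  rw [← hw.map_eq] at hfi
  refine ⟨hfi.comp_aemeasurable hw.aemeasurable, ?_⟩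
  rw [← integral_map hw.aemeasurable hfm.aestronglyMeasurable, hw.map_eq]
  -- The state entering iteration `s` does not see batch `s`, so only the oracle's argument varies
  -- and the one-step moment bound applies.
  refine integral_le_of_update (batchLaw n k q) s hfm hfb fun w => ?_
  simp only [hf, (hupd w s _ le_rfl).1, (hupd w s _ le_rfl).2, Function.update_self]
  exact integral_stepError_le hΦ hq (hQsymm _ (hmdQ w)) γ

theorem integrable_smoothF_output (hn : 0 < n) (hk : 0 < k) (hε : 0 < ε)
    (hΦ : IsLeadingEigenvectorRule ε Φ)
    (hQsymm : ∀ X ∈ Q, X.IsSymm) (hQ : IsCompact Q) (hQc : Convex ℝ Q) (hne : Q.Nonempty)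
    {Ω : Type*} [MeasurableSpace Ω] {P : Measure Ω} [IsProbabilityMeasure P]
    {w : Ω → Fin N → Fin q → Fin k → Fin n → ℝ}
    (hw : HasLaw w (Measure.pi fun _ : Fin N => batchLaw n k q) P)
    {X Xmd Xag : ℕ → Ω → Matrix (Fin n) (Fin n) ℝ}
    (hrun : ∀ ω, IsACSARun ε Q Φ (w ω) (fun t => X t ω) (fun t => Xmd t ω) (fun t => Xag t ω)) :
    Integrable (fun ω => smoothF k ε (Xag (N + 1) ω)) P := by
  obtain ⟨T, A, hT, hA, hmem, -, hst⟩ :=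
    exists_measurable_state (N := N) (q := q) hΦ hQ hQc hne le_rfl
  -- `smoothF` is known to be continuous only on symmetric matrices; symmetrising gives a continuous
  -- function on all matrices that agrees with it on `Q`.
  have hsymm : ∀ B : Matrix (Fin n) (Fin n) ℝ, ((1 / 2 : ℝ) • (B + Bᵀ)).IsSymm := fun B => by
    rw [Matrix.IsSymm, transpose_smul, transpose_add, transpose_transpose, add_comm]
  have hcont : Continuous fun B : Matrix (Fin n) (Fin n) ℝ => smoothF k ε ((1 / 2 : ℝ) • (B + Bᵀ)) :=
    (continuousOn_smoothF hn hk hε).comp_continuous (by fun_prop) hsymm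
  have hfix : ∀ B ∈ Q, (1 / 2 : ℝ) • (B + Bᵀ) = B := fun B hB => by
    rw [(hQsymm B hB).eq, ← two_smul ℝ, smul_smul]; norm_num
  have e : (fun ω => smoothF k ε (Xag (N + 1) ω)) =
      fun ω => smoothF k ε ((1 / 2 : ℝ) • (A (w ω) + (A (w ω))ᵀ)) := by
    ext ω
    rw [hfix _ (hmem _).2]
    exact congrArg _ (hst (w ω) _ _ _ (hrun ω)).2
  obtain ⟨K, hK⟩ := hQ.exists_bound_of_continuousOn hcont.continuousOn
  rw [e]
  exact Integrable.of_bound ((hcont.measurable.comp hA).comp_aemeasurable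
    hw.aemeasurable).aestronglyMeasurable K (.of_forall fun ω => hK _ (hmem _).2)

end

end StochSmooth

/-! ### Assembly of the two estimates. -/

theorem mainTheorem12 {n k : ℕ} (hn : 0 < n) (hk : 3 ≤ k) {ε : ℝ} (hε : 0 < ε)
    (Q : Set (Matrix (Fin n) (Fin n) ℝ)) (hQsymm : ∀ X ∈ Q, X.IsSymm)
    (hQcompact : IsCompact Q) (hQconvex : Convex ℝ Q) (hQne : Q.Nonempty)
    (Φ : Matrix (Fin n) (Fin n) ℝ → (Fin k → Fin n → ℝ) → (Fin n → ℝ))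
    (hΦ : StochSmooth.IsLeadingEigenvectorRule ε Φ)
    {N q : ℕ} (hq : 0 < q)
    {Ω : Type*} [MeasurableSpace Ω] (P : Measure Ω) [IsProbabilityMeasure P]
    (z : Fin N → Fin q → Fin k → Ω → (Fin n → ℝ))
    (hlaw : ∀ s l i, HasLaw (z s l i) (StochSmooth.gaussianVec n) P)
    (hindep : iIndepFun (fun p : Fin N × Fin q × Fin k => z p.1 p.2.1 p.2.2) P)
    (X Xmd Xag : ℕ → Ω → Matrix (Fin n) (Fin n) ℝ)
    (hrun : ∀ ω, StochSmooth.IsACSARun ε Q Φ (fun s l i => z s l i ω)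
      (fun t => X t ω) (fun t => Xmd t ω) (fun t => Xag t ω)) :
    (∀ Y ∈ Q, Integrable (fun w => StochSmooth.sampleF ε Y w) (StochSmooth.gaussianSample n k)) ∧
    (∃ Y ∈ Q, StochSmooth.smoothF k ε Y = StochSmooth.smoothOpt k ε Q) ∧
    Integrable (fun ω => StochSmooth.smoothF k ε (Xag (N + 1) ω)) P ∧
    (0 < N →
      ∫ ω, (StochSmooth.smoothF k ε (Xag (N + 1) ω) - StochSmooth.smoothOpt k ε Q) ∂P ≤
        8 * n * StochSmooth.constC k * StochSmooth.diam Q ^ 2 / (ε * N * (N + 2)) +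
          4 * Real.sqrt 2 * StochSmooth.diam Q / Real.sqrt (N * q)) ∧
    (N = ⌈2 * StochSmooth.diam Q * Real.sqrt n / ε⌉₊ →
      q = ⌈max 1 (StochSmooth.diam Q / (ε * Real.sqrt n))⌉₊ →
      ∫ ω, (StochSmooth.smoothF k ε (Xag (N + 1) ω) - StochSmooth.smoothOpt k ε Q) ∂P ≤
        (2 * StochSmooth.constC k + 4) * ε ∧
      (2 * StochSmooth.constC k + 4) * ε ≤ 10 * ε) := by
  open StochSmooth in
  have hk0 : 0 < k := by omega
  have hC := one_le_constC hk
  have hD0 : 0 ≤ diam Q := Real.sqrt_nonneg _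
  have hw := hasLaw_batches hlaw hindep
  have hI := integrable_smoothF_output hn hk0 hε hΦ hQsymm hQcompact hQconvex hQne hw hrun
  obtain ⟨x, hxQ, hxmin⟩ := hQcompact.exists_isMinOn hQne
    ((continuousOn_smoothF hn hk0 hε).mono fun X hX => hQsymm X hX)
  have hmin : ∀ Y ∈ Q, smoothF k ε x ≤ smoothF k ε Y := fun Y hY => isMinOn_iff.1 hxmin Y hY
  have hopt : smoothF k ε x = smoothOpt k ε Q :=
    (IsLeast.csInf_eq ⟨Set.mem_image_of_mem _ hxQ, by rintro _ ⟨Y, hY, rfl⟩; exact hmin Y hY⟩).symm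
  -- For diameter zero the step size vanishes and the telescoped inequality carries no information;
  -- but then `Q` is a single point and the gap is zero.
  have hone : diam Q = 0 →
      ∫ ω, (smoothF k ε (Xag (N + 1) ω) - smoothOpt k ε Q) ∂P = 0 := by
    intro hD
    have : ∀ ω, smoothF k ε (Xag (N + 1) ω) - smoothOpt k ε Q = 0 := fun ω => by
      rw [eq_of_diam_eq_zero hQcompact hQconvex hD ((hrun ω).mem hQconvex le_rfl).2 hxQ, hopt,
        sub_self]
    simp [this]
  have hq' : (0 : ℝ) < q := by exact_mod_cast hq
  have hn' : (0 : ℝ) < n := by exact_mod_cast hn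
  have hrate : 0 < N →
      ∫ ω, (smoothF k ε (Xag (N + 1) ω) - smoothOpt k ε Q) ∂P ≤
        8 * n * constC k * diam Q ^ 2 / (ε * N * (N + 2)) +
          4 * Real.sqrt 2 * diam Q / Real.sqrt (N * q) := by
    intro hN
    rcases hD0.eq_or_lt with hD | hD
    · rw [hone hD.symm, ← hD]; simp
    set σ : ℝ := Real.sqrt (1 / (q : ℝ)) with hσ
    have hσ0 : 0 < σ := by positivity
    have hσ2 : σ ^ 2 = 1 / q := Real.sq_sqrt (by positivity)
    set c : ℝ := stepScale (constC k * n / ε) σ (diam Q) N with hc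
    have herr := fun s : Fin N => integral_stepError_run_le hΦ hQsymm hQcompact hQconvex hQne hq hw
      hrun x (stepBeta (s + 1) * c) s
    have hgap : c * stepBeta N ^ 2 *
        ∫ ω, (smoothF k ε (Xag (N + 1) ω) - smoothOpt k ε Q) ∂P ≤
        diam Q ^ 2 + 4 * c ^ 2 * σ ^ 2 * ∑ s : Fin N, stepBeta (s + 1) ^ 2 := by
      have hJ := integrable_finsetSum Finset.univ fun (s : Fin N) _ => (herr s).1
      calc c * stepBeta N ^ 2 * ∫ ω, (smoothF k ε (Xag (N + 1) ω) - smoothOpt k ε Q) ∂P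
          = ∫ ω, c * stepBeta N ^ 2 * (smoothF k ε (Xag (N + 1) ω) - smoothF k ε x) ∂P := by
            rw [integral_const_mul, hopt]
        _ ≤ ∫ ω, (diam Q ^ 2 + ∑ s : Fin N, stepError Φ x (stepBeta (s + 1) * c)
              (X (s + 1) ω) (Xmd (s + 1) ω) (fun l i => z s l i ω)) ∂P :=
            integral_mono ((hI.sub (integrable_const _)).const_mul _)
              ((integrable_const _).add hJ) fun ω => (hrun ω).gap_le hn hk hε hΦ hQsymm hQcompact
                hQconvex hxQ hmin hN hc
        _ = diam Q ^ 2 + ∑ s : Fin N, ∫ ω, stepError Φ x (stepBeta (s + 1) * c)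
              (X (s + 1) ω) (Xmd (s + 1) ω) (fun l i => z s l i ω) ∂P := by
            rw [integral_add (integrable_const _) hJ,
              integral_finsetSum _ fun (s : Fin N) _ => (herr s).1]
            simp
        _ ≤ diam Q ^ 2 + ∑ s : Fin N, 4 * (stepBeta (s + 1) * c) ^ 2 * (1 / q) := by
            gcongr with s; exact (herr s).2
        _ = _ := by
            rw [Finset.mul_sum, hσ2]
            congr 1
            exact Finset.sum_congr rfl fun s _ => by ring
    refine (rate_bound (by positivity) hσ0 hD hN (sum_stepBeta_sq_le N) hgap).trans (le_of_eq ?_)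
    congr 1
    · field_simp
    · rw [hσ, Real.sqrt_div zero_le_one, Real.sqrt_one, Real.sqrt_mul (Nat.cast_nonneg N)]
      field_simp
  refine ⟨fun Y hY => integrable_sampleF hn hk0 hε (hQsymm Y hY), ⟨x, hxQ, hopt⟩, hI, hrate,
    fun hN hqq => ⟨?_, ?_⟩⟩
  -- The prescribed `N` is zero exactly when the diameter is zero, the case where the rate is
  -- unavailable and `hone` is used instead.
  · rcases hD0.eq_or_lt with hD | hD
    · rw [hone hD.symm]; positivity
    have h1 : 2 * diam Q * Real.sqrt n / ε ≤ N := by rw [hN]; exact Nat.le_ceil _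
    have h2 : diam Q / (ε * Real.sqrt n) ≤ q := by
      rw [hqq]; exact (le_max_right _ _).trans (Nat.le_ceil _)
    have hN0 : 0 < N := by
      have : (0 : ℝ) < N := lt_of_lt_of_le (by positivity) h1
      exact_mod_cast this
    exact (hrate hN0).trans (complexity_bound hn hk hε hD h1 h2)
  · have := constC_le_three hk
    exact mul_le_mul_of_nonneg_right (by linarith) hε.le
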